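/- **Setting.** Let $d\ge 3$. For $k\in\mathbb R^d$ let $k_x$ be its first component, $\Lambda(k)=k_x|k|^2$, $\Omega(k_1,k_2,k)=\Lambda(k_1)+\Lambda(k_2)-\Lambda(k)$. For $L>0$ let $\mathbb Z^d_L=L^{-1}\mathbb Z^d$. Let $0\le n_{\rm in}\le C_{\rm in}$ be an even function in $C_0^\infty(\mathbb R^d)$ whose support has diameter at most $D$, and let $\xi_k=\sqrt{n_{\rm in}(k)}\,\eta_k$ for $k\in\mathbb Z^d_L$, where the $\eta_k$ are centred complex Gaussian variables with $\mathbb E|\eta_k|^2=1$ (standard circular for $k\neq0$, real for $k=0$), $\eta_{-k}=\overline{\eta_k}$, and $\eta_k$ is independent of $\{\eta_{k'}\}_{k'\ne k,-k}$. For $\lambda,\nu>0$ put $$\mathcal T(\phi,\psi)_k(t)=\frac{i\lambda}{L^d}\sum_{\substack{k_1,k_2\in\mathbb Z_L^d\\ k_1+k_2=k}}\int_0^t k_x\,\phi_{k_1}(s)\psi_{k_2}(s)\,e^{is\Omega(k_1,k_2,k)-\nu|k|^2(t-s)}\,ds .$$ For a binary tree $T$ let $\mathcal J_T=\xi$ if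 $T$ is a single node, and $\mathcal J_T=\mathcal T(\mathcal J_{T_1},\mathcal J_{T_2})$ if $T_1,T_2$ are the subtrees at the two children of the root; let $l(T)$ be the number of branching nodes of $T$. The first correction to the energy spectrum is $$n^{(1)}(k)=\sum_{l(T)+l(T')=2}\mathbb E\big[(\mathcal J_T)_k\overline{(\mathcal J_{T'})_k}\big](t).$$ The collision operator is $$\mathcal K(n)(k)=k_x^2\int n(k_1)n(k-k_1)\,\delta(\Omega(k_1,k-k_1,k))\,dk_1-2n(k)\int k_x(k_x-k_{1x})\,n(k_1)\,\delta(\Omega(k_1,k-k_1,k))\,dk_1 ,$$ where $\int F\,\delta(\Phi)=\lim_{h\to0^+}\frac1{2h}\int_{|\Phi|\le h}F$, and $\mathcal K(n)(k)=0$ if $k_x=0$. Put $\alpha=\lambda L^{-d/2}$, let $\varepsilon>0$, $T_{\max}=L^{-\varepsilon}\alpha^{-2}$, $T_{\rm kin}=\frac1{4\pi\alpha^2}$, $l_d=(\nu T_{\max})^{1/2}$, and $$\mathrm{Err}_D(k_x)=\begin{cases}D^{d+1},&|k_x|\le D,\\ D^{d-1}(|k_x|^2+D|k_x|),&|k_x|>D.\end{cases}$$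 **Statement.** There are constants $C_1,B>0$ depending only on $d$ such that, with $\theta=C_1^{-1}\varepsilon$, the following holds. Let $c,C_2,D>0$. There is a constant $C$ depending only on $d,c,C_2,D$ such that for all $\varepsilon,\epsilon_1>0$ and all $n_{\rm in},C_{\rm in}$ as above, if $L$ is large enough (depending on all the quantities named so far), $\alpha^{-1}\le L^{1/2}$, $\nu\ge c^2T_{\max}^{-1}$ (so that $l_d\ge c$) and $D\le C_2l_d^{-1}$, then for all $L^\varepsilon\le t\le T_{\max}$ and all $k\in\mathbb Z^d_L$: 1. if $D\ge1$ and $|k|\le\epsilon_1l_d^{-1}$, then the two integrals in $\mathcal K(n_{\rm in})(k)$ exist when $k_x\neq0$, and $$\Big|n^{(1)}(k)-\frac t{T_{\rm kin}}\mathcal K(n_{\rm in})(k)\Big|\le C\,L^{-\theta}\frac{T_{\max}}{T_{\rm kin}}+B\,C_{\rm in}^2\,\epsilon_1\,\mathrm{Err}_D(k_x)\frac{T_{\max}}{T_{\rm kin}};$$ 2. if $|k|\ge2C_2l_d^{-1}$, then $n^{(1)}(k)=0$. -/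

import Mathlib

open MeasureTheory ProbabilityTheory Filter Topology
open scoped ContDiff ComplexConjugate

noncomputable section

namespace ZK

variable {d : ℕ} [NeZero d]

/-- The wave vector space `ℝ^d` with its Euclidean norm. -/
abbrev Vec (d : ℕ) : Type := EuclideanSpace ℝ (Fin d)

/-- The first component `k_x` of a wave vector. -/
def kx (k : Vec d) : ℝ := k 0

/-- The dispersion relation `Λ(k) = k_x |k|²`. -/
def disp (k : Vec d) : ℝ := kx k * ‖k‖ ^ 2

/-- The resonance function `Ω(k₁, k₂, k) = Λ(k₁) + Λ(k₂) - Λ(k)`. -/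
def Om (k₁ k₂ k : Vec d) : ℝ := disp k₁ + disp k₂ - disp k

/-- The point `K / L` of the lattice `ℤ_L^d`; lattice points are indexed by `K ∈ ℤ^d`. -/
def pt (L : ℝ) (K : Fin d → ℤ) : Vec d := WithLp.toLp 2 (fun i => (K i : ℝ) / L)

/-! ### The Gaussian initial data -/

/-- The law of a standard complex Gaussian `g`: independent centred real and imaginary parts of
variance `1/2`, so that `𝔼 |g|² = 1`. -/
def stdComplexGaussian : Measure ℂ :=
  ((gaussianReal 0 (1 / 2)).prod (gaussianReal 0 (1 / 2))).map Complex.measurableEquivRealProd.symm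

/-- The random Fourier coefficients `η_k`: normalised centred Gaussians with `η_{-k} = conj η_k`,
each `η_k` being independent of the family `(η_{k'})`, `k' ≠ k, -k`. The symmetry forces `η_0` to
be real. -/
structure IsGaussianData {S : Type*} [MeasurableSpace S] (μ : Measure S)
    (η : (Fin d → ℤ) → S → ℂ) : Prop where
  measurable : ∀ K, Measurable (η K)
  law : ∀ K, K ≠ 0 → μ.map (η K) = stdComplexGaussian
  law_zero : μ.map (η 0) = (gaussianReal 0 1).map (fun x : ℝ => (x : ℂ))
  symm : ∀ K w, η (-K) w = conj (η K w)
  indep : ∀ K, IndepFun (η K) (fun w (K' : {K' : Fin d → ℤ // K' ≠ K ∧ K' ≠ -K}) => η K' w) μ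

/-- `ξ_k = √(n_in(k)) η_k`. -/
def xi {S : Type*} (L : ℝ) (nin : Vec d → ℝ) (η : (Fin d → ℤ) → S → ℂ) (w : S)
    (K : Fin d → ℤ) : ℂ :=
  (Real.sqrt (nin (pt L K)) : ℂ) * η K w

/-! ### The perturbation expansion -/

/-- The bilinear Duhamel operator
`T(φ, ψ)_k(t) = (iλ / L^d) ∑_{k₁ + k₂ = k} ∫₀ᵗ k_x φ_{k₁} ψ_{k₂} e^{i s Ω(k₁,k₂,k) - ν |k|² (t-s)} ds`. -/
def duhamel (L lam ν : ℝ) (φ ψ : ℝ → (Fin d → ℤ) → ℂ) (t : ℝ) (K : Fin d → ℤ) : ℂ :=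
  Complex.I * (lam : ℂ) / (L : ℂ) ^ d *
    ∑' K₁ : Fin d → ℤ, ∫ s in (0 : ℝ)..t,
      (kx (pt L K) : ℂ) * φ s K₁ * ψ s (K - K₁) *
        Complex.exp (Complex.I * (s * Om (pt L K₁) (pt L (K - K₁)) (pt L K) : ℝ)
          - (ν * ‖pt L K‖ ^ 2 * (t - s) : ℝ))

/-- The term of the expansion attached to a binary tree: `ξ` at a leaf, and the Duhamel operator
applied to the terms of the two subtrees at a branch. -/
def treeTerm (L lam ν : ℝ) (ξ : (Fin d → ℤ) → ℂ) : BinaryTree Unit → ℝ → (Fin d → ℤ) → ℂ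
  | .nil => fun _ K => ξ K
  | .node _ l r => duhamel L lam ν (treeTerm L lam ν ξ l) (treeTerm L lam ν ξ r)

/-- The `j`-th correction to the energy spectrum: the sum of `𝔼 (J_T)_k conj (J_{T'})_k` over the
pairs of binary trees with `2j` branches in total, i.e. the terms of order `λ^{2j}`. -/
def nCorr {S : Type*} [MeasurableSpace S] (μ : Measure S) (L lam ν : ℝ) (nin : Vec d → ℝ)
    (η : (Fin d → ℤ) → S → ℂ) (j : ℕ) (t : ℝ) (K : Fin d → ℤ) : ℂ :=
  ∑ p ∈ Finset.HasAntidiagonal.antidiagonal (2 * j),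
    ∑ T ∈ BinaryTree.treesOfNumNodesEq p.1, ∑ T' ∈ BinaryTree.treesOfNumNodesEq p.2,
      ∫ w, treeTerm L lam ν (xi L nin η w) T t K *
        conj (treeTerm L lam ν (xi L nin η w) T' t K) ∂μ

/-! ### The wave kinetic operator -/

/-- `∫ F(x) δ(Φ(x)) dx` exists and equals `I`. -/
def HasDeltaIntegral (F Φ : Vec d → ℝ) (I : ℝ) : Prop :=
  Tendsto (fun h : ℝ => (2 * h)⁻¹ * ∫ x in {x | |Φ x| ≤ h}, F x) (𝓝[>] 0) (𝓝 I)

/-- The value of `∫ F(x) δ(Φ(x)) dx`. -/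
def deltaIntegral (F Φ : Vec d → ℝ) : ℝ :=
  limUnder (𝓝[>] (0 : ℝ)) (fun h : ℝ => (2 * h)⁻¹ * ∫ x in {x | |Φ x| ≤ h}, F x)

/-- The integrand of the gain term, as a function of `k₁`, with `k₂ = k - k₁`. -/
def gain (n : Vec d → ℝ) (k k₁ : Vec d) : ℝ := n k₁ * n (k - k₁)

/-- The integrand of the loss term, as a function of `k₁`. -/
def loss (n : Vec d → ℝ) (k k₁ : Vec d) : ℝ := kx k * (kx k - kx k₁) * n k₁

/-- The collision operator `𝒦(n)(k)`. It vanishes if `k_x = 0`. -/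
def collision (n : Vec d → ℝ) (k : Vec d) : ℝ :=
  kx k ^ 2 * deltaIntegral (gain n k) (fun k₁ => Om k₁ (k - k₁) k)
    - 2 * n k * deltaIntegral (loss n k) (fun k₁ => Om k₁ (k - k₁) k)

/-- Both integrals in `𝒦(n)(k)` exist. -/
def CollisionExists (n : Vec d → ℝ) (k : Vec d) : Prop :=
  (∃ I, HasDeltaIntegral (gain n k) (fun k₁ => Om k₁ (k - k₁) k) I) ∧
    ∃ I, HasDeltaIntegral (loss n k) (fun k₁ => Om k₁ (k - k₁) k) I

/-! ### The parameters -/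

/-- The strength of the nonlinearity, `α = λ L^{-d/2}`. -/
def alpha (d : ℕ) (L lam : ℝ) : ℝ := lam * L ^ (-(d : ℝ) / 2)

/-- `T_max = L^{-ε} α^{-2}`. -/
def Tmax (d : ℕ) (L lam ε : ℝ) : ℝ := L ^ (-ε) * (alpha d L lam ^ 2)⁻¹

/-- The kinetic time `T_kin = 1 / (4 π α²)`. -/
def Tkin (d : ℕ) (L lam : ℝ) : ℝ := 1 / (4 * Real.pi * alpha d L lam ^ 2)

/-- The dissipation length `l_d = (ν T_max)^{1/2}`. -/
def dissLength (d : ℕ) (L lam ε ν : ℝ) : ℝ := Real.sqrt (ν * Tmax d L lam ε)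

/-- The error function `Err_D(k_x)` in dimension `d`. -/
def errD (d : ℕ) (D x : ℝ) : ℝ :=
  if |x| ≤ D then D ^ (d + 1) else D ^ (d - 1) * (|x| ^ 2 + D * |x|)

end ZK

end

noncomputable section

namespace ZK

/-! ### Gaussian moments -/

/-! The first correction involves only trees with at most two branches, so each expectation is a
fourth moment of the Gaussian data. Wick's formula (`wick`) collapses it to a single lattice sum
over `k₁` (`nCorr_eq`) of an amplitude times `timeKernel`, a damped form of `∫₀ᵗ (t-u) cos(uΩ) du`.
It remains to replace this sum by `π t δ(Ω)`, uniformly in `k`.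

From sum to integral: at fixed time `u` the summand is a smooth compactly supported amplitude times
`e^{iuΩ}`. Each derivative costs at most `1 + |u|` and the mesh is `1/L`, so the discretisation
error is smaller than any power of `(1+u)/L` (`norm_latSum_osc_sub_integral_le`). Since `t ≤ T_max ≤
L^{1-ε}`, a power of order `1/ε` makes it negligible; no arithmetic of the lattice enters.

From integral to delta function: two integrations by parts write `timeKernel` as a superposition
over `r ∈ [0,t]` of Fejér kernels of mass `πr`, with total mass `π · damp a t`. The Fejér kernel
minus the indicator of `[-h,h]` normalised to the same mass (`fejerDefect`) has integral zero, and
must be shown to be small when composed with the resonance function. In the centred variable `q =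
k/2 - k₁` that function is a quadratic form minus the constant `(3/4) k_x|k|²`. Averaging over the
dilations `q ↦ √s q`, along which the form is linear in `s`, reduces the estimate to one dimension
without parametrising the resonant hypersurface (`abs_integral_mul_fejerDefect_res_le`). The same
estimate shows that the shell averages are Cauchy, so that the integrals in the collision operator
exist.

This bound degenerates as `k_x → 0`. There one uses that the resonance function has density
`O((|k_x||k|)^{-1/2})` on balls (`lintegral_closedBall_comp_res_le`; `d ≥ 3` supplies a second
definite direction of the form), that it is even in `q`, and that the amplitudes are odd in `q` at
`k = 0`, which gains a factor `|k|`. With the prefactor `k_x` the contribution is `O(√(|k_x||k|))`.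
A threshold `η` for `|k_x|` balances the two regimes (`exists_abs_kx_mul_integral_fejerDefect_le`).

Finally `damp a t` is replaced by `t`; since `ν|k|²t ≤ ε₁²` this costs `O(t ε₁)`, the second error
term of the statement. All other errors are a constant depending on `n_in` times `T_max` times a
power of `L^{-ε}`, and a spare power of `L` absorbs the constant. By evenness `n_in` lives in the
ball of radius `D/2`, so for `|k| > D` both the correction and the collision term vanish. -/

theorem integral_pow_gaussianReal (v : NNReal) :
    (∫ x, x ^ 1 ∂gaussianReal 0 v) = 0 ∧ (∫ x, x ^ 2 ∂gaussianReal 0 v) = v ∧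
      (∫ x, x ^ 3 ∂gaussianReal 0 v) = 0 ∧ (∫ x, x ^ 4 ∂gaussianReal 0 v) = 3 * v ^ 2 := by
  -- Moments are the derivatives at `0` of the moment generating function `exp(vt²/2)`; all its
  -- derivatives are polynomials times itself, which `hder` propagates.
  have key : ∀ n : ℕ, (∫ x, x ^ n ∂gaussianReal 0 v) =
      iteratedDeriv n (fun t : ℝ => Real.exp (v * t ^ 2 / 2)) 0 := by
    intro n
    have h := iteratedDeriv_mgf_zero (X := (id : ℝ → ℝ)) (μ := gaussianReal 0 v)
      (by rw [integrableExpSet_id_gaussianReal]; simp) n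
    rw [mgf_id_gaussianReal] at h
    simpa using h.symm
  have hE : ∀ t : ℝ, HasDerivAt (fun t : ℝ => Real.exp (v * t ^ 2 / 2))
      (v * t * Real.exp (v * t ^ 2 / 2)) t := by
    intro t
    have h := (((hasDerivAt_pow 2 t).const_mul (v : ℝ)).div_const 2).exp
    convert h using 1
    push_cast
    ring
  have hder : ∀ p p' : ℝ → ℝ, (∀ t, HasDerivAt p (p' t) t) →
      deriv (fun t => p t * Real.exp (v * t ^ 2 / 2)) =
        fun t => (p' t + v * t * p t) * Real.exp (v * t ^ 2 / 2) := by
    intro p p' hp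
    funext t
    rw [((hp t).fun_mul (hE t)).deriv]
    ring
  have h1 : deriv (fun t : ℝ => Real.exp (v * t ^ 2 / 2)) =
      fun t => (v * t) * Real.exp (v * t ^ 2 / 2) := by
    funext t
    rw [(hE t).deriv]
  have h2 := hder (fun t => v * t) (fun _ => v) fun t => by
    simpa using (hasDerivAt_id t).const_mul (v : ℝ)
  have h3 := hder (fun t => v + v * t * (v * t)) (fun t => 2 * v ^ 2 * t) fun t => by
    have h := ((hasDerivAt_id t).const_mul (v : ℝ))
    convert! (h.mul h).const_add (v : ℝ) using 1
    simp; ring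
  have h4 := hder (fun t => 2 * v ^ 2 * t + v * t * (v + v * t * (v * t)))
      (fun t => 3 * v ^ 2 + 3 * v ^ 3 * t ^ 2) fun t => by
    have h := ((hasDerivAt_id t).const_mul (3 * (v : ℝ) ^ 2)).add
      ((hasDerivAt_pow 3 t).const_mul ((v : ℝ) ^ 3))
    convert! h using 1
    · funext t; simp; ring
    · simp; ring
  simp only [key, iteratedDeriv_eq_iterate, Function.iterate_succ, Function.iterate_zero,
    Function.comp_apply, id, h1, h2, h3, h4]
  simp

theorem integrable_pow_gaussianReal (v : NNReal) (n : ℕ) :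
    Integrable (fun x : ℝ => x ^ n) (gaussianReal 0 v) := by
  rcases Nat.eq_zero_or_pos n with rfl | hn
  · simp
  · have h := (memLp_id_gaussianReal (μ := 0) (v := v) n).integrable_norm_pow hn.ne'
    refine (integrable_norm_iff (by fun_prop)).1 ?_
    simpa using h

/-- Fubini on each monomial in the real and imaginary parts. The one-dimensional moments enter as an
abstract table `m`, so that every complex moment becomes a finite computation. -/
theorem integral_stdComplexGaussian {n : ℕ} (g : ℂ → ℂ) (hg : Measurable g) (c : Fin n → ℂ)
    (a b : Fin n → ℕ) (m : ℕ → ℝ) (hm : ∀ j, m j = ∫ x, x ^ j ∂gaussianReal 0 (1 / 2))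
    (h : ∀ x y : ℝ, g (x + y * Complex.I) = ∑ i, c i * ((x : ℂ) ^ a i * (y : ℂ) ^ b i)) :
    ∫ z, g z ∂stdComplexGaussian =
      ∑ i, c i * ((m (a i) : ℂ) * (m (b i) : ℂ)) := by
  have hint : ∀ m : ℕ, Integrable (fun x : ℝ => (x : ℂ) ^ m) (gaussianReal 0 (1 / 2)) := by
    intro m
    simpa using (integrable_pow_gaussianReal (1 / 2) m).ofReal (𝕜 := ℂ)
  unfold stdComplexGaussian
  rw [integral_map (by fun_prop) hg.aestronglyMeasurable]
  have : ∀ p : ℝ × ℝ, g (Complex.measurableEquivRealProd.symm p) =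
      ∑ i, c i * ((p.1 : ℂ) ^ a i * (p.2 : ℂ) ^ b i) := by
    intro p
    rw [← h]
    congr 1
    apply Complex.ext <;> simp [Complex.measurableEquivRealProd]
  simp_rw [this]
  rw [integral_finsetSum]
  · refine Finset.sum_congr rfl fun i _ => ?_
    rw [integral_const_mul, integral_prod_mul (fun x : ℝ => (x : ℂ) ^ a i)
      (fun x : ℝ => (x : ℂ) ^ b i)]
    rw [hm, hm, ← integral_complex_ofReal, ← integral_complex_ofReal]
    simp
  · intro i _
    exact ((hint (a i)).mul_prod (hint (b i))).const_mul _

theorem stdComplexGaussian_moments :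
    (∫ z, z ∂stdComplexGaussian) = 0 ∧ (∫ z, z ^ 2 ∂stdComplexGaussian) = 0 ∧
    (∫ z, z * conj z ∂stdComplexGaussian) = 1 ∧ (∫ z, z ^ 4 ∂stdComplexGaussian) = 0 ∧
    (∫ z, z ^ 3 * conj z ∂stdComplexGaussian) = 0 ∧
    (∫ z, z ^ 2 * conj z ^ 2 ∂stdComplexGaussian) = 2 := by
  obtain ⟨m1, m2, m3, m4⟩ := integral_pow_gaussianReal (1 / 2)
  obtain ⟨m, hm⟩ : ∃ m : ℕ → ℝ, ∀ j, m j = ∫ x, x ^ j ∂gaussianReal 0 (1 / 2) :=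
    ⟨_, fun _ => rfl⟩
  have m0 : m 0 = 1 := by simp [hm]
  rw [← hm] at m1 m2 m3 m4
  norm_num at m2 m4
  have hI2 : Complex.I ^ 2 = -1 := Complex.I_sq
  have hI3 : Complex.I ^ 3 = -Complex.I := by rw [pow_succ, hI2]; ring
  have hI4 : Complex.I ^ 4 = 1 := by rw [pow_succ, hI3]; simp
  refine ⟨?_, ?_, ?_, ?_, ?_, ?_⟩
  · rw [integral_stdComplexGaussian (fun z => z) (by fun_prop) ![1, Complex.I] ![1, 0] ![0, 1] m hm]
    · simp [Fin.sum_univ_succ, m0, m1]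
    · intro x y; simp [Fin.sum_univ_succ]; ring
  · rw [integral_stdComplexGaussian (fun z => z ^ 2) (by fun_prop) ![1, 2 * Complex.I, -1]
      ![2, 1, 0] ![0, 1, 2] m hm]
    · simp [Fin.sum_univ_succ, m0, m1, m2]
    · intro x y; simp [Fin.sum_univ_succ]; ring_nf; rw [hI2]; ring
  · rw [integral_stdComplexGaussian (fun z => z * conj z) (by fun_prop) ![1, 1]
      ![2, 0] ![0, 2] m hm]
    · simp [Fin.sum_univ_succ, m0, m2]; norm_num
    · intro x y; simp [Fin.sum_univ_succ]; ring_nf; rw [hI2]; ring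
  · rw [integral_stdComplexGaussian (fun z => z ^ 4) (by fun_prop)
      ![1, 4 * Complex.I, -6, -4 * Complex.I, 1] ![4, 3, 2, 1, 0] ![0, 1, 2, 3, 4] m hm]
    · simp [Fin.sum_univ_succ, m0, m1, m2, m3, m4]; norm_num
    · intro x y; simp [Fin.sum_univ_succ]; ring_nf; rw [hI2, hI3, hI4]; ring
  · rw [integral_stdComplexGaussian (fun z => z ^ 3 * conj z) (by fun_prop)
      ![1, 2 * Complex.I, 2 * Complex.I, -1] ![4, 3, 1, 0] ![0, 1, 3, 4] m hm]
    · simp [Fin.sum_univ_succ, m0, m1, m3, m4]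
    · intro x y; simp [Fin.sum_univ_succ]; ring_nf; simp only [hI3, hI4]; ring
  · rw [integral_stdComplexGaussian (fun z => z ^ 2 * conj z ^ 2) (by fun_prop)
      ![1, 2, 1] ![4, 2, 0] ![0, 2, 4] m hm]
    · simp [Fin.sum_univ_succ, m0, m2, m4]; norm_num
    · intro x y; simp [Fin.sum_univ_succ]; ring_nf; rw [hI2, hI4]; ring

theorem integrable_norm_pow_stdComplexGaussian :
    MemLp (fun z : ℂ => z) 4 stdComplexGaussian := by
  unfold stdComplexGaussian
  rw [memLp_map_measure_iff (by fun_prop) (by fun_prop)]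
  have h : MemLp (fun x : ℝ => (x : ℂ)) 4 (gaussianReal 0 (1 / 2)) :=
    (memLp_id_gaussianReal (μ := 0) (v := 1 / 2) 4).ofReal
  have h1 := h.comp_measurePreserving
    (measurePreserving_fst (μ := gaussianReal 0 (1 / 2)) (ν := gaussianReal 0 (1 / 2)))
  have h2 := h.comp_measurePreserving
    (measurePreserving_snd (μ := gaussianReal 0 (1 / 2)) (ν := gaussianReal 0 (1 / 2)))
  convert h1.add (h2.const_mul Complex.I) using 1
  funext p
  apply Complex.ext <;> simp [Complex.measurableEquivRealProd]

end ZK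

end

noncomputable section

namespace ZK

variable {d : ℕ}

/-! ### Moments of the Gaussian data -/

namespace IsGaussianData

variable {S : Type*} [MeasurableSpace S] {μ : Measure S}
  {η : (Fin d → ℤ) → S → ℂ}

theorem memLp (h : IsGaussianData μ η) (K : Fin d → ℤ) : MemLp (η K) 4 μ := by
  by_cases hK : K = 0
  · subst hK
    have h1 : MemLp (fun x : ℝ => (x : ℂ)) 4 (gaussianReal 0 1) :=
      (memLp_id_gaussianReal (μ := 0) (v := 1) 4).ofReal
    have h2 : MemLp (fun z : ℂ => z) 4 (μ.map (η 0)) := by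
      rw [h.law_zero, memLp_map_measure_iff (by fun_prop) (by fun_prop)]
      exact h1
    rw [memLp_map_measure_iff (by fun_prop) (h.measurable 0).aemeasurable] at h2
    exact h2
  · have h2 := integrable_norm_pow_stdComplexGaussian
    rw [← h.law K hK, memLp_map_measure_iff (by fun_prop) (h.measurable K).aemeasurable] at h2
    exact h2

theorem integrable_mul_four (h : IsGaussianData μ η) (a b c e : Fin d → ℤ) :
    Integrable (fun w => η a w * η b w * (η c w * η e w)) μ := by
  have : ENNReal.HolderTriple 4 4 2 := ⟨by
    rw [← two_mul, show (4 : ENNReal) = 2 * 2 by norm_num,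
      ENNReal.mul_inv (by simp) (by simp), ← mul_assoc, ENNReal.mul_inv_cancel (by simp) (by simp),
      one_mul]⟩
  have h1 : MemLp (fun w => η a w * η b w) 2 μ := (h.memLp b).mul (h.memLp a)
  have h2 : MemLp (fun w => η c w * η e w) 2 μ := (h.memLp e).mul (h.memLp c)
  exact h1.integrable_mul h2

theorem integral_comp (h : IsGaussianData μ η) {K : Fin d → ℤ} (hK : K ≠ 0) {g : ℂ → ℂ}
    (hg : Measurable g) : ∫ w, g (η K w) ∂μ = ∫ z, g z ∂stdComplexGaussian := by
  rw [← h.law K hK, integral_map (h.measurable K).aemeasurable hg.aestronglyMeasurable]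

theorem integral_pow_zero (h : IsGaussianData μ η) (n : ℕ) :
    ∫ w, η 0 w ^ n ∂μ = ((∫ x, x ^ n ∂gaussianReal 0 1 : ℝ) : ℂ) := by
  have h1 := integral_map (μ := μ) (φ := η 0) (h.measurable 0).aemeasurable
    (f := fun z : ℂ => z ^ n) (by fun_prop)
  rw [← h1, h.law_zero, integral_map (by fun_prop) (by fun_prop), ← integral_complex_ofReal]
  simp

theorem integral_eq_zero (h : IsGaussianData μ η) (K : Fin d → ℤ) : ∫ w, η K w ∂μ = 0 := by
  by_cases hK : K = 0
  · subst hK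
    simpa [(integral_pow_gaussianReal 1).1, -pow_one] using h.integral_pow_zero 1
  · rw [h.integral_comp hK (g := fun z => z) measurable_id, stdComplexGaussian_moments.1]

theorem add_self_ne_zero {a : Fin d → ℤ} (ha : a ≠ 0) : a + a ≠ 0 := by
  intro h
  apply ha
  funext i
  have := congrFun h i
  simp at this
  simpa using this

theorem integral_mul_same (h : IsGaussianData μ η) {a b : Fin d → ℤ} (hb : b = a ∨ b = -a) :
    ∫ w, η a w * η b w ∂μ = if a + b = 0 then 1 else 0 := by
  by_cases ha : a = 0
  · subst ha
    have hb0 : b = 0 := by simpa using hb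
    subst hb0
    have := h.integral_pow_zero 2
    simp only [(integral_pow_gaussianReal 1).2.1] at this
    simpa [pow_two] using this
  · obtain ⟨-, h2, h11, -⟩ := stdComplexGaussian_moments
    rcases hb with rfl | rfl
    · rw [if_neg (add_self_ne_zero ha), ← h2,
        ← h.integral_comp ha (g := fun z => z ^ 2) (by fun_prop)]
      simp [pow_two]
    · rw [if_pos (by simp), ← h11,
        ← h.integral_comp ha (g := fun z => z * conj z) (by fun_prop)]
      simp [h.symm]

/-- The isolated factor is independent of the product of the other three, and it is centred. -/
theorem integral_mul_isolated (h : IsGaussianData μ η) {a b c e : Fin d → ℤ}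
    (hb : ¬ (b = a ∨ b = -a)) (hc : ¬ (c = a ∨ c = -a)) (he : ¬ (e = a ∨ e = -a)) :
    ∫ w, η a w * η b w * (η c w * η e w) ∂μ = 0 := by
  push Not at hb hc he
  have hind := (h.indep a).comp (φ := fun z => z)
    (ψ := fun f => f ⟨b, hb⟩ * (f ⟨c, hc⟩ * f ⟨e, he⟩)) measurable_id (by fun_prop)
  have hm := h.measurable
  have := hind.integral_fun_mul_eq_mul_integral (hm a).aestronglyMeasurable
    (((hm b).mul ((hm c).mul (hm e))).aestronglyMeasurable)
  simp only [Function.comp_apply] at this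
  rw [h.integral_eq_zero, zero_mul] at this
  simpa [mul_assoc] using this

/-- Since `b = ±a`, the factor at `b` is a function of the one at `a`. The first pair is therefore a
function of a single coefficient and independent of the second pair, although independence is only
assumed for one coefficient against the others. -/
theorem integral_mul_pairs (h : IsGaussianData μ η) {a b c e : Fin d → ℤ}
    (hb : b = a ∨ b = -a) (hc : ¬ (c = a ∨ c = -a)) (he : e = c ∨ e = -c) :
    ∫ w, η a w * η b w * (η c w * η e w) ∂μ =
      (if a + b = 0 then 1 else 0) * (if c + e = 0 then 1 else 0) := by
  have he' : e ≠ a ∧ e ≠ -a := by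
    push Not at hc
    rcases he with rfl | rfl
    · exact hc
    · exact ⟨fun h => hc.2 (by rw [← h, neg_neg]), fun h => hc.1 (neg_injective h)⟩
  push Not at hc
  obtain ⟨g, hg, hgb⟩ : ∃ g : ℂ → ℂ, Measurable g ∧ ∀ w, η b w = g (η a w) := by
    rcases hb with rfl | rfl
    · exact ⟨id, measurable_id, fun _ => rfl⟩
    · exact ⟨fun z => conj z, by fun_prop, fun w => h.symm a w⟩
  have hind := (h.indep a).comp (φ := fun z => z * g z)
    (ψ := fun f => f ⟨c, hc⟩ * f ⟨e, he'⟩) (by fun_prop) (by fun_prop)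
  have hm := h.measurable
  have := hind.integral_fun_mul_eq_mul_integral
    ((hm a).mul (hg.comp (hm a))).aestronglyMeasurable
    (((hm c).mul (hm e)).aestronglyMeasurable)
  simp only [Function.comp_apply, ← hgb] at this
  rw [h.integral_mul_same hb, h.integral_mul_same he] at this
  exact this

/-- Only one Gaussian is involved, so this is its table of fourth moments: for `a ≠ 0` either none
or two of the three pairings survive, the latter matching `𝔼|η|⁴ = 2`; for `a = 0` all three do,
matching the real moment `3`. -/
theorem integral_mul_all (h : IsGaussianData μ η) {a b c e : Fin d → ℤ}
    (hb : b = a ∨ b = -a) (hc : c = a ∨ c = -a) (he : e = a ∨ e = -a) :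
    ∫ w, η a w * η b w * (η c w * η e w) ∂μ =
      (if a + b = 0 then 1 else 0) * (if c + e = 0 then 1 else 0) +
      (if a + c = 0 then 1 else 0) * (if b + e = 0 then 1 else 0) +
      (if a + e = 0 then 1 else 0) * (if b + c = 0 then 1 else 0) := by
  by_cases ha : a = 0
  · subst ha
    have hb0 : b = 0 := by simpa using hb
    have hc0 : c = 0 := by simpa using hc
    have he0 : e = 0 := by simpa using he
    subst hb0 hc0 he0
    have := h.integral_pow_zero 4
    simp only [(integral_pow_gaussianReal 1).2.2.2] at this
    have h4 : ∀ w, η 0 w * η 0 w * (η 0 w * η 0 w) = η 0 w ^ 4 := fun w => by ring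
    simp only [h4, this]
    norm_num
  · obtain ⟨-, -, -, h40, h31, h22⟩ := stdComplexGaussian_moments
    have h13 : (∫ z, z * conj z ^ 3 ∂stdComplexGaussian) = 0 := by
      have := integral_conj (μ := stdComplexGaussian) (f := fun z : ℂ => z ^ 3 * conj z)
      rw [h31] at this
      simpa [mul_comm] using this
    rw [← h.integral_comp ha (by fun_prop)] at h40 h31 h22 h13
    have e1 := add_self_ne_zero ha
    have e2 : -a + -a ≠ 0 := add_self_ne_zero (neg_ne_zero.2 ha)
    have key : ∀ {f g : S → ℂ} {v : ℂ}, (∫ w, f w ∂μ) = v → (∀ w, g w = f w) →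
        (∫ w, g w ∂μ) = v := by
      intro f g v hf hfg
      simp only [hfg, hf]
    rcases hb with rfl | rfl <;> rcases hc with rfl | rfl <;> rcases he with rfl | rfl <;>
      simp only [e1, e2, add_neg_cancel, neg_add_cancel, if_true, if_false, h.symm, mul_zero,
        mul_one, add_zero, zero_add]
    · exact key h40 fun w => by ring
    · exact key h31 fun w => by ring
    · exact key h31 fun w => by ring
    · rw [one_add_one_eq_two]; exact key h22 fun w => by ring
    · exact key h31 fun w => by ring
    · rw [one_add_one_eq_two]; exact key h22 fun w => by ring
    · rw [one_add_one_eq_two]; exact key h22 fun w => by ring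
    · exact key h13 fun w => by ring


/-- Wick's formula for products of four of the random Fourier coefficients. -/
theorem wick (h : IsGaussianData μ η) (a b c e : Fin d → ℤ) :
    ∫ w, η a w * η b w * (η c w * η e w) ∂μ =
      (if a + b = 0 then 1 else 0) * (if c + e = 0 then 1 else 0) +
      (if a + c = 0 then 1 else 0) * (if b + e = 0 then 1 else 0) +
      (if a + e = 0 then 1 else 0) * (if b + c = 0 then 1 else 0) := by
  have nz : ∀ {x y : Fin d → ℤ}, ¬ (y = x ∨ y = -x) → x + y ≠ 0 := by
    intro x y hxy h0
    exact hxy (Or.inr (eq_neg_of_add_eq_zero_right h0))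
  have tr : ∀ {x y z : Fin d → ℤ}, (y = x ∨ y = -x) → (z = x ∨ z = -x) → (z = y ∨ z = -y) := by
    rintro x y z (rfl | rfl) (rfl | rfl) <;> simp
  have sy : ∀ {x y : Fin d → ℤ}, (y = x ∨ y = -x) → (x = y ∨ x = -y) := by
    rintro x y (rfl | rfl) <;> simp
  have perm : ∀ {x y z t : Fin d → ℤ}, (∀ w, η a w * η b w * (η c w * η e w) =
      η x w * η y w * (η z w * η t w)) → ∫ w, η a w * η b w * (η c w * η e w) ∂μ =
      ∫ w, η x w * η y w * (η z w * η t w) ∂μ := by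
    intro x y z t hh
    simp only [hh]
  -- The cases record which indices agree with `a` up to sign. Either some index is isolated, and
  -- `perm` brings it to the front, or the indices form two pairs or a single class.
  by_cases hb : b = a ∨ b = -a <;> by_cases hc : c = a ∨ c = -a <;>
    by_cases he : e = a ∨ e = -a
  · exact h.integral_mul_all hb hc he
  · have e1 : ¬ (a = e ∨ a = -e) := fun t => he (sy t)
    have e2 : ¬ (b = e ∨ b = -e) := fun t => he (tr (sy hb) (sy t))
    have e3 : ¬ (c = e ∨ c = -e) := fun t => he (tr (sy hc) (sy t))
    rw [perm (x := e) (y := a) (z := b) (t := c) fun w => by ring,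
      h.integral_mul_isolated e1 e2 e3]
    have := nz he
    have q1 : c + e ≠ 0 := fun t => nz e3 (by rw [add_comm]; exact t)
    have q2 : b + e ≠ 0 := fun t => nz e2 (by rw [add_comm]; exact t)
    simp [this, q1, q2]
  · have e1 : ¬ (a = c ∨ a = -c) := fun t => hc (sy t)
    have e2 : ¬ (b = c ∨ b = -c) := fun t => hc (tr (sy hb) (sy t))
    have e3 : ¬ (e = c ∨ e = -c) := fun t => hc (tr (sy he) (sy t))
    rw [perm (x := c) (y := a) (z := b) (t := e) fun w => by ring,
      h.integral_mul_isolated e1 e2 e3]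
    have q1 : b + c ≠ 0 := fun t => nz e2 (by rw [add_comm]; exact t)
    simp [nz hc, nz e3, q1]
  · have e2 : ¬ (c = b ∨ c = -b) := fun t => hc (tr (sy hb) t)
    have e3 : ¬ (e = b ∨ e = -b) := fun t => he (tr (sy hb) t)
    by_cases hce : e = c ∨ e = -c
    · rw [h.integral_mul_pairs hb hc hce]
      simp [nz hc, nz he]
    · have e1 : ¬ (a = c ∨ a = -c) := fun t => hc (sy t)
      have e2' : ¬ (b = c ∨ b = -c) := fun t => e2 (sy t)
      rw [perm (x := c) (y := a) (z := b) (t := e) fun w => by ring,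
        h.integral_mul_isolated e1 e2' hce]
      simp [nz hc, nz he, nz hce]
  · have e1 : ¬ (a = b ∨ a = -b) := fun t => hb (sy t)
    have e2 : ¬ (c = b ∨ c = -b) := fun t => hb (tr (sy hc) (sy t))
    have e3 : ¬ (e = b ∨ e = -b) := fun t => hb (tr (sy he) (sy t))
    rw [perm (x := b) (y := a) (z := c) (t := e) fun w => by ring,
      h.integral_mul_isolated e1 e2 e3]
    simp [nz hb, nz e3, nz e2]
  · have e1 : ¬ (a = b ∨ a = -b) := fun t => hb (sy t)
    have e2 : ¬ (c = b ∨ c = -b) := fun t => hb (tr (sy hc) (sy t))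
    by_cases hbe : e = b ∨ e = -b
    · rw [perm (x := a) (y := c) (z := b) (t := e) fun w => by ring,
        h.integral_mul_pairs hc hb hbe]
      simp [nz hb, nz he]
    · rw [perm (x := b) (y := a) (z := c) (t := e) fun w => by ring,
        h.integral_mul_isolated e1 e2 hbe]
      simp [nz hb, nz he, nz hbe]
  · have e1 : ¬ (a = b ∨ a = -b) := fun t => hb (sy t)
    have e2 : ¬ (e = b ∨ e = -b) := fun t => hb (tr (sy he) (sy t))
    by_cases hbc : c = b ∨ c = -b
    · rw [perm (x := a) (y := e) (z := b) (t := c) fun w => by ring,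
        h.integral_mul_pairs he hb hbc]
      simp [nz hb, nz hc]
    · rw [perm (x := b) (y := a) (z := c) (t := e) fun w => by ring,
        h.integral_mul_isolated e1 hbc e2]
      simp [nz hb, nz hc, nz hbc]
  · rw [h.integral_mul_isolated hb hc he]
    simp [nz hb, nz hc, nz he]

end IsGaussianData

end ZK

end

noncomputable section

namespace ZK

variable {d : ℕ}

/-! ### Time kernels -/

/-- `∫₀ˣ e^{-as} ds`. -/
def damp (a x : ℝ) : ℝ := ∫ s in (0 : ℝ)..x, Real.exp (-(a * s))

theorem hasDerivAt_damp (a x : ℝ) : HasDerivAt (damp a) (Real.exp (-(a * x))) x := by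
  have hc : Continuous fun s : ℝ => Real.exp (-(a * s)) := by fun_prop
  exact intervalIntegral.integral_hasDerivAt_right (hc.intervalIntegrable _ _)
    (hc.stronglyMeasurableAtFilter _ _) hc.continuousAt

@[fun_prop]
theorem continuous_damp (a : ℝ) : Continuous (damp a) :=
  continuous_iff_continuousAt.2 fun x => (hasDerivAt_damp a x).continuousAt

theorem damp_zero (a : ℝ) : damp a 0 = 0 := by simp [damp]

theorem damp_nonneg (a : ℝ) {x : ℝ} (hx : 0 ≤ x) : 0 ≤ damp a x :=
  intervalIntegral.integral_nonneg hx fun _ _ => (Real.exp_pos _).le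

theorem damp_le {a x : ℝ} (ha : 0 ≤ a) (hx : 0 ≤ x) : damp a x ≤ x := by
  have hc : Continuous fun s : ℝ => Real.exp (-(a * s)) := by fun_prop
  have := intervalIntegral.integral_mono_on hx (hc.intervalIntegrable (μ := volume) 0 x)
    (continuous_const.intervalIntegrable (μ := volume) 0 x) (g := fun _ => (1 : ℝ))
    fun s hs => by
      rw [Real.exp_le_one_iff]
      have := mul_nonneg ha hs.1
      linarith
  simpa [damp] using this

theorem sub_damp_le {a x : ℝ} (ha : 0 ≤ a) (hx : 0 ≤ x) : x - damp a x ≤ x * (a * x) := by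
  have hc : Continuous fun s : ℝ => Real.exp (-(a * s)) := by fun_prop
  have := intervalIntegral.integral_mono_on hx
    (continuous_const.intervalIntegrable (μ := volume) 0 x) (f := fun _ => 1 - a * x)
    (hc.intervalIntegrable (μ := volume) 0 x)
    fun s hs => by
      have h1 := Real.add_one_le_exp (-(a * s))
      have h2 := mul_le_mul_of_nonneg_left hs.2 ha
      linarith
  simp only [intervalIntegral.integral_const, sub_zero, smul_eq_mul] at this
  change x * (1 - a * x) ≤ damp a x at this
  linarith

/-- The kernel `∫₀ᵗ e^{-bu} (∫₀^{t-u} e^{-as} ds) cos(uv) du`. -/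
def timeKernel (a b t v : ℝ) : ℝ :=
  ∫ u in (0 : ℝ)..t, Real.exp (-(b * u)) * damp a (t - u) * Real.cos (u * v)

/-- The second derivative of `r ↦ e^{-br} ∫₀^{t-r} e^{-as} ds`. -/
def kernelWeight (a b t r : ℝ) : ℝ :=
  Real.exp (-(b * r)) * ((-a + 2 * b) * Real.exp (-(a * (t - r))) + b ^ 2 * damp a (t - r))

/-- Two integrations by parts. At `r = t` the weight vanishes because `damp a 0 = 0`, but its
derivative is `-e^{-bt}`, which produces the last term; at `r = 0` the second boundary term drops
out since `Φ 0 = 0`. -/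
theorem integral_kernelWeight (a b t : ℝ) {Φ Φ' Φ'' : ℝ → ℝ} (h0 : Φ 0 = 0)
    (h1 : ∀ r, HasDerivAt Φ (Φ' r) r) (h2 : ∀ r, HasDerivAt Φ' (Φ'' r) r)
    (hc : Continuous Φ'') :
    ∫ r in (0 : ℝ)..t, Real.exp (-(b * r)) * damp a (t - r) * Φ'' r =
      -(damp a t * Φ' 0) + (∫ r in (0 : ℝ)..t, kernelWeight a b t r * Φ r)
        + Real.exp (-(b * t)) * Φ t := by
  have hexp : ∀ r, HasDerivAt (fun r => Real.exp (-(b * r))) (-b * Real.exp (-(b * r))) r := by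
    intro r
    have := ((hasDerivAt_id' r).const_mul b).fun_neg.exp
    convert! this using 1
    simp; ring
  have hdamp : ∀ r, HasDerivAt (fun r => damp a (t - r)) (-Real.exp (-(a * (t - r)))) r := by
    intro r
    have := (hasDerivAt_damp a (t - r)).comp r ((hasDerivAt_id' r).const_sub t)
    simpa [Function.comp_def] using this
  have hexp' : ∀ r, HasDerivAt (fun r => Real.exp (-(a * (t - r))))
      (a * Real.exp (-(a * (t - r)))) r := by
    intro r
    have := (((hasDerivAt_id' r).const_sub t).const_mul a).fun_neg.exp
    convert! this using 1
    simp; ring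
  have hW : ∀ r, HasDerivAt (fun r => Real.exp (-(b * r)) * damp a (t - r))
      (Real.exp (-(b * r)) * (-Real.exp (-(a * (t - r))) - b * damp a (t - r))) r := by
    intro r
    convert! (hexp r).fun_mul (hdamp r) using 1
    ring
  have hW' : ∀ r, HasDerivAt
      (fun r => Real.exp (-(b * r)) * (-Real.exp (-(a * (t - r))) - b * damp a (t - r)))
      (kernelWeight a b t r) r := by
    intro r
    convert! (hexp r).fun_mul ((hexp' r).fun_neg.fun_sub ((hdamp r).const_mul b)) using 1
    unfold kernelWeight
    ring
  have cΦ : Continuous Φ := continuous_iff_continuousAt.2 fun x => (h1 x).continuousAt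
  have cΦ' : Continuous Φ' := continuous_iff_continuousAt.2 fun x => (h2 x).continuousAt
  have cW' : Continuous
      (fun r => Real.exp (-(b * r)) * (-Real.exp (-(a * (t - r))) - b * damp a (t - r))) :=
    continuous_iff_continuousAt.2 fun x => (hW' x).continuousAt
  have cK : Continuous (kernelWeight a b t) := by unfold kernelWeight; fun_prop
  rw [intervalIntegral.integral_mul_deriv_eq_deriv_mul (fun r _ => hW r) (fun r _ => h2 r)
    (cW'.intervalIntegrable _ _) (hc.intervalIntegrable _ _),
    intervalIntegral.integral_mul_deriv_eq_deriv_mul (fun r _ => hW' r) (fun r _ => h1 r)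
    (cK.intervalIntegrable _ _) (cΦ'.intervalIntegrable _ _)]
  simp [damp_zero, h0]
  ring

/-- The Fejér kernel `∫₀ʳ (r - u) cos(uv) du`. -/
def fejer (r v : ℝ) : ℝ := r ^ 2 / 2 * Real.sinc (r * v / 2) ^ 2

theorem fejer_of_ne_zero (r : ℝ) {v : ℝ} (hv : v ≠ 0) :
    fejer r v = (1 - Real.cos (r * v)) / v ^ 2 := by
  unfold fejer
  by_cases hr : r = 0
  · simp [hr]
  · rw [Real.sinc_of_ne_zero (by positivity)]
    have h := Real.cos_two_mul (r * v / 2)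
    have h' := Real.sin_sq_add_cos_sq (r * v / 2)
    rw [show 2 * (r * v / 2) = r * v by ring] at h
    rw [h]
    field_simp
    linear_combination 2 * h'

theorem fejer_zero (r : ℝ) : fejer r 0 = r ^ 2 / 2 := by simp [fejer]

@[fun_prop]
theorem continuous_fejer : Continuous fun p : ℝ × ℝ => fejer p.1 p.2 := by
  unfold fejer
  have := Real.continuous_sinc
  fun_prop

theorem fejer_nonneg (r v : ℝ) : 0 ≤ fejer r v := by unfold fejer; positivity

theorem fejer_le (r v : ℝ) : fejer r v ≤ r ^ 2 / 2 := by
  unfold fejer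
  have h1 := Real.sinc_le_one (r * v / 2)
  have h2 := Real.neg_one_le_sinc (r * v / 2)
  have h3 : Real.sinc (r * v / 2) ^ 2 ≤ 1 := by nlinarith
  have : 0 ≤ r ^ 2 / 2 := by positivity
  nlinarith

theorem sq_mul_fejer_le (r v : ℝ) : v ^ 2 * fejer r v ≤ 2 := by
  by_cases hv : v = 0
  · simp [hv]
  · rw [fejer_of_ne_zero r hv, mul_div_cancel₀ _ (by positivity)]
    linarith [Real.neg_one_le_cos (r * v)]

/-- As a function of `r`, `fejer r v` is the second antiderivative of `cos(rv)` that vanishes to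
first order at `0`, so no boundary term at `0` remains. The gain is a superposition of nonnegative
approximate identities in `v`. -/
theorem timeKernel_eq_fejer (a b t v : ℝ) :
    timeKernel a b t v = (∫ r in (0 : ℝ)..t, kernelWeight a b t r * fejer r v)
        + Real.exp (-(b * t)) * fejer t v := by
  unfold timeKernel
  have hcos : Continuous fun r => Real.cos (r * v) := by fun_prop
  by_cases hv : v = 0
  · subst hv
    rw [integral_kernelWeight a b t (Φ := fun r => fejer r 0) (Φ' := fun r => r)
      (Φ'' := fun r => Real.cos (r * 0)) (by simp [fejer_zero]) ?_ ?_ hcos]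
    · simp
    · intro r
      simp only [fejer_zero]
      convert! (hasDerivAt_pow 2 r).div_const 2 using 1
      simp
    · intro r
      simpa using hasDerivAt_id' r
  · have hlin : ∀ r, HasDerivAt (fun r => r * v) v r := fun r => by
      simpa using (hasDerivAt_id' r).mul_const v
    rw [integral_kernelWeight a b t (Φ := fun r => fejer r v)
      (Φ' := fun r => Real.sin (r * v) / v)
      (Φ'' := fun r => Real.cos (r * v)) (by simp [fejer]) ?_ ?_ hcos]
    · simp
    · intro r
      simp only [fejer_of_ne_zero _ hv]
      convert! ((hlin r).cos.const_sub 1).div_const (v ^ 2) using 1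
      field_simp
    · intro r
      convert! (hlin r).sin.div_const v using 1
      field_simp

/-- The same integration by parts with `Φ r = r`. It computes the total mass of the superposition of
Fejér kernels: replacing each by `πr` times a unit mass gives `π · damp a t`. -/
theorem damp_eq_integral_kernelWeight (a b t : ℝ) :
    damp a t = (∫ r in (0 : ℝ)..t, kernelWeight a b t r * r) + Real.exp (-(b * t)) * t := by
  have := integral_kernelWeight a b t (Φ := fun r => r) (Φ' := fun _ => 1) (Φ'' := fun _ => 0)
    rfl (fun r => hasDerivAt_id' r) (fun r => hasDerivAt_const r _) continuous_const
  simp at this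
  linarith

/-! ### Mass and tails of the Fejér kernel. -/

theorem integrable_fejer (r : ℝ) : Integrable (fejer r) := by
  refine Integrable.mono' (integrable_inv_one_add_sq.const_mul (r ^ 2 / 2 + 2))
    (by fun_prop) (Eventually.of_forall fun v => ?_)
  rw [Real.norm_of_nonneg (fejer_nonneg r v), ← div_eq_mul_inv, le_div_iff₀ (by positivity)]
  linarith [fejer_le r v, sq_mul_fejer_le r v]

theorem integral_fejer_scale (r : ℝ) (hr : 0 ≤ r) :
    ∫ v, fejer r v = r * ∫ v, fejer 1 v := by
  rcases hr.eq_or_lt with rfl | hr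
  · simp [fejer]
  have h : ∀ v, fejer r v = r ^ 2 * fejer 1 (r * v) := fun v => by
    unfold fejer; ring_nf
  simp only [h]
  rw [integral_const_mul, Measure.integral_comp_mul_left (fun v => fejer 1 v),
    abs_of_pos (inv_pos.2 hr), smul_eq_mul]
  field_simp

/-- The Laplace transform in `r`, found from an explicit primitive; nonnegativity of the integrand
gives its integrability for free. -/
theorem integral_exp_mul_fejer {v : ℝ} (hv : v ≠ 0) :
    ∫ r in Set.Ioi (0 : ℝ), Real.exp (-r) * fejer r v = (1 + v ^ 2)⁻¹ := by
  have hexp : ∀ r, HasDerivAt (fun r : ℝ => Real.exp (-r)) (-Real.exp (-r)) r := fun r => by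
    simpa using (hasDerivAt_id' r).fun_neg.exp
  have hlin : ∀ r, HasDerivAt (fun r => r * v) v r := fun r => by
    simpa using (hasDerivAt_id' r).mul_const v
  have hv2 : (1 + v ^ 2) ≠ 0 := by positivity
  have hderiv : ∀ r, HasDerivAt (fun r => -Real.exp (-r) *
      (1 - (Real.cos (r * v) - v * Real.sin (r * v)) / (1 + v ^ 2)) / v ^ 2)
      (Real.exp (-r) * fejer r v) r := by
    intro r
    convert! ((hexp r).fun_neg.fun_mul ((((hlin r).cos.fun_sub ((hlin r).sin.const_mul v)).div_const
      (1 + v ^ 2)).const_sub 1)).div_const (v ^ 2) using 1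
    rw [fejer_of_ne_zero r hv]
    field_simp
    ring
  have hlim : Tendsto (fun r => -Real.exp (-r) *
      (1 - (Real.cos (r * v) - v * Real.sin (r * v)) / (1 + v ^ 2)) / v ^ 2) atTop (𝓝 0) := by
    have hb : Tendsto (fun r : ℝ => Real.exp (-r) * ((2 + |v|) / v ^ 2)) atTop (𝓝 0) := by
      have := Real.tendsto_exp_neg_atTop_nhds_zero.mul_const ((2 + |v|) / v ^ 2)
      simpa using this
    refine squeeze_zero_norm (fun r => ?_) hb
    rw [norm_div, norm_mul, norm_neg, Real.norm_eq_abs, Real.norm_eq_abs, Real.norm_eq_abs,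
      abs_of_pos (Real.exp_pos _), abs_of_nonneg (sq_nonneg v), mul_div_assoc]
    gcongr
    have h1 : |(Real.cos (r * v) - v * Real.sin (r * v)) / (1 + v ^ 2)| ≤ 1 + |v| := by
      rw [abs_div, abs_of_pos (show 0 < 1 + v ^ 2 by positivity), div_le_iff₀ (by positivity)]
      have h2 : |Real.cos (r * v) - v * Real.sin (r * v)| ≤ 1 + |v| := by
        refine (abs_sub _ _).trans ?_
        rw [abs_mul]
        have := Real.abs_cos_le_one (r * v)
        have := Real.abs_sin_le_one (r * v)
        nlinarith [abs_nonneg v]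
      nlinarith [abs_nonneg v, sq_nonneg v]
    calc _ ≤ |(1 : ℝ)| + |(Real.cos (r * v) - v * Real.sin (r * v)) / (1 + v ^ 2)| := abs_sub _ _
      _ ≤ 2 + |v| := by rw [abs_one]; linarith
  have hint : IntegrableOn (fun r => Real.exp (-r) * fejer r v) (Set.Ioi 0) := by
    refine integrableOn_Ioi_deriv_of_nonneg' (fun r _ => hderiv r) (fun r _ => ?_) hlim
    exact mul_nonneg (Real.exp_pos _).le (fejer_nonneg _ _)
  rw [integral_Ioi_of_hasDerivAt_of_tendsto' (fun r _ => hderiv r) hint hlim]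
  simp
  field_simp
  ring

/-- Integrate `e^{-r} fejer r v` in both variables. By scaling in `r` the double integral is `Γ(2)`
times the mass sought; in the other order it is the integral of `1/(1+v²)`, which is `π`. -/
theorem integral_fejer_one : ∫ v, fejer 1 v = Real.pi := by
  have hint : Integrable (Function.uncurry fun r v : ℝ => Real.exp (-r) * fejer r v)
      ((volume.restrict (Set.Ioi 0)).prod volume) := by
    have h1 : IntegrableOn (fun r : ℝ => Real.exp (-r) * (r ^ 2 / 2 + 2)) (Set.Ioi 0) := by
      have e0 := Real.GammaIntegral_convergent (s := 1) (by norm_num)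
      have e2 := Real.GammaIntegral_convergent (s := 3) (by norm_num)
      refine IntegrableOn.congr_fun ((e2.div_const 2).add (e0.mul_const 2)) (fun r hr => ?_)
        measurableSet_Ioi
      norm_num
      ring
    have h2 := h1.mul_prod integrable_inv_one_add_sq
    refine Integrable.mono' h2 (by fun_prop) (Eventually.of_forall fun p => ?_)
    rw [Function.uncurry, Real.norm_of_nonneg
      (mul_nonneg (Real.exp_pos _).le (fejer_nonneg _ _)), mul_assoc]
    refine mul_le_mul_of_nonneg_left ?_ (Real.exp_pos _).le
    rw [← div_eq_mul_inv, le_div_iff₀ (by positivity)]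
    linarith [fejer_le p.1 p.2, sq_mul_fejer_le p.1 p.2]
  have hswap := integral_integral_swap hint
  have hL : ∫ r in Set.Ioi (0 : ℝ), ∫ v, Real.exp (-r) * fejer r v = ∫ v, fejer 1 v := by
    have : ∀ r ∈ Set.Ioi (0 : ℝ), ∫ v, Real.exp (-r) * fejer r v =
        Real.exp (-r) * r ^ ((2 : ℝ) - 1) * ∫ v, fejer 1 v := by
      intro r hr
      rw [integral_const_mul, integral_fejer_scale r (le_of_lt hr)]
      norm_num
      ring
    rw [setIntegral_congr_fun measurableSet_Ioi this, integral_mul_const,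
      ← Real.Gamma_eq_integral (by norm_num), Real.Gamma_two, one_mul]
  rw [hL] at hswap
  rw [hswap, ← integral_univ_inv_one_add_sq]
  refine integral_congr_ae ?_
  have : ∀ᵐ v : ℝ, v ≠ 0 := by simp [ae_iff]
  filter_upwards [this] with v hv
  exact integral_exp_mul_fejer hv

theorem integral_fejer {r : ℝ} (hr : 0 ≤ r) : ∫ v, fejer r v = Real.pi * r := by
  rw [integral_fejer_scale r hr, integral_fejer_one, mul_comm]

/-- Each tail is at most `∫_δ^∞ 2/v² dv = 2/δ`, uniformly in `r`. -/
theorem abs_setIntegral_fejer_sub_le {r δ : ℝ} (hr : 0 ≤ r) (hδ : 0 < δ) :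
    |(∫ v in Set.Icc (-δ) δ, fejer r v) - Real.pi * r| ≤ 4 / δ := by
  have htail : ∀ {s : Set ℝ}, MeasurableSet s → ∀ c : ℝ, IntegrableOn (fun v => 2 * v ^ (-2 : ℝ)) s →
      (∫ v in s, 2 * v ^ (-2 : ℝ)) = c → (∀ v ∈ s, 0 < v) → ∫ v in s, fejer r v ≤ c := by
    intro s hs c hi hc hpos
    rw [← hc]
    refine setIntegral_mono_on (integrable_fejer r).integrableOn hi hs fun v hv => ?_
    have := hpos v hv
    rw [Real.rpow_neg this.le, ← div_eq_mul_inv, le_div_iff₀ (by positivity)]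
    have := sq_mul_fejer_le r v
    norm_cast
    linarith
  have h1 : ∫ v in Set.Ioi δ, fejer r v ≤ 2 / δ := by
    refine htail measurableSet_Ioi _ ((integrableOn_Ioi_rpow_of_lt (by norm_num) hδ).const_mul 2)
      ?_ (fun v hv => hδ.trans hv)
    rw [integral_const_mul, integral_Ioi_rpow_of_lt (by norm_num) hδ]
    norm_num
    rw [Real.rpow_neg hδ.le, Real.rpow_one]
    rfl
  have heven : ∀ v, fejer r (-v) = fejer r v := fun v => by
    unfold fejer
    rw [show r * -v / 2 = -(r * v / 2) by ring, Real.sinc_neg]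
  have h2 : ∫ v in Set.Iio (-δ), fejer r v ≤ 2 / δ := by
    rw [← integral_Iic_eq_integral_Iio]
    have := integral_comp_neg_Ioi δ (fejer r)
    simp only [heven] at this
    rw [← this]
    exact h1
  have h3 : (Set.Icc (-δ) δ)ᶜ = Set.Iio (-δ) ∪ Set.Ioi δ := by
    ext x
    simp only [Set.mem_compl_iff, Set.mem_Icc, Set.mem_union, Set.mem_Iio, Set.mem_Ioi, not_and_or,
      not_le]
  have h4 := integral_add_compl (measurableSet_Icc (a := -δ) (b := δ)) (integrable_fejer r)
  rw [h3, setIntegral_union (by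
    rw [Set.disjoint_left]
    intro x hx hx'
    simp at hx hx'
    linarith) measurableSet_Ioi (integrable_fejer r).integrableOn
    (integrable_fejer r).integrableOn, integral_fejer hr] at h4
  have p1 : 0 ≤ ∫ v in Set.Ioi δ, fejer r v := integral_nonneg fun _ => fejer_nonneg _ _
  have p2 : 0 ≤ ∫ v in Set.Iio (-δ), fejer r v := integral_nonneg fun _ => fejer_nonneg _ _
  have : 4 / δ = 2 / δ + 2 / δ := by ring
  rw [abs_le]
  constructor <;> linarith

end ZK

end

noncomputable section

namespace ZK

variable {d : ℕ}

/-! ### The time integrals of the first corrections -/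

/-- With `u = s - s'` the inner phase combines with the outer one and depends on `u` only.
Integrating by parts in `s`, with primitive `-damp a (t - s)` of the outer damping, leaves a single
integral: this primitive vanishes at `t` and the inner integral at `0`. -/
theorem integral_duhamel_twice (a b t v : ℝ) :
    ∫ s in (0 : ℝ)..t, (∫ s' in (0 : ℝ)..s,
        Complex.exp (Complex.I * (s' * -v : ℝ) - (b * (s - s') : ℝ))) *
        Complex.exp (Complex.I * (s * v : ℝ) - (a * (t - s) : ℝ)) =
      ∫ u in (0 : ℝ)..t, ((Real.exp (-(b * u)) * damp a (t - u) : ℝ) : ℂ) *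
        Complex.exp (Complex.I * (u * v : ℝ)) := by
  set g : ℝ → ℂ := fun u => Complex.exp (Complex.I * (u * v : ℝ) - (b * u : ℝ)) with hg
  have cg : Continuous g := by fun_prop
  have hP : ∀ s, HasDerivAt (fun s => ∫ u in (0 : ℝ)..s, g u) (g s) s := fun s =>
    intervalIntegral.integral_hasDerivAt_right (cg.intervalIntegrable _ _)
      (cg.stronglyMeasurableAtFilter _ _) cg.continuousAt
  have hdamp : ∀ s, HasDerivAt (fun s => -((damp a (t - s) : ℝ) : ℂ))
      ((Real.exp (-(a * (t - s))) : ℝ) : ℂ) s := by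
    intro s
    have h := ((hasDerivAt_damp a (t - s)).comp s ((hasDerivAt_id' s).const_sub t)).ofReal_comp.neg
    convert! h using 1
    simp
  have e1 : ∀ s, (∫ s' in (0 : ℝ)..s,
        Complex.exp (Complex.I * (s' * -v : ℝ) - (b * (s - s') : ℝ))) *
        Complex.exp (Complex.I * (s * v : ℝ) - (a * (t - s) : ℝ)) =
      (∫ u in (0 : ℝ)..s, g u) * ((Real.exp (-(a * (t - s))) : ℝ) : ℂ) := by
    intro s
    have h1 := intervalIntegral.integral_comp_sub_left (a := 0) (b := s) g s
    rw [sub_self, sub_zero] at h1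
    rw [← h1, ← intervalIntegral.integral_mul_const, ← intervalIntegral.integral_mul_const]
    refine intervalIntegral.integral_congr fun s' _ => ?_
    simp only [hg]
    rw [Complex.ofReal_exp, ← Complex.exp_add, ← Complex.exp_add]
    congr 1
    push_cast
    ring
  simp only [e1]
  have ce : Continuous fun s : ℝ => ((Real.exp (-(a * (t - s))) : ℝ) : ℂ) := by fun_prop
  rw [intervalIntegral.integral_mul_deriv_eq_deriv_mul (fun s _ => hP s) (fun s _ => hdamp s)
    (cg.intervalIntegrable _ _) (ce.intervalIntegrable _ _)]
  simp only [sub_self, damp_zero, Complex.ofReal_zero, neg_zero, mul_zero,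
    intervalIntegral.integral_same, zero_mul, zero_sub, mul_neg, intervalIntegral.integral_neg,
    neg_neg]
  refine intervalIntegral.integral_congr fun u _ => ?_
  simp only [hg]
  rw [Complex.exp_sub, div_eq_mul_inv, ← Complex.exp_neg]
  push_cast
  ring

theorem re_integral_eq_timeKernel (a b t v : ℝ) :
    (∫ u in (0 : ℝ)..t, ((Real.exp (-(b * u)) * damp a (t - u) : ℝ) : ℂ) *
        Complex.exp (Complex.I * (u * v : ℝ))).re = timeKernel a b t v := by
  have hc : Continuous fun u : ℝ => ((Real.exp (-(b * u)) * damp a (t - u) : ℝ) : ℂ) *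
        Complex.exp (Complex.I * (u * v : ℝ)) := by fun_prop
  have := Complex.reCLM.intervalIntegral_comp_comm (hc.intervalIntegrable (μ := volume) 0 t)
  rw [Complex.reCLM_apply] at this
  rw [← this]
  unfold timeKernel
  refine intervalIntegral.integral_congr fun u _ => ?_
  simp only [Complex.reCLM_apply, Complex.re_ofReal_mul]
  rw [mul_comm Complex.I, Complex.exp_ofReal_mul_I_re]

/-- With `P s` the integral up to `s` of the integrand `g`, the derivative of `|P|²` is `2 Re (P
conj g)`. Writing `t - s' = (s - s') + (t - s)`, this is the nested integral of
`integral_duhamel_twice` with outer rate `2a` and inner rate `a`. -/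
theorem mul_conj_integral_exp (a t v : ℝ) :
    (∫ s in (0 : ℝ)..t, Complex.exp (Complex.I * (s * v : ℝ) - (a * (t - s) : ℝ))) *
      conj (∫ s in (0 : ℝ)..t, Complex.exp (Complex.I * (s * v : ℝ) - (a * (t - s) : ℝ))) =
      ((2 * timeKernel (2 * a) a t v : ℝ) : ℂ) := by
  set g : ℝ → ℂ := fun s => Complex.exp (Complex.I * (s * v : ℝ) - (a * (t - s) : ℝ)) with hg
  have cg : Continuous g := by fun_prop
  have hP : ∀ s, HasDerivAt (fun s => ∫ u in (0 : ℝ)..s, g u) (g s) s := fun s =>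
    intervalIntegral.integral_hasDerivAt_right (cg.intervalIntegrable _ _)
      (cg.stronglyMeasurableAtFilter _ _) cg.continuousAt
  set P : ℝ → ℂ := fun s => ∫ u in (0 : ℝ)..s, g u with hPdef
  have cP : Continuous P := continuous_iff_continuousAt.2 fun s => (hP s).continuousAt
  have hcP : ∀ s, HasDerivAt (fun s => conj (P s)) (conj (g s)) s := fun s => by
    simpa using (hP s).star
  have cs : Continuous (fun z : ℂ => conj z) := Complex.continuous_conj
  have key := intervalIntegral.integral_deriv_mul_eq_sub (a := 0) (b := t) (fun s _ => hP s)
    (fun s _ => hcP s) (cg.intervalIntegrable _ _) ((cs.comp cg).intervalIntegrable _ _)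
  have hP0 : P 0 = 0 := by simp [hPdef]
  rw [hP0, zero_mul, sub_zero] at key
  rw [← key]
  have hre : ∀ s, g s * conj (P s) + P s * conj (g s) = ((2 * (P s * conj (g s)).re : ℝ) : ℂ) := by
    intro s
    have := Complex.add_conj (P s * conj (g s))
    simp only [map_mul, Complex.conj_conj] at this
    rw [← this]
    ring
  simp only [hre]
  rw [intervalIntegral.integral_ofReal, intervalIntegral.integral_const_mul]
  congr 2
  have h2 := integral_duhamel_twice (2 * a) a t (-v)
  have h3 := re_integral_eq_timeKernel (2 * a) a t (-v)
  rw [← h2] at h3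
  have h4 : timeKernel (2 * a) a t (-v) = timeKernel (2 * a) a t v := by
    simp [timeKernel]
  rw [h4] at h3
  rw [← h3]
  have h5 := Complex.reCLM.intervalIntegral_comp_comm
    ((cP.mul (cs.comp cg)).intervalIntegrable (μ := volume) 0 t)
  refine h5.trans ?_
  rw [Complex.reCLM_apply]
  congr 1
  refine intervalIntegral.integral_congr fun s _ => ?_
  simp only [hPdef, hg, Pi.mul_apply, Function.comp_apply]
  rw [← intervalIntegral.integral_mul_const, ← intervalIntegral.integral_mul_const]
  refine intervalIntegral.integral_congr fun s' _ => ?_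
  rw [← Complex.exp_conj, ← Complex.exp_add, ← Complex.exp_add]
  congr 1
  simp only [map_sub, map_mul, Complex.conj_I, Complex.conj_ofReal]
  push_cast
  ring

end ZK

end

noncomputable section

namespace ZK

variable {d : ℕ}

/-! ### The first corrections as lattice sums -/

theorem pt_neg (L : ℝ) (K : Fin d → ℤ) : pt L (-K) = -pt L K := by
  ext i; simp [pt, neg_div]

theorem pt_sub (L : ℝ) (K K₁ : Fin d → ℤ) : pt L (K - K₁) = pt L K - pt L K₁ := by
  ext i; simp [pt, sub_div]

theorem pt_zero (L : ℝ) : pt L (0 : Fin d → ℤ) = 0 := by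
  ext i; simp [pt]

variable [NeZero d]

/-- The exponential in the Duhamel operator. -/
def phaseFactor (L ν t s : ℝ) (K₁ K : Fin d → ℤ) : ℂ :=
  Complex.exp (Complex.I * (s * Om (pt L K₁) (pt L (K - K₁)) (pt L K) : ℝ)
    - (ν * ‖pt L K‖ ^ 2 * (t - s) : ℝ))

theorem continuous_phaseFactor (L ν t : ℝ) (K₁ K : Fin d → ℤ) :
    Continuous fun s => phaseFactor L ν t s K₁ K := by
  unfold phaseFactor; fun_prop

theorem kx_neg (k : Vec d) : kx (-k) = -kx k := by simp [kx]

theorem disp_neg (k : Vec d) : disp (-k) = -disp k := by simp [disp, kx_neg]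

theorem phaseFactor_sub (L ν t s : ℝ) (K₁ K : Fin d → ℤ) :
    phaseFactor L ν t s (K - K₁) K = phaseFactor L ν t s K₁ K := by
  unfold phaseFactor Om
  rw [sub_sub_cancel, add_comm (disp (pt L (K - K₁)))]

theorem duhamel_comm (L lam ν : ℝ) (φ ψ : ℝ → (Fin d → ℤ) → ℂ) (t : ℝ) (K : Fin d → ℤ) :
    duhamel L lam ν φ ψ t K = duhamel L lam ν ψ φ t K := by
  unfold duhamel
  congr 1
  rw [← (Equiv.subLeft K).tsum_eq]
  refine tsum_congr fun K₁ => intervalIntegral.integral_congr fun s _ => ?_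
  have := phaseFactor_sub L ν t s K₁ K
  unfold phaseFactor at this
  simp only [Equiv.subLeft_apply, this]
  rw [sub_sub_cancel]
  ring

theorem duhamel_of_kx_eq_zero (L lam ν : ℝ) (φ ψ : ℝ → (Fin d → ℤ) → ℂ) (t : ℝ) {K : Fin d → ℤ}
    (hK : kx (pt L K) = 0) : duhamel L lam ν φ ψ t K = 0 := by
  simp [duhamel, hK]

theorem treeTerm_one (L lam ν : ℝ) (ξ : (Fin d → ℤ) → ℂ) (Λ : Finset (Fin d → ℤ))
    (hΛ : ∀ K ∉ Λ, ξ K = 0) (t : ℝ) (K : Fin d → ℤ) :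
    duhamel L lam ν (fun _ => ξ) (fun _ => ξ) t K =
      Complex.I * lam / L ^ d * ∑ K₁ ∈ Λ, (kx (pt L K) : ℂ) *
        (∫ s in (0 : ℝ)..t, phaseFactor L ν t s K₁ K) * (ξ K₁ * ξ (K - K₁)) := by
  unfold duhamel
  congr 1
  rw [tsum_eq_sum (s := Λ) fun K₁ h => by simp [hΛ K₁ h]]
  refine Finset.sum_congr rfl fun K₁ _ => ?_
  rw [mul_comm (kx (pt L K) : ℂ), mul_assoc, ← intervalIntegral.integral_mul_const]
  refine intervalIntegral.integral_congr fun s _ => ?_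
  simp only [phaseFactor]
  ring

/-- The outer sum is cut off only by the factor `ξ` at `K - K₁`, hence the assumption that `Λ` is
stable under `K₁ ↦ K - K₁`. -/
theorem treeTerm_two (L lam ν : ℝ) (ξ : (Fin d → ℤ) → ℂ) (Λ : Finset (Fin d → ℤ))
    (hΛ : ∀ K ∉ Λ, ξ K = 0) (t : ℝ) {K : Fin d → ℤ} (hK : ∀ K₁ ∈ Λ, K - K₁ ∈ Λ) :
    duhamel L lam ν (duhamel L lam ν (fun _ => ξ) (fun _ => ξ)) (fun _ => ξ) t K =
      (Complex.I * lam / L ^ d) ^ 2 * ∑ K₁ ∈ Λ, ∑ K₃ ∈ Λ,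
        ((kx (pt L K) : ℂ) * (kx (pt L K₁) : ℂ) *
        ∫ s in (0 : ℝ)..t, (∫ s' in (0 : ℝ)..s, phaseFactor L ν s s' K₃ K₁) *
          phaseFactor L ν t s K₁ K) * (ξ K₃ * ξ (K₁ - K₃) * ξ (K - K₁)) := by
  conv_lhs => rw [duhamel]
  rw [sq (Complex.I * (lam : ℂ) / (L : ℂ) ^ d), mul_assoc (Complex.I * (lam : ℂ) / (L : ℂ) ^ d)]
  congr 1
  rw [tsum_eq_sum (s := Λ) fun K₁ h => by
    have : K - K₁ ∉ Λ := fun h' => h (by simpa using hK _ h')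
    simp [hΛ _ this], Finset.mul_sum]
  refine Finset.sum_congr rfl fun K₁ _ => ?_
  have hinner : ∀ s, duhamel L lam ν (fun _ => ξ) (fun _ => ξ) s K₁ = _ :=
    fun s => treeTerm_one L lam ν ξ Λ hΛ s K₁
  simp only [hinner]
  have hcont : ∀ K₃, Continuous fun s : ℝ => (∫ s' in (0 : ℝ)..s, phaseFactor L ν s s' K₃ K₁) *
          phaseFactor L ν t s K₁ K := by
    intro K₃
    refine Continuous.mul ?_ (continuous_phaseFactor L ν t K₁ K)
    refine intervalIntegral.continuous_parametric_intervalIntegral_of_continuous ?_ continuous_id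
    unfold phaseFactor
    fun_prop
  have : ∀ s, (kx (pt L K) : ℂ) * (Complex.I * lam / L ^ d * ∑ K₃ ∈ Λ, (kx (pt L K₁) : ℂ) *
        (∫ s' in (0 : ℝ)..s, phaseFactor L ν s s' K₃ K₁) * (ξ K₃ * ξ (K₁ - K₃))) * ξ (K - K₁) *
        Complex.exp (Complex.I * (s * Om (pt L K₁) (pt L (K - K₁)) (pt L K) : ℝ)
          - (ν * ‖pt L K‖ ^ 2 * (t - s) : ℝ)) =
      ∑ K₃ ∈ Λ, (Complex.I * lam / L ^ d) * (((kx (pt L K) : ℂ) * (kx (pt L K₁) : ℂ)) *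
        (ξ K₃ * ξ (K₁ - K₃) * ξ (K - K₁))) *
        ((∫ s' in (0 : ℝ)..s, phaseFactor L ν s s' K₃ K₁) * phaseFactor L ν t s K₁ K) := by
    intro s
    rw [Finset.mul_sum, Finset.mul_sum, Finset.sum_mul, Finset.sum_mul]
    refine Finset.sum_congr rfl fun K₃ _ => ?_
    simp only [phaseFactor]
    ring
  simp only [this]
  rw [intervalIntegral.integral_finsetSum fun K₃ _ =>
    ((hcont K₃).intervalIntegrable _ _).const_mul _, Finset.mul_sum]
  refine Finset.sum_congr rfl fun K₃ _ => ?_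
  rw [intervalIntegral.integral_const_mul]
  ring

/-- The resonance function at the lattice points indexed by `K₁`, `K - K₁`, `K`. -/
def latOm (L : ℝ) (K₁ K : Fin d → ℤ) : ℝ := Om (pt L K₁) (pt L (K - K₁)) (pt L K)

variable {S : Type*} [MeasurableSpace S] {μ : Measure S} {η : (Fin d → ℤ) → S → ℂ}

/-- Of the three Wick pairings, the one inside a tree forces `K = 0` and is excluded. The two cross
pairings agree because the phase is symmetric under `K₁ ↦ K - K₁`; together with the `2` of
`mul_conj_integral_exp` they make the `4`. -/
theorem integral_gain (h : IsGaussianData μ η) (L lam ν : ℝ) (nin : Vec d → ℝ)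
    (h0 : ∀ k, 0 ≤ nin k) (Λ : Finset (Fin d → ℤ))
    (hΛ : ∀ K ∉ Λ, nin (pt L K) = 0) (t : ℝ) {K : Fin d → ℤ} (hK0 : K ≠ 0)
    (hK : ∀ K₁ ∈ Λ, K - K₁ ∈ Λ) :
    ∫ w, duhamel L lam ν (fun _ => xi L nin η w) (fun _ => xi L nin η w) t K *
        conj (duhamel L lam ν (fun _ => xi L nin η w) (fun _ => xi L nin η w) t K) ∂μ =
      (((lam / L ^ d) ^ 2 * ∑ K₁ ∈ Λ, 4 * kx (pt L K) ^ 2 * (nin (pt L K₁) * nin (pt L (K - K₁))) *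
        timeKernel (2 * (ν * ‖pt L K‖ ^ 2)) (ν * ‖pt L K‖ ^ 2) t (latOm L K₁ K) : ℝ) : ℂ) := by
  have hξ : ∀ w, ∀ K₁ ∉ Λ, xi L nin η w K₁ = 0 := fun w K₁ hK₁ => by simp [xi, hΛ K₁ hK₁]
  set A : (Fin d → ℤ) → ℂ := fun K₁ => ∫ s in (0 : ℝ)..t, phaseFactor L ν t s K₁ K with hA
  set f : (Fin d → ℤ) → ℂ := fun K₁ => (Real.sqrt (nin (pt L K₁)) : ℂ) with hf
  have hff : ∀ K₁, f K₁ * f K₁ = (nin (pt L K₁) : ℂ) := fun K₁ => by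
    simp only [hf]
    rw [← Complex.ofReal_mul, Real.mul_self_sqrt (h0 _)]
  have hexp : ∀ w, duhamel L lam ν (fun _ => xi L nin η w) (fun _ => xi L nin η w) t K *
        conj (duhamel L lam ν (fun _ => xi L nin η w) (fun _ => xi L nin η w) t K) =
      ∑ K₁ ∈ Λ, ∑ K₂ ∈ Λ, ((lam / L ^ d) ^ 2 * kx (pt L K) ^ 2 * (A K₁ * conj (A K₂)) *
        (f K₁ * f (K - K₁) * f K₂ * f (K - K₂))) *
        (η K₁ w * η (K - K₁) w * (η (-K₂) w * η (-(K - K₂)) w)) := by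
    intro w
    rw [treeTerm_one L lam ν _ Λ (hξ w), map_mul, mul_mul_mul_comm, map_sum,
      Finset.sum_mul_sum, Finset.mul_sum]
    refine Finset.sum_congr rfl fun K₁ _ => ?_
    rw [Finset.mul_sum]
    refine Finset.sum_congr rfl fun K₂ _ => ?_
    simp only [xi, map_mul, map_div₀, map_pow, Complex.conj_I, Complex.conj_ofReal, h.symm, hA, hf]
    ring_nf
    simp only [Complex.I_sq]
    ring
  simp only [hexp]
  rw [integral_finsetSum _ fun K₁ _ => integrable_finsetSum _ fun K₂ _ =>
    (h.integrable_mul_four _ _ _ _).const_mul _]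
  push_cast
  rw [Finset.mul_sum]
  refine Finset.sum_congr rfl fun K₁ hK₁ => ?_
  rw [integral_finsetSum _ fun K₂ _ => (h.integrable_mul_four _ _ _ _).const_mul _]
  simp only [integral_const_mul, h.wick]
  have hAA : A (K - K₁) = A K₁ := by simp only [hA, phaseFactor_sub]
  have hT : A K₁ * conj (A K₁) =
      ((2 * timeKernel (2 * (ν * ‖pt L K‖ ^ 2)) (ν * ‖pt L K‖ ^ 2) t (latOm L K₁ K) : ℝ) : ℂ) :=
    mul_conj_integral_exp (ν * ‖pt L K‖ ^ 2) t (latOm L K₁ K)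
  have c1 : ¬ (K₁ + (K - K₁) = 0) := by simpa using hK0
  have c2 : ∀ K₂, (K₁ + -K₂ = 0) ↔ K₁ = K₂ := fun K₂ => by rw [← sub_eq_add_neg, sub_eq_zero]
  have c3 : ∀ K₂, (K - K₁ + -(K - K₂) = 0) ↔ K₁ = K₂ := fun K₂ => by
    rw [← sub_eq_add_neg, sub_eq_zero, sub_right_inj]
  have c5 : ∀ K₂, (K - K₁ + -K₂ = 0) ↔ K - K₁ = K₂ := fun K₂ => by
    rw [← sub_eq_add_neg, sub_eq_zero]
  have ite_mul_self : ∀ (p : Prop) [Decidable p],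
      (if p then (1 : ℂ) else 0) * (if p then 1 else 0) = if p then 1 else 0 := by
    intro p _
    split_ifs <;> simp
  simp only [c1, c2, c3, c5, if_false, zero_mul, zero_add, ite_mul_self]
  simp only [mul_add, Finset.sum_add_distrib, mul_ite, mul_one, mul_zero, Finset.sum_ite_eq, hK₁, hK K₁ hK₁, if_true,
    sub_sub_cancel, hAA]
  have e1 : f K₁ * f (K - K₁) * f K₁ * f (K - K₁) = nin (pt L K₁) * nin (pt L (K - K₁)) := by
    rw [← hff, ← hff]; ring
  have e2 : f K₁ * f (K - K₁) * f (K - K₁) * f K₁ = nin (pt L K₁) * nin (pt L (K - K₁)) := by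
    rw [← hff, ← hff]; ring
  rw [e1, e2, hT]
  push_cast
  ring

/-- The leaf of the one-node tree is paired with a leaf of the inner branch, in two ways that agree
by symmetry of the inner phase; this is the factor `2`. -/
theorem integral_loss (h : IsGaussianData μ η) (L lam ν : ℝ) (nin : Vec d → ℝ)
    (h0 : ∀ k, 0 ≤ nin k) (heven : ∀ k, nin (-k) = nin k) (Λ : Finset (Fin d → ℤ))
    (hΛ : ∀ K ∉ Λ, nin (pt L K) = 0) (t : ℝ) {K : Fin d → ℤ}
    (hK : ∀ K₁ ∈ Λ, K - K₁ ∈ Λ) :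
    ∫ w, duhamel L lam ν (duhamel L lam ν (fun _ => xi L nin η w) (fun _ => xi L nin η w))
        (fun _ => xi L nin η w) t K * conj (xi L nin η w K) ∂μ =
      -(lam / L ^ d : ℂ) ^ 2 * ∑ K₁ ∈ Λ, (2 * kx (pt L K) * nin (pt L K) *
        (kx (pt L K₁) * nin (pt L (K - K₁))) : ℝ) *
        ∫ u in (0 : ℝ)..t, ((Real.exp (-(ν * ‖pt L K₁‖ ^ 2 * u)) *
          damp (ν * ‖pt L K‖ ^ 2) (t - u) : ℝ) : ℂ) *
          Complex.exp (Complex.I * (u * latOm L K₁ K : ℝ)) := by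
  have hξ : ∀ w, ∀ K₁ ∉ Λ, xi L nin η w K₁ = 0 := fun w K₁ hK₁ => by simp [xi, hΛ K₁ hK₁]
  set M : (Fin d → ℤ) → (Fin d → ℤ) → ℂ := fun K₁ K₃ =>
    ∫ s in (0 : ℝ)..t, (∫ s' in (0 : ℝ)..s, phaseFactor L ν s s' K₃ K₁) *
          phaseFactor L ν t s K₁ K with hM
  set f : (Fin d → ℤ) → ℂ := fun K₁ => (Real.sqrt (nin (pt L K₁)) : ℂ) with hf
  have hff : ∀ K₁, f K₁ * f K₁ = (nin (pt L K₁) : ℂ) := fun K₁ => by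
    simp only [hf]
    rw [← Complex.ofReal_mul, Real.mul_self_sqrt (h0 _)]
  have hf0 : ∀ K₁ ∉ Λ, f K₁ = 0 := fun K₁ hK₁ => by simp [hf, hΛ K₁ hK₁]
  have hfe : ∀ K₁, f (-K₁) = f K₁ := fun K₁ => by simp only [hf, pt_neg, heven]
  have hexp : ∀ w, duhamel L lam ν (duhamel L lam ν (fun _ => xi L nin η w)
        (fun _ => xi L nin η w)) (fun _ => xi L nin η w) t K * conj (xi L nin η w K) =
      ∑ K₁ ∈ Λ, ∑ K₃ ∈ Λ, (-(lam / L ^ d : ℂ) ^ 2 * (kx (pt L K) * kx (pt L K₁) * M K₁ K₃) *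
        (f K₃ * f (K₁ - K₃) * f (K - K₁) * f K)) *
        (η K₃ w * η (K₁ - K₃) w * (η (K - K₁) w * η (-K) w)) := by
    intro w
    rw [treeTerm_two L lam ν _ Λ (hξ w) t hK, mul_assoc, Finset.sum_mul, Finset.mul_sum]
    refine Finset.sum_congr rfl fun K₁ _ => ?_
    rw [Finset.sum_mul, Finset.mul_sum]
    refine Finset.sum_congr rfl fun K₃ _ => ?_
    simp only [xi, map_mul, Complex.conj_ofReal, h.symm, hM, hf]
    ring_nf
    simp only [Complex.I_sq]
    ring
  simp only [hexp]
  rw [integral_finsetSum _ fun K₁ _ => integrable_finsetSum _ fun K₂ _ =>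
    (h.integrable_mul_four _ _ _ _).const_mul _, Finset.mul_sum]
  refine Finset.sum_congr rfl fun K₁ hK₁ => ?_
  rw [integral_finsetSum _ fun K₂ _ => (h.integrable_mul_four _ _ _ _).const_mul _]
  simp only [integral_const_mul, h.wick]
  rw [← integral_duhamel_twice (ν * ‖pt L K‖ ^ 2) (ν * ‖pt L K₁‖ ^ 2) t (latOm L K₁ K)]
  have hM1 : M K₁ K = ∫ s in (0 : ℝ)..t, (∫ s' in (0 : ℝ)..s,
        Complex.exp (Complex.I * (s' * -latOm L K₁ K : ℝ) - (ν * ‖pt L K₁‖ ^ 2 * (s - s') : ℝ))) *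
        Complex.exp (Complex.I * (s * latOm L K₁ K : ℝ) - (ν * ‖pt L K‖ ^ 2 * (t - s) : ℝ)) := by
    -- After the pairing the inner vertex reverses the outer one, and `Λ` is odd. The total phase
    -- thus depends only on the difference of the two times.
    have : Om (pt L K) (pt L (K₁ - K)) (pt L K₁) = -latOm L K₁ K := by
      unfold latOm Om
      rw [← neg_sub K K₁, pt_neg, disp_neg]
      ring
    simp only [hM, phaseFactor, this]
    rfl
  have hM2 : M K₁ (K₁ - K) = M K₁ K := by simp only [hM, phaseFactor_sub]
  rw [← hM1]
  -- The pairing of the two inner leaves survives only for `K₁ = 0`, where the inner factor `k_x`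
  -- vanishes.
  by_cases hz : K₁ = 0
  · have : kx (pt L K₁) = 0 := by rw [hz, pt_zero]; simp [kx]
    simp [this]
  have c1 : ∀ K₃, ¬ (K₃ + (K₁ - K₃) = 0) := fun K₃ => by simpa using hz
  have c2 : ∀ K₃, (K₃ + (K - K₁) = 0) ↔ K₁ - K = K₃ := fun K₃ => by
    rw [← neg_sub K K₁, eq_comm (a := -(K - K₁)), eq_neg_iff_add_eq_zero]
  have c3 : ∀ K₃, (K₁ - K₃ + -K = 0) ↔ K₁ - K = K₃ := fun K₃ => by
    rw [← sub_eq_add_neg, sub_eq_zero]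
    constructor <;> intro hh
    · rw [← hh]; abel
    · rw [← hh]; abel
  have c4 : ∀ K₃, (K₃ + -K = 0) ↔ K = K₃ := fun K₃ => by
    rw [← sub_eq_add_neg, sub_eq_zero, eq_comm]
  -- The index singled out by a pairing may lie outside `Λ`, but then its amplitude is zero and the
  -- membership test can be dropped.
  have s1 : ∀ (g : (Fin d → ℤ) → ℂ) (K₃ : Fin d → ℤ), (K₃ ∉ Λ → g K₃ = 0) →
      (if K₃ ∈ Λ then g K₃ else 0) = g K₃ := by
    intro g K₃ hg
    split_ifs with hm
    · rfl
    · exact (hg hm).symm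
  have ite_mul_self : ∀ (p : Prop) [Decidable p],
      (if p then (1 : ℂ) else 0) * (if p then 1 else 0) = if p then 1 else 0 := by
    intro p _
    split_ifs <;> simp
  simp only [c1, c2, c3, c4, sub_right_inj, if_false, zero_mul, zero_add, ite_mul_self]
  simp only [mul_add, Finset.sum_add_distrib, mul_ite, mul_one, mul_zero, Finset.sum_ite_eq]
  rw [s1 (fun K₃ => -(lam / L ^ d : ℂ) ^ 2 * (kx (pt L K) * kx (pt L K₁) * M K₁ K₃) *
        (f K₃ * f (K₁ - K₃) * f (K - K₁) * f K)) _ fun hh => by simp [hf0 _ hh],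
    s1 (fun K₃ => -(lam / L ^ d : ℂ) ^ 2 * (kx (pt L K) * kx (pt L K₁) * M K₁ K₃) *
        (f K₃ * f (K₁ - K₃) * f (K - K₁) * f K)) _ fun hh => by simp [hf0 _ hh]]
  have e0 : f (K₁ - K) = f (K - K₁) := by rw [← neg_sub K K₁, hfe]
  simp only [sub_sub_cancel, hM2, e0]
  have e1 : f (K - K₁) * f K * f (K - K₁) * f K = nin (pt L K) * nin (pt L (K - K₁)) := by
    rw [← hff, ← hff]; ring
  have e2 : f K * f (K - K₁) * f (K - K₁) * f K = nin (pt L K) * nin (pt L (K - K₁)) := by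
    rw [← hff, ← hff]; ring
  rw [e1, e2]
  push_cast
  ring

/-- There is one tree with one branch and there are two with two branches; the latter have equal
terms because the Duhamel operator is symmetric. Exchanging the two trees of a pair conjugates the
expectation. -/
theorem nCorr_one (μ : Measure S) (L lam ν : ℝ) (nin : Vec d → ℝ) (η : (Fin d → ℤ) → S → ℂ)
    (t : ℝ) (K : Fin d → ℤ) :
    nCorr μ L lam ν nin η 1 t K =
      (∫ w, duhamel L lam ν (fun _ => xi L nin η w) (fun _ => xi L nin η w) t K *
        conj (duhamel L lam ν (fun _ => xi L nin η w) (fun _ => xi L nin η w) t K) ∂μ) +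
      2 * ((∫ w, duhamel L lam ν (duhamel L lam ν (fun _ => xi L nin η w) (fun _ => xi L nin η w))
        (fun _ => xi L nin η w) t K * conj (xi L nin η w K) ∂μ) +
      conj (∫ w, duhamel L lam ν (duhamel L lam ν (fun _ => xi L nin η w) (fun _ => xi L nin η w))
        (fun _ => xi L nin η w) t K * conj (xi L nin η w K) ∂μ)) := by
  have t1 : BinaryTree.treesOfNumNodesEq 1 = {BinaryTree.node () .nil .nil} := by
    ext T
    rw [BinaryTree.mem_treesOfNumNodesEq, Finset.mem_singleton]
    rcases T with _ | ⟨_, _ | _, _ | _⟩ <;> simp [BinaryTree.numNodes]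
  have t2 : BinaryTree.treesOfNumNodesEq 2 = {BinaryTree.node () (.node () .nil .nil) .nil,
      BinaryTree.node () .nil (.node () .nil .nil)} := by
    ext T
    rw [BinaryTree.mem_treesOfNumNodesEq, Finset.mem_insert, Finset.mem_singleton]
    rcases T with _ | ⟨_, _ | ⟨_, _ | _, _ | _⟩, _ | ⟨_, _ | _, _ | _⟩⟩ <;>
      simp [BinaryTree.numNodes] <;> omega
  have a2 : Finset.HasAntidiagonal.antidiagonal (2 * 1) = {(0, 2), (1, 1), (2, 0)} := by decide
  have hcomm : ∀ w, duhamel L lam ν (fun _ => xi L nin η w)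
      (duhamel L lam ν (fun _ => xi L nin η w) (fun _ => xi L nin η w)) t K =
      duhamel L lam ν (duhamel L lam ν (fun _ => xi L nin η w) (fun _ => xi L nin η w))
        (fun _ => xi L nin η w) t K := fun w => duhamel_comm _ _ _ _ _ _ _
  unfold nCorr
  rw [a2, Finset.sum_insert (by decide), Finset.sum_insert (by decide), Finset.sum_singleton]
  simp only [BinaryTree.treesOfNumNodesEq_zero, t1, t2, Finset.sum_singleton]
  rw [Finset.sum_pair (by decide), Finset.sum_pair (by decide)]
  simp only [treeTerm, hcomm]
  have hconj := integral_conj (μ := μ) (f := fun w => duhamel L lam ν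
    (duhamel L lam ν (fun _ => xi L nin η w) (fun _ => xi L nin η w))
        (fun _ => xi L nin η w) t K * conj (xi L nin η w K))
  simp only [map_mul, Complex.conj_conj] at hconj
  rw [← hconj]
  simp only [mul_comm (conj _) (xi L nin η _ K)]
  ring

theorem nCorr_of_kx_eq_zero (μ : Measure S) {L : ℝ} (lam ν : ℝ) (nin : Vec d → ℝ)
    (η : (Fin d → ℤ) → S → ℂ) (t : ℝ) {K : Fin d → ℤ} (hK : kx (pt L K) = 0) :
    nCorr μ L lam ν nin η 1 t K = 0 := by
  rw [nCorr_one]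
  simp [duhamel_of_kx_eq_zero _ _ _ _ _ _ hK]

theorem nCorr_eq (h : IsGaussianData μ η) (L lam ν : ℝ) (nin : Vec d → ℝ)
    (h0 : ∀ k, 0 ≤ nin k) (heven : ∀ k, nin (-k) = nin k) (Λ : Finset (Fin d → ℤ))
    (hΛ : ∀ K ∉ Λ, nin (pt L K) = 0) (t : ℝ) {K : Fin d → ℤ} (hK0 : K ≠ 0)
    (hK : ∀ K₁ ∈ Λ, K - K₁ ∈ Λ) :
    nCorr μ L lam ν nin η 1 t K =
      (((lam / L ^ d) ^ 2 * (4 * kx (pt L K) ^ 2 *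
        ∑ K₁ ∈ Λ, (nin (pt L K₁) * nin (pt L (K - K₁))) *
          timeKernel (2 * (ν * ‖pt L K‖ ^ 2)) (ν * ‖pt L K‖ ^ 2) t (latOm L K₁ K) -
        8 * kx (pt L K) * ∑ K₁ ∈ Λ, (nin (pt L K) * (kx (pt L K₁) * nin (pt L (K - K₁)))) *
          timeKernel (ν * ‖pt L K‖ ^ 2) (ν * ‖pt L K₁‖ ^ 2) t (latOm L K₁ K)) : ℝ) : ℂ) := by
  rw [nCorr_one, integral_gain h L lam ν nin h0 Λ hΛ t hK0 hK,
    integral_loss h L lam ν nin h0 heven Λ hΛ t hK, Complex.add_conj]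
  have : (-(lam / L ^ d : ℂ) ^ 2) = ((-(lam / L ^ d) ^ 2 : ℝ) : ℂ) := by push_cast; ring
  rw [this, Complex.re_ofReal_mul, Complex.re_sum]
  simp only [Complex.re_ofReal_mul, re_integral_eq_timeKernel]
  norm_cast
  simp only [Finset.mul_sum, ← Finset.sum_sub_distrib, ← Finset.sum_add_distrib]
  refine Finset.sum_congr rfl fun K₁ _ => ?_
  ring

end ZK

end

noncomputable section

namespace ZK

variable {d : ℕ}

/-! ### Lattice sums of slowly oscillating functions -/

/-- The lattice points of `ℤ^d` in the cube of half-side `⌈L (R + d)⌉`. -/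
def box (d : ℕ) (L R : ℝ) : Finset (Fin d → ℤ) :=
  Fintype.piFinset fun _ => Finset.Icc (-⌈L * (R + d)⌉) ⌈L * (R + d)⌉

/-- The closed fundamental cell of `ℤ_L^d`. -/
def cell (d : ℕ) (L : ℝ) : Set (Vec d) := {y | ∀ i, y i ∈ Set.Icc 0 (1 / L)}

/-- The average of `f` over the translate of `ℤ_L^d` by `y`. -/
def latSum (L R : ℝ) (f : Vec d → ℂ) (y : Vec d) : ℂ :=
  (1 / L ^ d : ℝ) * ∑ K ∈ box d L R, f (pt L K + y)

theorem abs_apply_le_norm (y : Vec d) (i : Fin d) : |y i| ≤ ‖y‖ := by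
  simpa using PiLp.norm_apply_le y i

theorem norm_le_of_mem_cell {L : ℝ} (hL : 1 ≤ L) {y : Vec d} (hy : y ∈ cell d L) : ‖y‖ ≤ d := by
  have h1 : ‖y‖ ^ 2 ≤ (d : ℝ) ^ 2 := by
    rw [EuclideanSpace.norm_sq_eq]
    have : ∀ i ∈ Finset.univ, ‖y i‖ ^ 2 ≤ (1 : ℝ) := fun i _ => by
      have h := hy i
      have h1 : 1 / L ≤ 1 := by rw [div_le_one (by linarith)]; exact hL
      rw [Real.norm_of_nonneg h.1]
      nlinarith [h.1, h.2]
    refine (Finset.sum_le_sum this).trans ?_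
    simp only [Finset.sum_const, Finset.card_univ, Fintype.card_fin, nsmul_eq_mul, mul_one]
    rcases Nat.eq_zero_or_pos d with h | h
    · simp [h]
    · have : (1 : ℝ) ≤ d := by exact_mod_cast h
      nlinarith
  exact le_of_sq_le_sq h1 (by positivity)

theorem zero_mem_cell {L : ℝ} (hL : 1 ≤ L) : (0 : Vec d) ∈ cell d L := fun i => by
  simp [zero_le_one.trans hL]

theorem convex_cell (d : ℕ) (L : ℝ) : Convex ℝ (cell d L) := by
  intro x hx y hy a b ha hb hab i
  have := (convex_Icc (0 : ℝ) (1 / L)) (hx i) (hy i) ha hb hab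
  simpa using this

theorem lt_norm_of_notMem_box {L R : ℝ} (hL : 1 ≤ L) {K : Fin d → ℤ}
    (hK : K ∉ box d L R) {y : Vec d} (hy : y ∈ cell d L) : R < ‖pt L K + y‖ := by
  have hL0 : 0 < L := by linarith
  have h1 : ∃ i, L * (R + d) < |(K i : ℝ)| := by
    by_contra! hcon
    apply hK
    unfold box
    rw [Fintype.mem_piFinset]
    intro i
    have h2 := (hcon i).trans (Int.le_ceil _)
    rw [← Int.cast_abs, Int.cast_le, abs_le] at h2
    exact Finset.mem_Icc.2 h2
  obtain ⟨i, hi⟩ := h1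
  have h2 : R + d < |(pt L K) i| := by
    have : (pt L K) i = K i / L := rfl
    rw [this, abs_div, abs_of_pos hL0, lt_div_iff₀ hL0, mul_comm]
    exact hi
  have h3 := abs_apply_le_norm (pt L K) i
  have h4 := norm_le_of_mem_cell hL hy
  have h5 := norm_sub_norm_le (pt L K) (-y)
  rw [sub_neg_eq_add, norm_neg] at h5
  linarith

theorem card_box_le {L R : ℝ} (hL : 1 ≤ L) (hR : 0 ≤ R) :
    ((box d L R).card : ℝ) ≤ L ^ d * (2 * (R + d) + 3) ^ d := by
  unfold box
  rw [Fintype.card_piFinset, Finset.prod_const, Finset.card_univ, Fintype.card_fin, Int.card_Icc,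
    ← mul_pow]
  push_cast
  refine pow_le_pow_left₀ (by positivity) ?_ _
  have hc : (0 : ℤ) ≤ ⌈L * (R + d)⌉ := Int.ceil_nonneg (by positivity)
  have h1 := (Int.ceil_lt_add_one (L * (R + d))).le
  have h2 : (((⌈L * (R + d)⌉ + 1 - -⌈L * (R + d)⌉).toNat : ℕ) : ℝ) = 2 * ⌈L * (R + d)⌉ + 1 := by
    have : ((⌈L * (R + d)⌉ + 1 - -⌈L * (R + d)⌉).toNat : ℤ) = 2 * ⌈L * (R + d)⌉ + 1 := by
      rw [Int.toNat_of_nonneg (by linarith)]; ring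
    exact_mod_cast this
  rw [h2]
  nlinarith

theorem norm_latSum_le {L R M : ℝ} (hL : 1 ≤ L) (hR : 0 ≤ R) (hM : 0 ≤ M) {f : Vec d → ℂ}
    (hf : ∀ x, ‖f x‖ ≤ M) (y : Vec d) : ‖latSum L R f y‖ ≤ (2 * (R + d) + 3) ^ d * M := by
  unfold latSum
  have hL0 : 0 < L ^ d := by positivity
  rw [norm_mul, Complex.norm_real, Real.norm_of_nonneg (by positivity), one_div, inv_mul_le_iff₀ hL0]
  calc ‖∑ K ∈ box d L R, f (pt L K + y)‖ ≤ ∑ K ∈ box d L R, M :=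
        norm_sum_le_of_le _ fun K _ => hf _
    _ = (box d L R).card * M := by simp
    _ ≤ L ^ d * (2 * (R + d) + 3) ^ d * M := by gcongr; exact card_box_le hL hR
    _ = _ := by ring

/-- The half-open cells of `ℤ_L^d`. -/
def latCell (L : ℝ) (K : Fin d → ℤ) : Set (Vec d) := {x | ∀ i, ⌊L * x i⌋ = K i}

theorem measurableSet_latCell (L : ℝ) (K : Fin d → ℤ) : MeasurableSet (latCell L K) := by
  have : latCell L K = ⋂ i, (fun x : Vec d => ⌊L * x i⌋) ⁻¹' {K i} := by
    ext x; simp [latCell]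
  rw [this]
  refine MeasurableSet.iInter fun i => ?_
  exact (Int.measurable_floor.comp (by fun_prop)) (measurableSet_singleton _)

theorem latCell_zero_eq {L : ℝ} (hL : 1 ≤ L) : latCell L (0 : Fin d → ℤ) =
    (WithLp.ofLp : Vec d → (Fin d → ℝ)) ⁻¹' (Set.pi Set.univ fun _ => Set.Ico 0 (1 / L)) := by
  have hL0 : 0 < L := by linarith
  ext x
  simp only [latCell, Set.mem_ofPred_eq, Pi.zero_apply, Set.mem_preimage, Set.mem_univ_pi,
    Set.mem_Ico]
  refine forall_congr' fun i => ?_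
  rw [Int.floor_eq_zero_iff, Set.mem_Ico, lt_div_iff₀ hL0, mul_comm, mul_nonneg_iff_of_pos_right hL0]

theorem latCell_zero_subset {L : ℝ} (hL : 1 ≤ L) : latCell L (0 : Fin d → ℤ) ⊆ cell d L := by
  rw [latCell_zero_eq hL]
  intro x hx i
  exact Set.Ico_subset_Icc_self (hx i (Set.mem_univ i))

theorem volume_real_latCell_zero {L : ℝ} (hL : 1 ≤ L) :
    volume.real (latCell L (0 : Fin d → ℤ)) = 1 / L ^ d := by
  rw [measureReal_def, latCell_zero_eq hL,
    (PiLp.volume_preserving_ofLp (Fin d)).measure_preimage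
      (MeasurableSet.univ_pi fun _ => measurableSet_Ico).nullMeasurableSet, Real.volume_pi_Ico]
  simp only [sub_zero, Finset.prod_const, Finset.card_univ, Fintype.card_fin]
  rw [ENNReal.toReal_pow, ENNReal.toReal_ofReal (by positivity), one_div, one_div, inv_pow]

/-- Cut space into half-open cells and move each to the origin: the integral is the mean of the
shifted lattice sums. -/
theorem integral_eq_integral_latSum {L R : ℝ} (hL : 1 ≤ L) {f : Vec d → ℂ}
    (hf : Integrable f) (hR : ∀ x, R < ‖x‖ → f x = 0) :
    ∫ x, f x = (L ^ d : ℝ) * ∫ y in latCell L (0 : Fin d → ℤ), latSum L R f y := by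
  have hL0 : 0 < L := by linarith
  have hU : (⋃ K : Fin d → ℤ, latCell L K) = Set.univ :=
    Set.eq_univ_of_forall fun x => Set.mem_iUnion.2 ⟨fun i => ⌊L * x i⌋, fun i => rfl⟩
  have hdisj : Pairwise (Function.onFun Disjoint (latCell L : (Fin d → ℤ) → Set (Vec d))) := by
    intro K K' hKK
    rw [Function.onFun, Set.disjoint_left]
    intro x hx hx'
    exact hKK (funext fun i => (hx i).symm.trans (hx' i))
  have htrans : ∀ K : Fin d → ℤ, ∫ x in latCell L K, f x =
      ∫ y in latCell L (0 : Fin d → ℤ), f (pt L K + y) := by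
    intro K
    rw [← integral_indicator (measurableSet_latCell L K),
      ← integral_indicator (measurableSet_latCell L 0), ← integral_add_left_eq_self _ (pt L K)]
    congr 1
    funext y
    have : pt L K + y ∈ latCell L K ↔ y ∈ latCell L (0 : Fin d → ℤ) := by
      simp only [latCell, Set.mem_ofPred_eq, Pi.zero_apply]
      refine forall_congr' fun i => ?_
      have : L * (pt L K + y) i = (K i : ℝ) + L * y i := by
        simp only [pt, PiLp.add_apply]
        field_simp
      rw [this, Int.floor_intCast_add]
      constructor <;> intro h <;> linarith
    by_cases hy : y ∈ latCell L (0 : Fin d → ℤ)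
    · rw [Set.indicator_of_mem hy, Set.indicator_of_mem (this.2 hy)]
    · rw [Set.indicator_of_notMem hy, Set.indicator_of_notMem fun h => hy (this.1 h)]
  have h1 := integral_iUnion (μ := volume) (f := f) (measurableSet_latCell L) hdisj hf.integrableOn
  rw [hU, setIntegral_univ] at h1
  rw [h1]
  simp only [htrans]
  rw [tsum_eq_sum (s := box d L R) fun K hK => ?_]
  · unfold latSum
    rw [integral_const_mul, integral_finsetSum _ fun K _ => ?_, ← mul_assoc, ← Complex.ofReal_mul,
      mul_one_div_cancel (by positivity), Complex.ofReal_one, one_mul]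
    exact (hf.comp_add_left (pt L K)).integrableOn
  · rw [← integral_zero (Vec d) ℂ (μ := volume.restrict (latCell L 0))]
    refine setIntegral_congr_fun (measurableSet_latCell L 0) fun y hy => ?_
    exact hR _ (lt_norm_of_notMem_box hL hK (latCell_zero_subset hL hy))

/-- A value differs from the mean over the cell by at most the oscillation over the cell. -/
theorem norm_latSum_sub_integral_le {L R C : ℝ} (hL : 1 ≤ L) {f : Vec d → ℂ}
    (hf : Integrable f) (hR : ∀ x, R < ‖x‖ → f x = 0) {y : Vec d}
    (hC : ∀ z ∈ cell d L, ‖latSum L R f y - latSum L R f z‖ ≤ C) :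
    ‖latSum L R f y - ∫ x, f x‖ ≤ C := by
  have hL0 : 0 < L ^ d := by positivity
  have hvol : volume (latCell L (0 : Fin d → ℤ)) < ⊤ := by
    by_contra h
    have := volume_real_latCell_zero (d := d) hL
    rw [measureReal_def, not_lt_top_iff.1 h, ENNReal.toReal_top] at this
    have : 0 < 1 / L ^ d := by positivity
    linarith
  have hint : IntegrableOn (latSum L R f) (latCell L (0 : Fin d → ℤ)) := by
    have hfi : ∀ K : Fin d → ℤ, Integrable fun y => f (pt L K + y) :=
      fun K => hf.comp_add_left (pt L K)
    unfold latSum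
    exact ((integrable_finsetSum _ fun K _ => hfi K).const_mul _).integrableOn
  have hconst : IntegrableOn (fun _ => latSum L R f y) (latCell L (0 : Fin d → ℤ)) :=
    integrableOn_const hvol.ne
  have h1 : latSum L R f y - ∫ x, f x =
      (L ^ d : ℝ) * ∫ z in latCell L (0 : Fin d → ℤ), (latSum L R f y - latSum L R f z) := by
    rw [integral_eq_integral_latSum hL hf hR, integral_sub hconst hint,
      setIntegral_const, volume_real_latCell_zero hL, mul_sub, Complex.real_smul, ← mul_assoc,
      ← Complex.ofReal_mul, mul_one_div_cancel hL0.ne', Complex.ofReal_one, one_mul]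
  rw [h1, norm_mul, Complex.norm_real, Real.norm_of_nonneg hL0.le]
  have h2 := norm_setIntegral_le_of_norm_le_const hvol
    (f := fun z => latSum L R f y - latSum L R f z) (C := C)
    fun z hz => hC z (latCell_zero_subset hL hz)
  rw [volume_real_latCell_zero hL] at h2
  calc _ ≤ L ^ d * (C * (1 / L ^ d)) := by gcongr
    _ = C := by field_simp

/-- The `i`-th partial derivative. -/
def pderiv (i : Fin d) (f : Vec d → ℂ) (x : Vec d) : ℂ :=
  fderiv ℝ f x (EuclideanSpace.single i 1)

/-- Mean value inequality along a segment in the cell. The shift derivative of a lattice sum is the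
lattice sum of the derivative, and the side `1/L` of the cell is the gain. -/
theorem norm_latSum_sub_latSum_le {L R : ℝ} (hL : 1 ≤ L) {f : Vec d → ℂ}
    (hf : Differentiable ℝ f) {A : Fin d → ℝ}
    (hA : ∀ i, ∀ z ∈ cell d L, ‖latSum L R (pderiv i f) z‖ ≤ A i) {y z : Vec d}
    (hy : y ∈ cell d L) (hz : z ∈ cell d L) :
    ‖latSum L R f y - latSum L R f z‖ ≤ 1 / L * ∑ i, A i := by
  set γ : ℝ → Vec d := fun s => z + s • (y - z) with hγ
  have hγm : ∀ s ∈ Set.Icc (0 : ℝ) 1, γ s ∈ cell d L := fun s hs =>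
    (convex_cell d L).add_smul_sub_mem hz hy hs
  have hγ' : ∀ s, HasDerivAt γ (y - z) s := fun s => by
    simpa [hγ] using (((hasDerivAt_id' s).smul_const (y - z)).const_add z)
  have hder : ∀ s, HasDerivAt (fun s => latSum L R f (γ s))
      (∑ i, ((y i - z i : ℝ) : ℂ) * latSum L R (pderiv i f) (γ s)) s := by
    intro s
    have h1 : ∀ K : Fin d → ℤ, HasDerivAt (fun s => f (pt L K + γ s))
        (∑ i, ((y i - z i : ℝ) : ℂ) * pderiv i f (pt L K + γ s)) s := by
      intro K
      have h2 := (hf (pt L K + γ s)).hasFDerivAt.comp_hasDerivAt s ((hγ' s).const_add (pt L K))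
      convert! h2 using 1
      have h3 := (EuclideanSpace.basisFun (Fin d) ℝ).sum_repr (y - z)
      conv_rhs => rw [← h3]
      rw [map_sum]
      refine Finset.sum_congr rfl fun i _ => ?_
      rw [map_smul]
      simp [pderiv]
    have h4 := (HasDerivAt.fun_sum (u := box d L R) fun K _ => h1 K).const_mul
      (((1 / L ^ d : ℝ)) : ℂ)
    convert! h4 using 1
    unfold latSum
    rw [Finset.sum_comm, Finset.mul_sum]
    refine Finset.sum_congr rfl fun i _ => ?_
    rw [← Finset.mul_sum]
    ring
  have h5 := norm_image_sub_le_of_norm_deriv_le_segment_01' (C := 1 / L * ∑ i, A i)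
    (fun s _ => (hder s).hasDerivWithinAt) fun s hs => ?_
  · simpa [hγ] using h5
  · rw [Finset.mul_sum]
    refine norm_sum_le_of_le _ fun i _ => ?_
    rw [norm_mul, Complex.norm_real]
    refine mul_le_mul ?_ (hA i _ (hγm s (Set.Ico_subset_Icc_self hs))) (norm_nonneg _)
      (by positivity)
    have h1 := hy i
    have h2 := hz i
    rw [Real.norm_eq_abs, abs_le]
    constructor <;> linarith [h1.1, h1.2, h2.1, h2.2]

theorem integral_pderiv_eq_zero {f : Vec d → ℂ} (hf : ContDiff ℝ 1 f) (hs : HasCompactSupport f)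
    (i : Fin d) : ∫ x, pderiv i f x = 0 := by
  have hc : Continuous (pderiv i f) := by
    unfold pderiv
    exact (hf.continuous_fderiv one_ne_zero).clm_apply continuous_const
  have hs' : HasCompactSupport (pderiv i f) := hs.fderiv_apply ℝ _
  have h := integral_smul_fderiv_eq_neg_fderiv_smul_of_integrable (𝕜 := ℝ)
    (μ := (volume : Measure (Vec d)))
    (f := fun _ => (1 : ℝ)) (g := f) (v := EuclideanSpace.single i 1) (by simp)
    (by simp only [one_smul]; exact hc.integrable_of_hasCompactSupport hs')
    (by simp only [one_smul]; exact hf.continuous.integrable_of_hasCompactSupport hs)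
    (by fun_prop) (fun x _ => (hf.differentiable one_ne_zero) x)
  simpa [pderiv] using h

end ZK

end

/-! ### Lattice sums of oscillating functions. -/

noncomputable section

namespace ZK

variable {d : ℕ}

/-- An amplitude times an oscillating factor, for a fixed value `p` of the parameters. -/
def osc {P : Type*} (F : P × Vec d → ℂ) (Φ : P × Vec d → ℝ) (p : P) (u : ℝ) (x : Vec d) : ℂ :=
  F (p, x) * Complex.exp (Complex.I * (u * Φ (p, x) : ℝ))

theorem hasCompactSupport_osc {P : Type*} {F : P × Vec d → ℂ} {Φ : P × Vec d → ℝ} {R : ℝ}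
    (hR : ∀ p x, R < ‖x‖ → F (p, x) = 0) (p : P) (u : ℝ) : HasCompactSupport (osc F Φ p u) := by
  refine HasCompactSupport.of_support_subset_isCompact (isCompact_closedBall (0 : Vec d) R) ?_
  intro x hx
  by_contra h
  rw [mem_closedBall_zero_iff, not_le] at h
  exact hx (by simp [osc, hR p x h])

section

variable {P : Type*} [NormedAddCommGroup P] [NormedSpace ℝ P]

/-- The `i`-th partial derivative in the second variable. -/
def pderivSnd {E : Type*} [NormedAddCommGroup E] [NormedSpace ℝ E] (i : Fin d)
    (F : P × Vec d → E) (z : P × Vec d) : E :=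
  fderiv ℝ F z (0, EuclideanSpace.single i 1)

theorem contDiff_pderivSnd {E : Type*} [NormedAddCommGroup E] [NormedSpace ℝ E] (i : Fin d)
    {F : P × Vec d → E} (hF : ContDiff ℝ ∞ F) : ContDiff ℝ ∞ (pderivSnd i F) := by
  unfold pderivSnd
  exact (hF.fderiv_right (m := ∞) (by simp)).clm_apply contDiff_const

theorem pderivSnd_eq_zero {i : Fin d} {F : P × Vec d → ℂ} {R : ℝ}
    (hR : ∀ p x, R < ‖x‖ → F (p, x) = 0) {p : P} {x : Vec d} (hx : R < ‖x‖) :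
    pderivSnd i F (p, x) = 0 := by
  have : F =ᶠ[𝓝 (p, x)] fun _ => 0 := by
    have ho : IsOpen {z : P × Vec d | R < ‖z.2‖} :=
      isOpen_lt continuous_const (by fun_prop)
    filter_upwards [ho.mem_nhds hx] with z hz
    exact hR z.1 z.2 hz
  unfold pderivSnd
  rw [this.fderiv_eq]
  simp

theorem contDiff_osc {F : P × Vec d → ℂ} {Φ : P × Vec d → ℝ} (hF : ContDiff ℝ ∞ F)
    (hΦ : ContDiff ℝ ∞ Φ) (p : P) (u : ℝ) : ContDiff ℝ ∞ (osc F Φ p u) := by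
  unfold osc
  have h1 : ContDiff ℝ ∞ fun x : Vec d => (p, x) := by fun_prop
  have h2 : ContDiff ℝ ∞ fun x : Vec d => ((u * Φ (p, x) : ℝ) : ℂ) :=
    Complex.ofRealCLM.contDiff.comp (contDiff_const.mul (hΦ.comp h1))
  exact (hF.comp h1).mul (contDiff_const.mul h2).cexp

theorem pderiv_osc {F : P × Vec d → ℂ} {Φ : P × Vec d → ℝ} (hF : ContDiff ℝ ∞ F)
    (hΦ : ContDiff ℝ ∞ Φ) (p : P) (u : ℝ) (i : Fin d) (x : Vec d) :
    pderiv i (osc F Φ p u) x = osc (pderivSnd i F) Φ p u x +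
      (u : ℂ) * osc (fun z => Complex.I * (pderivSnd i Φ z : ℝ) * F z) Φ p u x := by
  have hi : HasFDerivAt (fun x : Vec d => (p, x)) (ContinuousLinearMap.inr ℝ P (Vec d)) x :=
    hasFDerivAt_prodMk_right p x
  have h1 := ((hF.differentiable (by simp)) (p, x)).hasFDerivAt.comp x hi
  have h2 := ((hΦ.differentiable (by simp)) (p, x)).hasFDerivAt.comp x hi
  have h3 := (((Complex.ofRealCLM.hasFDerivAt.comp x (h2.const_mul u)).const_mul
    Complex.I).cexp)
  have h4 := h1.mul h3
  have h5 : osc F Φ p u = F ∘ Prod.mk p * fun x => Complex.exp (Complex.I *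
      (Complex.ofRealCLM ∘ fun y => u * (Φ ∘ Prod.mk p) y) x) := by
    funext x
    simp [osc]
  unfold pderiv
  rw [h5, h4.fderiv]
  simp [osc, pderivSnd]
  ring

/-- Induction on `N`. The error is at most `1/L` times lattice sums of first derivatives. These have
integral zero, so the sums are themselves discretisation errors, of amplitudes of the same kind with
a factor at most `1 + |u|`. Each round gains `(1+|u|)/L`. The parameters range over a compact set to
make the constants uniform in `k` and in the damping. -/
theorem norm_latSum_osc_sub_integral_le {Φ : P × Vec d → ℝ} (hΦ : ContDiff ℝ ∞ Φ) {𝒦 : Set P}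
    (h𝒦 : IsCompact 𝒦) {R : ℝ} (hR0 : 0 ≤ R) (N : ℕ) :
    ∀ F : P × Vec d → ℂ, ContDiff ℝ ∞ F → (∀ p x, R < ‖x‖ → F (p, x) = 0) →
    ∃ C : ℝ, 0 ≤ C ∧ ∀ p ∈ 𝒦, ∀ u L : ℝ, 1 ≤ L → ∀ y ∈ cell d L,
      ‖latSum L R (osc F Φ p u) y - ∫ x, osc F Φ p u x‖ ≤ C * ((1 + |u|) / L) ^ N := by
  induction N with
  | zero =>
    intro F hF hR
    obtain ⟨M, hM⟩ := (h𝒦.prod (isCompact_closedBall (0 : Vec d) R)).exists_bound_of_continuousOn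
      hF.continuous.continuousOn
    have hM' : ∀ p ∈ 𝒦, ∀ u x, ‖osc F Φ p u x‖ ≤ max M 0 := by
      intro p hp u x
      by_cases hx : R < ‖x‖
      · simp [osc, hR p x hx]
      · have := hM (p, x) ⟨hp, by simpa using hx⟩
        unfold osc
        rw [norm_mul, mul_comm Complex.I, Complex.norm_exp_ofReal_mul_I, mul_one]
        exact this.trans (le_max_left _ _)
    refine ⟨(2 * (R + d) + 3) ^ d * max M 0 +
      max M 0 * volume.real (Metric.closedBall (0 : Vec d) R), by positivity, ?_⟩
    intro p hp u L hL y _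
    rw [pow_zero, mul_one]
    refine (norm_sub_le _ _).trans (add_le_add ?_ ?_)
    · exact norm_latSum_le hL hR0 (le_max_right _ _) (hM' p hp u) y
    · rw [← setIntegral_eq_integral_of_forall_compl_eq_zero (s := Metric.closedBall (0 : Vec d) R)
        fun x hx => ?_]
      · exact norm_setIntegral_le_of_norm_le_const measure_closedBall_lt_top
          fun x _ => hM' p hp u x
      · have : R < ‖x‖ := by simpa using hx
        simp [osc, hR p x this]
  | succ N ih =>
    intro F hF hR
    have hG : ∀ i : Fin d, ContDiff ℝ ∞
        (fun z : P × Vec d => Complex.I * (pderivSnd i Φ z : ℝ) * F z) := fun i =>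
      (contDiff_const.mul (Complex.ofRealCLM.contDiff.comp (contDiff_pderivSnd i hΦ))).mul hF
    have hGR : ∀ i : Fin d, ∀ p x, R < ‖x‖ →
        (fun z : P × Vec d => Complex.I * (pderivSnd i Φ z : ℝ) * F z) (p, x) = 0 :=
      fun i p x hx => by simp [hR p x hx]
    have hFR : ∀ i : Fin d, ∀ p x, R < ‖x‖ → pderivSnd i F (p, x) = 0 :=
      fun i p x hx => pderivSnd_eq_zero hR hx
    choose C₁ hC₁0 hC₁ using fun i => ih (pderivSnd i F) (contDiff_pderivSnd i hF) (hFR i)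
    choose C₂ hC₂0 hC₂ using fun i => ih _ (hG i) (hGR i)
    refine ⟨∑ i, (C₁ i + C₂ i), Finset.sum_nonneg fun i _ => add_nonneg (hC₁0 i) (hC₂0 i), ?_⟩
    intro p hp u L hL y hy
    have hL0 : 0 < L := by linarith
    have hsm := contDiff_osc hF hΦ p u
    have hcs := hasCompactSupport_osc (Φ := Φ) hR p u
    refine norm_latSum_sub_integral_le hL (hsm.continuous.integrable_of_hasCompactSupport hcs)
      (fun x hx => by simp [osc, hR p x hx]) fun z hz => ?_
    have hA : ∀ i, ∀ z ∈ cell d L, ‖latSum L R (pderiv i (osc F Φ p u)) z‖ ≤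
        (1 + |u|) * (C₁ i + C₂ i) * ((1 + |u|) / L) ^ N := by
      intro i z hz
      -- The two integrals subtracted add up to the integral of a derivative, which is zero;
      -- subtracting them brings each sum into the form of the induction hypothesis.
      have e1 : latSum L R (pderiv i (osc F Φ p u)) z =
          (latSum L R (osc (pderivSnd i F) Φ p u) z - ∫ x, osc (pderivSnd i F) Φ p u x) +
          (u : ℂ) * (latSum L R (osc (fun z => Complex.I * (pderivSnd i Φ z : ℝ) * F z) Φ p u) z -
            ∫ x, osc (fun z => Complex.I * (pderivSnd i Φ z : ℝ) * F z) Φ p u x) := by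
        have e2 := integral_pderiv_eq_zero (hsm.of_le (by simp)) hcs i
        simp only [pderiv_osc hF hΦ p u i] at e2
        rw [integral_add ((contDiff_osc (contDiff_pderivSnd i hF) hΦ p
          u).continuous.integrable_of_hasCompactSupport (hasCompactSupport_osc (hFR i) p u))
          (((contDiff_osc (hG i) hΦ p u).continuous.integrable_of_hasCompactSupport
            (hasCompactSupport_osc (hGR i) p u)).const_mul _), integral_const_mul] at e2
        have e3 : latSum L R (pderiv i (osc F Φ p u)) z =
            latSum L R (osc (pderivSnd i F) Φ p u) z + (u : ℂ) *
            latSum L R (osc (fun z => Complex.I * (pderivSnd i Φ z : ℝ) * F z) Φ p u) z := by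
          unfold latSum
          simp only [pderiv_osc hF hΦ p u i, Finset.sum_add_distrib, ← Finset.mul_sum]
          ring
        rw [e3]
        linear_combination e2
      rw [e1]
      refine (norm_add_le _ _).trans ?_
      rw [norm_mul, Complex.norm_real, Real.norm_eq_abs]
      have b1 := hC₁ i p hp u L hL z hz
      have b2 := mul_le_mul_of_nonneg_left (hC₂ i p hp u L hL z hz) (abs_nonneg u)
      have hq : 0 ≤ ((1 + |u|) / L) ^ N := by positivity
      have b3 : 0 ≤ |u| * (C₁ i * ((1 + |u|) / L) ^ N) :=
        mul_nonneg (abs_nonneg u) (mul_nonneg (hC₁0 i) hq)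
      have b4 : 0 ≤ C₂ i * ((1 + |u|) / L) ^ N := mul_nonneg (hC₂0 i) hq
      nlinarith
    refine (norm_latSum_sub_latSum_le hL (hsm.differentiable (by simp)) hA hy hz).trans_eq ?_
    rw [pow_succ, ← Finset.sum_mul, ← Finset.mul_sum]
    field_simp

end

end ZK

end

noncomputable section

namespace ZK

variable {d : ℕ}

/-! ### The centred resonance function and its sublevel sets -/

theorem lintegral_comp_mul_left_real {a : ℝ} (ha : 0 < a) {f : ℝ → ENNReal} (hf : Measurable f) :
    ∫⁻ x, f (a * x) = ENNReal.ofReal a⁻¹ * ∫⁻ x, f x := by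
  rw [← lintegral_map hf (by fun_prop : Measurable fun x => a * x),
    Real.map_volume_mul_left ha.ne', lintegral_smul_measure, abs_of_pos (inv_pos.2 ha), smul_eq_mul]

/-- In polar coordinates `r dr = d(r²)/2`: under `x² + y²` the plane measure has constant density
`π`. Two definite directions are exactly what gives a bounded density. -/
theorem lintegral_sq_add_sq_le {Ψ : ℝ → ENNReal} (hΨ : Measurable Ψ) (c : ℝ) :
    ∫⁻ p : ℝ × ℝ, Ψ (p.1 ^ 2 + p.2 ^ 2 + c) ≤ ENNReal.ofReal Real.pi * ∫⁻ v, Ψ v := by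
  rw [← lintegral_comp_polarCoord_symm]
  have h1 : ∀ p : ℝ × ℝ, ENNReal.ofReal p.1 • Ψ ((polarCoord.symm p).1 ^ 2 +
      (polarCoord.symm p).2 ^ 2 + c) = (ENNReal.ofReal p.1 * Ψ (p.1 ^ 2 + c)) * 1 := by
    intro p
    have : (polarCoord.symm p).1 ^ 2 + (polarCoord.symm p).2 ^ 2 = p.1 ^ 2 := by
      rw [polarCoord_symm_apply]
      simp only
      have := Real.cos_sq_add_sin_sq p.2
      linear_combination p.1 ^ 2 * this
    rw [this, smul_eq_mul, mul_one]
  simp only [h1]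
  have hm : Measurable fun r : ℝ => ENNReal.ofReal r * Ψ (r ^ 2 + c) := by fun_prop
  rw [show polarCoord.target = Set.Ioi (0 : ℝ) ×ˢ Set.Ioo (-Real.pi) Real.pi from rfl,
    Measure.volume_eq_prod, ← Measure.prod_restrict,
    lintegral_prod_mul hm.aemeasurable measurable_const.aemeasurable]
  simp only [lintegral_const, MeasurableSet.univ, Measure.restrict_apply, Set.univ_inter,
    Real.volume_Ioo, one_mul]
  have h2 : ∫⁻ r in Set.Ioi (0 : ℝ), ENNReal.ofReal |2 * r| * Ψ (r ^ 2 + c) ≤ ∫⁻ v, Ψ v := by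
    have := lintegral_image_eq_lintegral_abs_deriv_mul (s := Set.Ioi (0 : ℝ)) measurableSet_Ioi
      (f := fun r : ℝ => r ^ 2 + c) (f' := fun r => 2 * r)
      (fun r _ => by simpa using ((hasDerivAt_pow 2 r).add_const c).hasDerivWithinAt)
      (fun r hr r' hr' h => by
        have h3 : r ^ 2 = r' ^ 2 := by simpa using h
        exact (pow_left_inj₀ (le_of_lt hr) (le_of_lt hr') two_ne_zero).1 h3) Ψ
    rw [← this]
    exact setLIntegral_le_lintegral _ _
  have h3 : ∫⁻ r in Set.Ioi (0 : ℝ), ENNReal.ofReal |2 * r| * Ψ (r ^ 2 + c) =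
      2 * ∫⁻ r in Set.Ioi (0 : ℝ), ENNReal.ofReal r * Ψ (r ^ 2 + c) := by
    rw [← lintegral_const_mul _ hm]
    refine setLIntegral_congr_fun measurableSet_Ioi fun r hr => ?_
    have hr' : (0 : ℝ) < r := hr
    rw [abs_of_pos (by positivity), ENNReal.ofReal_mul (by norm_num), ENNReal.ofReal_ofNat,
      mul_assoc]
  calc _ = ENNReal.ofReal Real.pi *
        (2 * ∫⁻ r in Set.Ioi (0 : ℝ), ENNReal.ofReal r * Ψ (r ^ 2 + c)) := by
        rw [show Real.pi - -Real.pi = 2 * Real.pi by ring, ENNReal.ofReal_mul (by norm_num),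
          ENNReal.ofReal_ofNat]
        ring
    _ ≤ _ := by
        rw [← h3]
        gcongr

theorem lintegral_quadratic_two_le {Ψ : ℝ → ENNReal} (hΨ : Measurable Ψ) {a b : ℝ} (ha : 0 < a)
    (hb : 0 < b) (c : ℝ) :
    ∫⁻ y, ∫⁻ x, Ψ (a * x ^ 2 + b * y ^ 2 + c) ≤
      ENNReal.ofReal (Real.pi / Real.sqrt (a * b)) * ∫⁻ v, Ψ v := by
  have h1 : ∀ y, ∫⁻ x, Ψ (a * x ^ 2 + b * y ^ 2 + c) =
      ENNReal.ofReal (Real.sqrt a)⁻¹ * ∫⁻ x, Ψ (x ^ 2 + (Real.sqrt b * y) ^ 2 + c) := by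
    intro y
    rw [← lintegral_comp_mul_left_real (Real.sqrt_pos.2 ha)
      (f := fun x => Ψ (x ^ 2 + (Real.sqrt b * y) ^ 2 + c)) (by fun_prop)]
    simp only [mul_pow, Real.sq_sqrt ha.le, Real.sq_sqrt hb.le]
  have hm : Measurable fun y : ℝ => ∫⁻ x, Ψ (x ^ 2 + y ^ 2 + c) :=
    Measurable.lintegral_prod_right' (f := fun p : ℝ × ℝ => Ψ (p.2 ^ 2 + p.1 ^ 2 + c))
      (by fun_prop)
  simp only [h1]
  rw [lintegral_const_mul' _ _ ENNReal.ofReal_ne_top,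
    lintegral_comp_mul_left_real (Real.sqrt_pos.2 hb) hm]
  have h2 := lintegral_sq_add_sq_le hΨ c
  rw [Measure.volume_eq_prod, lintegral_prod_symm' _ (by fun_prop)] at h2
  calc _ ≤ ENNReal.ofReal (Real.sqrt a)⁻¹ * (ENNReal.ofReal (Real.sqrt b)⁻¹ *
        (ENNReal.ofReal Real.pi * ∫⁻ v, Ψ v)) := by gcongr
    _ = _ := by
      rw [← mul_assoc, ← mul_assoc, ← ENNReal.ofReal_mul (by positivity),
        ← ENNReal.ofReal_mul (by positivity), Real.sqrt_mul ha.le]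
      congr 2
      field_simp

variable [NeZero d]

/-- The quadratic form `k_x |q|² + 2 q_x (k ⬝ q)`. -/
def quad (k q : Vec d) : ℝ := kx k * ‖q‖ ^ 2 + 2 * kx q * inner ℝ k q

/-- The resonance function `Ω(k/2 - q, k/2 + q, k)` as a function of `q`. -/
def res (k q : Vec d) : ℝ := quad k q - 3 / 4 * kx k * ‖k‖ ^ 2

theorem kx_add (k q : Vec d) : kx (k + q) = kx k + kx q := rfl

theorem kx_sub (k q : Vec d) : kx (k - q) = kx k - kx q := rfl

theorem kx_smul (a : ℝ) (k : Vec d) : kx (a • k) = a * kx k := rfl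

theorem abs_kx_le (k : Vec d) : |kx k| ≤ ‖k‖ := by
  simpa [kx] using PiLp.norm_apply_le k 0

/-- Centring at `k/2` removes the terms linear in `q`: what remains is even in `q`, and homogeneous
of degree two up to a constant. -/
theorem Om_eq_res (k q : Vec d) :
    Om ((1 / 2 : ℝ) • k - q) (k - ((1 / 2 : ℝ) • k - q)) k = res k q := by
  have h1 : k - ((1 / 2 : ℝ) • k - q) = (1 / 2 : ℝ) • k + q := by
    module
  have h2 : ‖(1 / 2 : ℝ) • k + q‖ ^ 2 = 1 / 4 * ‖k‖ ^ 2 + inner ℝ k q + ‖q‖ ^ 2 := by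
    rw [norm_add_sq_real, norm_smul, inner_smul_left]
    simp
    ring
  have h3 : ‖(1 / 2 : ℝ) • k - q‖ ^ 2 = 1 / 4 * ‖k‖ ^ 2 - inner ℝ k q + ‖q‖ ^ 2 := by
    rw [norm_sub_sq_real, norm_smul, inner_smul_left]
    simp
    ring
  rw [h1]
  unfold Om disp res quad
  rw [h2, h3, kx_add, kx_sub, kx_smul]
  ring

theorem res_neg (k q : Vec d) : res k (-q) = res k q := by
  simp [res, quad, kx_neg]

theorem res_neg_left (k q : Vec d) : res (-k) q = -res k q := by
  simp [res, quad, kx_neg]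
  ring

theorem quad_smul (k q : Vec d) (a : ℝ) : quad k (a • q) = a ^ 2 * quad k q := by
  simp only [quad, norm_smul, kx_smul, inner_smul_right, mul_pow, Real.norm_eq_abs, sq_abs]
  ring

@[fun_prop]
theorem continuous_quad (k : Vec d) : Continuous (quad k) := by
  unfold quad kx
  fun_prop

@[fun_prop]
theorem continuous_res (k : Vec d) : Continuous (res k) := by
  unfold res
  fun_prop

/-- The first unit vector. -/
def ex : Vec d := EuclideanSpace.single 0 1

theorem inner_ex (q : Vec d) : inner ℝ (ex : Vec d) q = kx q := by
  simp [ex, kx, EuclideanSpace.inner_single_left]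

/-- The direction `|k| e_x + k` bisects `e_x` and `k` and is an eigenvector of the form with
eigenvalue `2k_x + |k|`; any direction orthogonal to both has eigenvalue `k_x`. For `k_x > 0` these
are two positive directions that decouple from the rest. -/
theorem quad_add_of_orthogonal {k v₂ w : Vec d} {x y : ℝ}
    (hv₂ : ‖v₂‖ = 1) (he : kx v₂ = 0) (hk : inner ℝ k v₂ = 0)
    {c : ℝ} (hc : ‖c • (‖k‖ • ex + k)‖ = 1)
    (h1 : inner ℝ (c • (‖k‖ • ex + k)) w = 0) (h2 : inner ℝ v₂ w = 0) :
    quad k (x • (c • (‖k‖ • ex + k)) + y • v₂ + w) =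
      (2 * kx k + ‖k‖) * x ^ 2 + kx k * y ^ 2 + quad k w := by
  set v₁ : Vec d := c • (‖k‖ • ex + k) with hv₁
  have hc0 : c ≠ 0 := by
    rintro rfl
    simp [hv₁] at hc
  have e12 : inner ℝ v₁ v₂ = 0 := by
    rw [hv₁, inner_smul_left, inner_add_left, inner_smul_left, inner_ex, he, hk]
    simp
  have ekv : inner ℝ k v₁ = ‖k‖ * kx v₁ := by
    rw [hv₁, inner_smul_right, inner_add_right, inner_smul_right, kx_smul, kx_add, kx_smul,
      real_inner_comm, inner_ex, real_inner_self_eq_norm_sq]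
    have : kx (ex : Vec d) = 1 := by simp [kx, ex]
    rw [this]
    ring
  have ekw : inner ℝ k w = -(‖k‖ * kx w) := by
    rw [hv₁, inner_smul_left, inner_add_left, inner_smul_left, inner_ex] at h1
    have h3 := (mul_eq_zero.1 h1).resolve_left (by simpa using hc0)
    simp at h3
    linarith
  have e11 : 2 * kx v₁ * inner ℝ k v₁ = kx k + ‖k‖ := by
    have h4 : inner ℝ v₁ v₁ = (1 : ℝ) := by rw [real_inner_self_eq_norm_sq, hc]; norm_num
    have h5 : inner ℝ v₁ v₁ = c * (‖k‖ * kx v₁ + ‖k‖ * kx v₁) := by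
      conv_lhs => rw [hv₁, inner_smul_left, inner_add_left, inner_smul_left, inner_ex]
      rw [← hv₁, ekv]
      simp
    have h6 : kx v₁ = c * (‖k‖ + kx k) := by
      have : kx (ex : Vec d) = 1 := by simp [kx, ex]
      rw [hv₁, kx_smul, kx_add, kx_smul, this]
      ring
    rw [ekv]
    rw [h4] at h5
    calc 2 * kx v₁ * (‖k‖ * kx v₁) = (c * (‖k‖ * kx v₁ + ‖k‖ * kx v₁)) * (‖k‖ + kx k) := by
          conv_lhs => rw [h6]
          rw [h6]
          ring
      _ = kx k + ‖k‖ := by rw [← h5]; ring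
  have en : ‖x • v₁ + y • v₂ + w‖ ^ 2 = x ^ 2 + y ^ 2 + ‖w‖ ^ 2 := by
    rw [norm_add_sq_real, norm_add_sq_real, inner_add_left]
    simp only [inner_smul_left, inner_smul_right, norm_smul, e12, h1, h2, hc, hv₂]
    simp
  unfold quad
  rw [en]
  simp only [kx_add, kx_smul, inner_add_right, inner_smul_right, he, hk, ekw]
  rw [ekv] at e11 ⊢
  linear_combination x ^ 2 * e11

end ZK

end

/-! ### Bounded density of the resonance function. -/

noncomputable section

namespace ZK

variable {d : ℕ}


theorem lintegral_fin_cons {n : ℕ} {f : (Fin (n + 1) → ℝ) → ENNReal} (hf : Measurable f) :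
    ∫⁻ z, f z = ∫⁻ z' : Fin n → ℝ, ∫⁻ x : ℝ, f (Fin.cons x z') := by
  have h := (volume_preserving_piFinSuccAbove (fun _ : Fin (n + 1) => ℝ) 0).symm
  rw [← h.lintegral_comp hf]
  have hm : Measurable fun p : ℝ × (Fin n → ℝ) =>
      f ((MeasurableEquiv.piFinSuccAbove (fun _ => ℝ) 0).symm p) :=
    hf.comp (MeasurableEquiv.measurable _)
  refine (lintegral_prod_symm' (μ := (volume : Measure ℝ)) (ν := (volume : Measure (Fin n → ℝ)))
    _ hm).trans ?_
  simp [MeasurableEquiv.piFinSuccAbove, Fin.insertNthEquiv]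

theorem exists_norm_eq_one_inner_eq_zero (hd : 3 ≤ d) (e k : Vec d) :
    ∃ v : Vec d, ‖v‖ = 1 ∧ inner ℝ e v = 0 ∧ inner ℝ k v = 0 := by
  classical
  have h : (Submodule.span ℝ (({e, k} : Finset (Vec d)) : Set (Vec d)))ᗮ ≠ ⊥ := by
    intro h
    rw [Submodule.orthogonal_eq_bot_iff] at h
    have h1 := finrank_span_finset_le_card (R := ℝ) ({e, k} : Finset (Vec d))
    rw [Set.finrank, h, finrank_top, finrank_euclideanSpace_fin] at h1
    have := Finset.card_le_two (a := e) (b := k)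
    omega
  obtain ⟨v, hv, hv0⟩ := Submodule.exists_mem_ne_zero_of_ne_bot h
  rw [Submodule.mem_orthogonal] at hv
  refine ⟨‖v‖⁻¹ • v, ?_, ?_, ?_⟩
  · rw [norm_smul, norm_inv, norm_norm, inv_mul_cancel₀ (norm_ne_zero_iff.2 hv0)]
  · rw [inner_smul_right, hv e (Submodule.subset_span (by simp)), mul_zero]
  · rw [inner_smul_right, hv k (Submodule.subset_span (by simp)), mul_zero]

variable [NeZero d]

/-- Complete the two eigenvectors to an orthonormal basis. In their plane the density is at most
`π/√((2k_x+|k|)k_x)`, whatever the other coordinates; these lie in a cube of side `2R`. -/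
theorem lintegral_closedBall_comp_res_le_of_pos (hd : 3 ≤ d) {k : Vec d} (hk : 0 < kx k) {R : ℝ}
    (hR : 0 ≤ R) {Ψ : ℝ → ENNReal} (hΨ : Measurable Ψ) :
    ∫⁻ q in Metric.closedBall (0 : Vec d) R, Ψ (res k q) ≤
      ENNReal.ofReal (Real.pi * (2 * R) ^ (d - 2) / Real.sqrt (kx k * ‖k‖)) * ∫⁻ v, Ψ v := by
  obtain ⟨n, rfl⟩ : ∃ n, d = n + 2 := ⟨d - 2, by omega⟩
  obtain ⟨v₂, hv₂, he, hkv⟩ := exists_norm_eq_one_inner_eq_zero hd (ex : Vec (n + 2)) k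
  have hkn : 0 < ‖k‖ := hk.trans_le ((le_abs_self _).trans (abs_kx_le k))
  have hu : ‖k‖ • (ex : Vec (n + 2)) + k ≠ 0 := by
    intro h
    have h1 := congrArg kx h
    rw [kx_add, kx_smul] at h1
    have h2 : kx (ex : Vec (n + 2)) = 1 := by simp [kx, ex]
    have h3 : kx (0 : Vec (n + 2)) = 0 := rfl
    rw [h2, h3] at h1
    linarith
  set c : ℝ := ‖‖k‖ • (ex : Vec (n + 2)) + k‖⁻¹ with hcdef
  set v₁ : Vec (n + 2) := c • (‖k‖ • ex + k) with hv₁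
  have hc : ‖v₁‖ = 1 := by
    rw [hv₁, norm_smul, hcdef, norm_inv, norm_norm, inv_mul_cancel₀ (norm_ne_zero_iff.2 hu)]
  have h12 : inner ℝ v₁ v₂ = 0 := by
    rw [hv₁, inner_smul_left, inner_add_left, inner_smul_left, he, hkv]
    simp
  have h21 : inner ℝ v₂ v₁ = 0 := by rw [real_inner_comm, h12]
  obtain ⟨b, hb⟩ : ∃ b : OrthonormalBasis (Fin (n + 2)) ℝ (Vec (n + 2)), b 0 = v₁ ∧ b 1 = v₂ := by
    have horth : Orthonormal ℝ (({0, 1} : Set (Fin (n + 2))).domRestrict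
        (fun i => if i = 0 then v₁ else v₂)) := by
      constructor
      · rintro ⟨i, hi⟩
        rcases hi with rfl | rfl
        · simpa using hc
        · simpa using hv₂
      · rintro ⟨i, hi⟩ ⟨j, hj⟩ hij
        rcases hi with rfl | rfl <;> rcases hj with rfl | rfl
        · exact absurd rfl hij
        · simpa using h12
        · simpa using h21
        · exact absurd rfl hij
    obtain ⟨b, hb⟩ := horth.exists_orthonormalBasis_extension_of_card_eq (by simp)
    exact ⟨b, by simpa using hb 0 (by simp), by simpa using hb 1 (by simp)⟩
  obtain ⟨hb0, hb1⟩ := hb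
  set w : (Fin n → ℝ) → Vec (n + 2) := fun z => ∑ i : Fin n, z i • b i.succ.succ with hw
  have hwm : Measurable w := by
    apply Continuous.measurable
    fun_prop
  have hexp : ∀ (x y : ℝ) (z : Fin n → ℝ),
      b.repr.symm (WithLp.toLp 2 (Fin.cons x (Fin.cons y z : Fin (n + 1) → ℝ) : Fin (n + 2) → ℝ)) =
        x • v₁ + y • v₂ + w z := by
    intro x y z
    rw [← OrthonormalBasis.sum_repr_symm]
    simp only [Fin.sum_univ_succ, Fin.cons_zero, Fin.cons_succ, hw, Fin.succ_zero_eq_one, hb0, hb1]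
    exact (add_assoc _ _ _).symm
  have hbw : ∀ i : Fin (n + 2), (i = 0 ∨ i = 1) → ∀ z, inner ℝ (b i) (w z) = 0 := by
    intro i hi z
    rw [hw, inner_sum]
    refine Finset.sum_eq_zero fun j _ => ?_
    rw [inner_smul_right, b.orthonormal.2, mul_zero]
    intro h
    rcases hi with rfl | rfl
    · exact absurd h.symm (Fin.succ_ne_zero _)
    · rw [← Fin.succ_zero_eq_one] at h
      exact absurd (Fin.succ_injective _ h).symm (Fin.succ_ne_zero _)
  set f : Vec (n + 2) → ENNReal := (Metric.closedBall (0 : Vec (n + 2)) R).indicator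
    (fun q => Ψ (res k q)) with hf
  have hfm : Measurable f := by
    refine Measurable.indicator ?_ measurableSet_closedBall
    exact hΨ.comp (continuous_res k).measurable
  set g : (Fin n → ℝ) → ENNReal := (Set.Icc (fun _ => -R) (fun _ => R)).indicator 1 with hg
  have hle : ∀ (x y : ℝ) (z : Fin n → ℝ), f (b.repr.symm (WithLp.toLp 2
      (Fin.cons x (Fin.cons y z : Fin (n + 1) → ℝ) : Fin (n + 2) → ℝ))) ≤
      g z * Ψ ((2 * kx k + ‖k‖) * x ^ 2 + kx k * y ^ 2 +
        (quad k (w z) - 3 / 4 * kx k * ‖k‖ ^ 2)) := by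
    intro x y z
    rw [hf]
    by_cases hq : b.repr.symm (WithLp.toLp 2
      (Fin.cons x (Fin.cons y z : Fin (n + 1) → ℝ) : Fin (n + 2) → ℝ)) ∈
        Metric.closedBall (0 : Vec (n + 2)) R
    · rw [Set.indicator_of_mem hq]
      have hz : z ∈ Set.Icc (fun _ => -R) (fun _ => R) := by
        rw [mem_closedBall_zero_iff, LinearIsometryEquiv.norm_map] at hq
        have : ∀ i, |z i| ≤ R := fun i => by
          refine le_trans ?_ hq
          simpa using PiLp.norm_apply_le (WithLp.toLp 2
            (Fin.cons x (Fin.cons y z : Fin (n + 1) → ℝ) : Fin (n + 2) → ℝ)) i.succ.succ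
        exact ⟨fun i => (abs_le.1 (this i)).1, fun i => (abs_le.1 (this i)).2⟩
      rw [hg, Set.indicator_of_mem hz, Pi.one_apply, one_mul, hexp, res,
        quad_add_of_orthogonal hv₂ (by rw [← inner_ex]; exact he) hkv hc
          (by rw [← hv₁, ← hb0]; exact hbw 0 (Or.inl rfl) z)
          (by rw [← hb1]; exact hbw 1 (Or.inr rfl) z)]
      refine le_of_eq (congrArg _ ?_)
      ring
    · rw [Set.indicator_of_notMem hq]
      exact zero_le
  have hmp := b.measurePreserving_repr_symm.comp (PiLp.volume_preserving_toLp (Fin (n + 2)))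
  have hgm : Measurable g := measurable_one.indicator measurableSet_Icc
  have hmeas1 : Measurable fun z : Fin (n + 2) → ℝ => f (b.repr.symm (WithLp.toLp 2 z)) :=
    hfm.comp hmp.measurable
  have hmeas2 : Measurable fun z : Fin (n + 1) → ℝ =>
      ∫⁻ x : ℝ, f (b.repr.symm (WithLp.toLp 2 (Fin.cons x z : Fin (n + 2) → ℝ))) := by
    refine Measurable.lintegral_prod_right' (f := fun p : (Fin (n + 1) → ℝ) × ℝ =>
      f (b.repr.symm (WithLp.toLp 2 (Fin.cons p.2 p.1 : Fin (n + 2) → ℝ)))) ?_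
    refine hmeas1.comp (Continuous.measurable ?_)
    fun_prop
  rw [← lintegral_indicator measurableSet_closedBall, ← hf, ← hmp.lintegral_comp hfm]
  simp only [Function.comp_def]
  rw [lintegral_fin_cons hmeas1, lintegral_fin_cons hmeas2]
  calc _ ≤ ∫⁻ z : Fin n → ℝ, ∫⁻ y : ℝ, ∫⁻ x : ℝ, g z *
        Ψ ((2 * kx k + ‖k‖) * x ^ 2 + kx k * y ^ 2 +
        (quad k (w z) - 3 / 4 * kx k * ‖k‖ ^ 2)) := by
        gcongr with z y x
        exact hle x y z
    _ ≤ ∫⁻ z : Fin n → ℝ, g z * (ENNReal.ofReal (Real.pi / Real.sqrt ((2 * kx k + ‖k‖) * kx k)) *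
          ∫⁻ v, Ψ v) := by
        gcongr with z
        have hgz : g z ≠ ⊤ := by
          by_cases h : z ∈ Set.Icc (fun _ => -R) (fun _ => R) <;> simp [hg, h]
        simp only [lintegral_const_mul' _ _ hgz]
        gcongr
        exact lintegral_quadratic_two_le hΨ (by positivity) hk _
    _ = ENNReal.ofReal ((2 * R) ^ n) *
          (ENNReal.ofReal (Real.pi / Real.sqrt ((2 * kx k + ‖k‖) * kx k)) * ∫⁻ v, Ψ v) := by
        rw [lintegral_mul_const _ hgm, hg, lintegral_indicator_one measurableSet_Icc,
          Real.volume_Icc_pi]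
        congr 1
        simp only [sub_neg_eq_add, ← two_mul, Finset.prod_const, Finset.card_univ,
          Fintype.card_fin]
        rw [ENNReal.ofReal_pow (by positivity)]
    _ ≤ _ := by
        rw [← mul_assoc, ← ENNReal.ofReal_mul (by positivity)]
        gcongr
        simp only [Nat.add_sub_cancel]
        rw [← mul_div_assoc, mul_comm ((2 * R) ^ n)]
        gcongr Real.pi * (2 * R) ^ n / Real.sqrt ?_
        rw [mul_comm]
        gcongr
        linarith

/-- The pushforward of Lebesgue measure on a ball under the resonance function has bounded
density. -/
theorem lintegral_closedBall_comp_res_le (hd : 3 ≤ d) {k : Vec d} (hk : kx k ≠ 0) {R : ℝ}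
    (hR : 0 ≤ R) {Ψ : ℝ → ENNReal} (hΨ : Measurable Ψ) :
    ∫⁻ q in Metric.closedBall (0 : Vec d) R, Ψ (res k q) ≤
      ENNReal.ofReal (Real.pi * (2 * R) ^ (d - 2) / Real.sqrt (|kx k| * ‖k‖)) * ∫⁻ v, Ψ v := by
  rcases hk.lt_or_gt with h | h
  · have h1 := lintegral_closedBall_comp_res_le_of_pos hd (k := -k) (by rw [kx_neg]; linarith) hR
      (hΨ.comp measurable_neg)
    have h2 : ∫⁻ v, (Ψ ∘ Neg.neg) v = ∫⁻ v, Ψ v := lintegral_neg_eq_self Ψ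
    rw [h2, kx_neg, norm_neg] at h1
    simpa only [Function.comp_apply, res_neg_left, neg_neg, abs_of_neg h] using h1
  · rw [abs_of_pos h]
    exact lintegral_closedBall_comp_res_le_of_pos hd h hR hΨ

end ZK

end

noncomputable section

namespace ZK

variable {d : ℕ}


/-! ### The Fejér kernel against the normalised indicator function -/

/-- The Fejér kernel minus the multiple of a normalised indicator function of the same mass. -/
def fejerDefect (h r v : ℝ) : ℝ :=
  fejer r v - Real.pi * r * (Set.Icc (-h) h).indicator (fun _ => (2 * h)⁻¹) v

theorem fejerDefect_neg (h r v : ℝ) : fejerDefect h r (-v) = fejerDefect h r v := by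
  have h1 : fejer r (-v) = fejer r v := by
    simp only [fejer, mul_neg, neg_div, Real.sinc_neg]
  have h2 : (Set.Icc (-h) h).indicator (fun _ => (2 * h)⁻¹) (-v) =
      (Set.Icc (-h) h).indicator (fun _ => (2 * h)⁻¹) v := by
    simp only [Set.indicator_apply, Set.mem_Icc]
    congr 1
    exact propext ⟨fun h => ⟨by linarith, by linarith⟩, fun h => ⟨by linarith, by linarith⟩⟩
  rw [fejerDefect, h1, h2, fejerDefect]

@[fun_prop]
theorem measurable_indicator_Icc (h : ℝ) :
    Measurable ((Set.Icc (-h) h).indicator (fun _ : ℝ => (2 * h)⁻¹)) :=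
  measurable_const.indicator measurableSet_Icc

theorem measurable_fejerDefect (h : ℝ) : Measurable fun p : ℝ × ℝ => fejerDefect h p.1 p.2 := by
  unfold fejerDefect
  fun_prop

theorem integrable_indicator_Icc (h : ℝ) :
    Integrable ((Set.Icc (-h) h).indicator (fun _ : ℝ => (2 * h)⁻¹)) :=
  (integrableOn_const (by simp)).integrable_indicator measurableSet_Icc

theorem integral_indicator_Icc {h : ℝ} (hh : 0 < h) :
    ∫ v, (Set.Icc (-h) h).indicator (fun _ : ℝ => (2 * h)⁻¹) v = 1 := by
  rw [integral_indicator_const _ measurableSet_Icc, Real.volume_real_Icc_of_le (by linarith)]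
  simp only [smul_eq_mul]
  field_simp
  ring

theorem indicator_Icc_nonneg {h : ℝ} (hh : 0 < h) (v : ℝ) :
    0 ≤ (Set.Icc (-h) h).indicator (fun _ : ℝ => (2 * h)⁻¹) v :=
  Set.indicator_nonneg (fun _ _ => by positivity) v

theorem integrable_fejerDefect (h r : ℝ) : Integrable (fejerDefect h r) :=
  (integrable_fejer r).sub ((integrable_indicator_Icc h).const_mul _)

theorem integral_fejerDefect {h r : ℝ} (hh : 0 < h) (hr : 0 ≤ r) : ∫ v, fejerDefect h r v = 0 := by
  unfold fejerDefect
  rw [integral_sub (integrable_fejer r) ((integrable_indicator_Icc h).const_mul _),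
    integral_const_mul, integral_indicator_Icc hh, integral_fejer hr]
  ring

theorem abs_fejerDefect_le {h r : ℝ} (hh : 0 < h) (hr : 0 ≤ r) (v : ℝ) :
    |fejerDefect h r v| ≤
      fejer r v + Real.pi * r * (Set.Icc (-h) h).indicator (fun _ => (2 * h)⁻¹) v := by
  have h1 := fejer_nonneg r v
  have h2 := mul_nonneg (mul_nonneg Real.pi_pos.le hr) (indicator_Icc_nonneg hh v)
  unfold fejerDefect
  rw [abs_le]
  constructor <;> linarith

theorem abs_fejerDefect_le_const {h r : ℝ} (hh : 0 < h) (hr : 0 ≤ r) (v : ℝ) :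
    |fejerDefect h r v| ≤ r ^ 2 / 2 + Real.pi * r * (2 * h)⁻¹ := by
  refine (abs_fejerDefect_le hh hr v).trans ?_
  have h1 : (Set.Icc (-h) h).indicator (fun _ => (2 * h)⁻¹) v ≤ (2 * h)⁻¹ :=
    Set.indicator_le_self' (fun _ _ => by positivity) v
  have := fejer_le r v
  have := Real.pi_pos
  gcongr

theorem abs_fejerDefect_of_lt {h r m v : ℝ} (hm : 0 < m) (hhm : h ≤ m) (hv : m < |v|) :
    |fejerDefect h r v| ≤ 2 / m ^ 2 := by
  have h1 : v ∉ Set.Icc (-h) h := fun hv' => by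
    have := abs_le.2 ⟨hv'.1, hv'.2⟩
    linarith
  rw [fejerDefect, Set.indicator_of_notMem h1, mul_zero, sub_zero, abs_of_nonneg (fejer_nonneg _ _),
    le_div_iff₀ (by positivity)]
  have h2 : m ^ 2 ≤ v ^ 2 := by
    rw [← sq_abs v]
    gcongr
  have := sq_mul_fejer_le r v
  have := mul_le_mul_of_nonneg_right h2 (fejer_nonneg r v)
  linarith

/-- The zero mass allows subtracting `G 0`. The Lipschitz bound is used on `[-δ,δ]` and the tail
bound of the Fejér kernel beyond; `h` drops out as long as `h ≤ δ`. -/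
theorem abs_integral_mul_fejerDefect_le {G : ℝ → ℝ} (hG : Measurable G) {B Λ h r δ : ℝ}
    (hB : ∀ v, |G v| ≤ B) (hΛ : ∀ v, |G v - G 0| ≤ Λ * |v|) (hh : 0 < h) (hhδ : h ≤ δ)
    (hr : 0 ≤ r) : |∫ v, G v * fejerDefect h r v| ≤ 2 * Real.pi * r * Λ * δ + 8 * B / δ := by
  have hδ : 0 < δ := hh.trans_le hhδ
  have hB0 : 0 ≤ B := (abs_nonneg _).trans (hB 0)
  have hΛ0 : 0 ≤ Λ := by simpa using (abs_nonneg _).trans (hΛ 1)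
  have hi : Integrable fun v => G v * fejerDefect h r v :=
    (integrable_fejerDefect h r).bdd_mul hG.aestronglyMeasurable (c := B)
      (Eventually.of_forall hB)
  have h0 : ∫ v, G v * fejerDefect h r v = ∫ v, (G v - G 0) * fejerDefect h r v := by
    simp only [sub_mul]
    rw [integral_sub hi ((integrable_fejerDefect h r).const_mul _), integral_const_mul,
      integral_fejerDefect hh hr]
    simp
  have hIcc : Integrable ((Set.Icc (-δ) δ).indicator (fejer r)) :=
    (integrable_fejer r).indicator measurableSet_Icc
  have hi1 : Integrable fun v => Λ * δ * (fejer r v +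
      Real.pi * r * (Set.Icc (-h) h).indicator (fun _ => (2 * h)⁻¹) v) :=
    ((integrable_fejer r).add ((integrable_indicator_Icc h).const_mul _)).const_mul _
  have hi2 : Integrable fun v => 2 * B * (fejer r v - (Set.Icc (-δ) δ).indicator (fejer r) v) :=
    ((integrable_fejer r).sub hIcc).const_mul _
  rw [h0, ← Real.norm_eq_abs]
  refine (norm_integral_le_of_norm_le (hi1.add hi2) (Eventually.of_forall fun v => ?_)).trans ?_
  · rw [norm_mul, Real.norm_eq_abs, Real.norm_eq_abs, Pi.add_apply]
    have hf := fejer_nonneg r v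
    by_cases hv : v ∈ Set.Icc (-δ) δ
    · rw [Set.indicator_of_mem hv, sub_self, mul_zero, add_zero]
      refine mul_le_mul ((hΛ v).trans ?_) (abs_fejerDefect_le hh hr v) (abs_nonneg _) (by positivity)
      exact mul_le_mul_of_nonneg_left (abs_le.2 ⟨hv.1, hv.2⟩) hΛ0
    · have hv' : v ∉ Set.Icc (-h) h := fun hv' => hv ⟨by linarith [hv'.1], by linarith [hv'.2]⟩
      simp only [fejerDefect, Set.indicator_of_notMem hv, Set.indicator_of_notMem hv', mul_zero,
        sub_zero, add_zero, abs_of_nonneg hf]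
      have : |G v - G 0| ≤ 2 * B := (abs_sub _ _).trans (by linarith [hB v, hB 0])
      have h2 := mul_le_mul_of_nonneg_right this hf
      have h3 : 0 ≤ Λ * δ * fejer r v := by positivity
      linarith
  · have ht := abs_setIntegral_fejer_sub_le hr hδ
    rw [integral_add' hi1 hi2, integral_const_mul, integral_const_mul,
      integral_add (integrable_fejer r) ((integrable_indicator_Icc h).const_mul _),
      integral_const_mul, integral_indicator_Icc hh,
      integral_sub (integrable_fejer r) hIcc, integral_indicator measurableSet_Icc,
      integral_fejer hr]
    have h4 := mul_le_mul_of_nonneg_left (abs_sub_le_iff.1 ht).2 (by positivity : 0 ≤ 2 * B)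
    have : 2 * B * (4 / δ) = 8 * B / δ := by ring
    linarith

/-! ### Averaging over dilations -/

/-- A tent function on `[1, 2]`. -/
def tent (s : ℝ) : ℝ := max 0 (1 / 2 - |s - 3 / 2|)

@[fun_prop]
theorem continuous_tent : Continuous tent := by unfold tent; fun_prop

theorem tent_nonneg (s : ℝ) : 0 ≤ tent s := le_max_left _ _

theorem tent_le (s : ℝ) : tent s ≤ 1 :=
  max_le zero_le_one (by linarith [abs_nonneg (s - 3 / 2)])

theorem tent_eq_zero {s : ℝ} (hs : s ∉ Set.Icc (1 : ℝ) 2) : tent s = 0 := by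
  refine max_eq_left ?_
  by_contra! h
  have := abs_lt.1 (show |s - 3 / 2| < 1 / 2 by linarith)
  exact hs ⟨by linarith, by linarith⟩

theorem abs_tent_sub_le (s s' : ℝ) : |tent s - tent s'| ≤ |s - s'| := by
  have h1 := abs_max_sub_max_le_max 0 (1 / 2 - |s - 3 / 2|) 0 (1 / 2 - |s' - 3 / 2|)
  rw [sub_self, abs_zero, max_eq_right (abs_nonneg (1 / 2 - |s - 3 / 2| - (1 / 2 - |s' - 3 / 2|))),
    sub_sub_sub_cancel_left] at h1
  have h2 := abs_abs_sub_abs_le (s' - 3 / 2) (s - 3 / 2)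
  rw [sub_sub_sub_cancel_right, abs_sub_comm s' s] at h2
  exact h1.trans h2

/-- The dilation factor `√s`, regularised for `s < 1`. -/
def dil (s : ℝ) : ℝ := Real.sqrt (max 1 s)

@[fun_prop]
theorem continuous_dil : Continuous dil := by unfold dil; fun_prop

theorem one_le_dil (s : ℝ) : 1 ≤ dil s := Real.one_le_sqrt.2 (le_max_left _ _)

theorem dil_sq {s : ℝ} (hs : 1 ≤ s) : dil s ^ 2 = s := by
  rw [dil, Real.sq_sqrt (by positivity), max_eq_right hs]

theorem abs_dil_sub_le (s s' : ℝ) : |dil s - dil s'| ≤ |s - s'| := by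
  have h1 : |dil s ^ 2 - dil s' ^ 2| ≤ |s - s'| := by
    unfold dil
    rw [Real.sq_sqrt (by positivity), Real.sq_sqrt (by positivity)]
    refine (abs_max_sub_max_le_max _ _ _ _).trans ?_
    simp
  have h2 := one_le_dil s
  have h3 := one_le_dil s'
  rw [sq_sub_sq, abs_mul, abs_of_pos (by linarith : 0 < dil s + dil s')] at h1
  nlinarith [abs_nonneg (dil s - dil s')]

/-- The mass of the average over dilations. -/
def tentMass (d : ℕ) : ℝ := ∫ s in Set.Icc (1 : ℝ) 2, tent s * (dil s ^ d)⁻¹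

theorem tentMass_pos (d : ℕ) : 0 < tentMass d := by
  have hc : Continuous fun s => tent s * (dil s ^ d)⁻¹ := by
    have : ∀ s, dil s ^ d ≠ 0 := fun s => pow_ne_zero _ (by linarith [one_le_dil s])
    fun_prop (disch := exact this)
  unfold tentMass
  rw [integral_Icc_eq_integral_Ioc, ← intervalIntegral.integral_of_le one_le_two]
  refine intervalIntegral.intervalIntegral_pos_of_pos_on (hc.intervalIntegrable _ _)
    (fun s hs => ?_) one_lt_two
  have h1 : 0 < tent s := by
    refine lt_max_of_lt_right ?_
    have : |s - 3 / 2| < 1 / 2 := abs_lt.2 ⟨by linarith [hs.1], by linarith [hs.2]⟩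
    linarith
  have := one_le_dil s
  positivity

/-- At fixed `q` the argument `sQ - m` is affine in `s`, so the average over `s` is a
one-dimensional integral against the defect. The tent makes the test function Lipschitz on the whole
line. -/
theorem abs_integral_tent_mul_fejerDefect_le {F : Vec d → ℝ} (hF : Continuous F) {M R : ℝ}
    (hM : ∀ q, |F q| ≤ M) (hL : ∀ q q', |F q - F q'| ≤ M * ‖q - q'‖) {h r δ m Q : ℝ} (hh : 0 < h) (hhδ : h ≤ δ)
    (hδ : δ ≤ m / 2) (hr : 0 ≤ r) (q : Vec d) (hq : ‖q‖ ≤ R) :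
    |∫ s in Set.Icc (1 : ℝ) 2, tent s * F (dil s • q) * fejerDefect h r (s * Q - m)| ≤
      32 * M * (1 + R) * (Real.pi * r * δ / m ^ 2 + 1 / (δ * m) + 1 / m ^ 2) := by
  have hδ0 : 0 < δ := hh.trans_le hhδ
  have hm : 0 < m := by linarith
  have hM0 : 0 ≤ M := (abs_nonneg _).trans (hM 0)
  have hR0 : 0 ≤ R := (norm_nonneg q).trans hq
  have hpi := Real.pi_pos
  set g : ℝ → ℝ := fun s => tent s * F (dil s • q) with hg
  have hgc : Continuous g := by fun_prop
  have hgM : ∀ s, |g s| ≤ M := fun s => by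
    rw [hg, abs_mul, abs_of_nonneg (tent_nonneg s)]
    have := mul_le_mul (tent_le s) (hM (dil s • q)) (abs_nonneg _) zero_le_one
    linarith
  have hgL : ∀ s s', |g s - g s'| ≤ M * (1 + R) * |s - s'| := fun s s' => by
    have h1 : g s - g s' = (tent s - tent s') * F (dil s • q) +
        tent s' * (F (dil s • q) - F (dil s' • q)) := by simp only [hg]; ring
    have h2 : |F (dil s • q) - F (dil s' • q)| ≤ M * (|s - s'| * R) := by
      refine (hL _ _).trans (mul_le_mul_of_nonneg_left ?_ hM0)
      rw [← sub_smul, norm_smul]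
      exact mul_le_mul (abs_dil_sub_le s s') hq (norm_nonneg _) (abs_nonneg _)
    rw [h1]
    refine (abs_add_le _ _).trans ?_
    rw [abs_mul, abs_mul, abs_of_nonneg (tent_nonneg s')]
    have h3 := mul_le_mul (abs_tent_sub_le s s') (hM (dil s • q)) (abs_nonneg _) (abs_nonneg _)
    have h4 := mul_le_mul (tent_le s') h2 (abs_nonneg _) zero_le_one
    linarith
  -- If `Q ≥ m/4` the slope permits the substitution `v = sQ - m`. Otherwise `sQ < m/2` for all `s ≤
  -- 2`, so the argument stays away from zero and the defect is `O(1/m²)`.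
  rcases le_or_gt (m / 4) Q with hQ | hQ
  · have hQ0 : 0 < Q := by linarith
    have h1 : ∫ s in Set.Icc (1 : ℝ) 2, g s * fejerDefect h r (s * Q - m) =
        Q⁻¹ * ∫ v, g ((v + m) / Q) * fejerDefect h r v := by
      rw [setIntegral_eq_integral_of_forall_compl_eq_zero
        (fun s hs => by simp [hg, tent_eq_zero hs])]
      rw [← integral_sub_right_eq_self (fun v => g ((v + m) / Q) * fejerDefect h r v) m]
      have := Measure.integral_comp_mul_right
        (fun v => g ((v - m + m) / Q) * fejerDefect h r (v - m)) Q
      rw [abs_of_pos (inv_pos.2 hQ0), smul_eq_mul] at this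
      rw [← this]
      congr 1
      ext s
      rw [sub_add_cancel, mul_div_cancel_right₀ _ hQ0.ne']
    have h2 := abs_integral_mul_fejerDefect_le (G := fun v => g ((v + m) / Q))
      (Continuous.measurable (by fun_prop)) (B := M) (Λ := M * (1 + R) * Q⁻¹) (fun v => hgM _)
      (fun v => by
        refine (hgL _ _).trans (le_of_eq ?_)
        rw [← sub_div, add_sub_add_right_eq_sub, sub_zero, abs_div, abs_of_pos hQ0]
        ring) hh hhδ hr
    have hQi : Q⁻¹ ≤ 4 / m := by
      rw [← inv_div]
      exact inv_anti₀ (by positivity) hQ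
    rw [h1, abs_mul, abs_of_pos (inv_pos.2 hQ0)]
    calc _ ≤ (4 / m) * (2 * Real.pi * r * (M * (1 + R) * (4 / m)) * δ + 8 * M / δ) := by
          refine mul_le_mul hQi (h2.trans ?_) (abs_nonneg _) (by positivity)
          gcongr
      _ = 32 * M * (1 + R) * (Real.pi * r * δ / m ^ 2) + 32 * M * (1 / (δ * m)) := by
          field_simp
          ring
      _ ≤ _ := by
          have h3 : 32 * M * (1 / (δ * m)) ≤ 32 * M * (1 + R) * (1 / (δ * m)) := by
            refine mul_le_mul_of_nonneg_right ?_ (by positivity)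
            nlinarith
          have h4 : 0 ≤ 32 * M * (1 + R) * (1 / m ^ 2) := by positivity
          linarith
  · have h1 : ∀ s ∈ Set.Icc (1 : ℝ) 2, ‖g s * fejerDefect h r (s * Q - m)‖ ≤
        M * (2 / (m / 2) ^ 2) := by
      intro s hs
      rw [norm_mul]
      refine mul_le_mul (hgM s) (abs_fejerDefect_of_lt (by positivity) (hhδ.trans hδ) ?_)
        (norm_nonneg _) hM0
      have : s * Q < m / 2 := by
        rcases le_or_gt Q 0 with h0 | h0 <;> nlinarith [hs.1, hs.2]
      rw [lt_abs]
      right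
      linarith
    have h2 := norm_setIntegral_le_of_norm_le_const (μ := volume) (by simp) h1
    rw [Real.volume_real_Icc_of_le one_le_two] at h2
    refine h2.trans ?_
    have h3 : M * (2 / (m / 2) ^ 2) * (2 - 1) = 8 * M * (1 / m ^ 2) := by
      field_simp
      ring
    have h4 : 8 * M * (1 / m ^ 2) ≤ 32 * M * (1 + R) * (1 / m ^ 2) := by
      refine mul_le_mul_of_nonneg_right ?_ (by positivity)
      nlinarith
    have h5 : 0 ≤ 32 * M * (1 + R) * (Real.pi * r * δ / m ^ 2) := by positivity
    have h6 : 0 ≤ 32 * M * (1 + R) * (1 / (δ * m)) := by positivity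
    rw [h3]
    linarith

variable [NeZero d]

/-- The substitution `q ↦ √s q` has Jacobian `√s ^ d` and multiplies the form by `s`; averaging over
`s` against the tent gives the left side `tentMass d` times the original integral. -/
theorem tentMass_mul_integral {k : Vec d} {F : Vec d → ℝ} (hF : Measurable F) {M R : ℝ}
    (hM : ∀ q, |F q| ≤ M) (hR : ∀ q, R < ‖q‖ → F q = 0) {Ψ : ℝ → ℝ} (hΨ : Measurable Ψ) {A : ℝ}
    (hA : ∀ v, |Ψ v| ≤ A) :
    tentMass d * ∫ q, F q * Ψ (quad k q) =
      ∫ q, ∫ s in Set.Icc (1 : ℝ) 2, tent s * F (dil s • q) * Ψ (s * quad k q) := by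
  have hM0 : 0 ≤ M := (abs_nonneg _).trans (hM 0)
  rw [integral_integral_swap]
  · rw [tentMass, ← integral_mul_const]
    refine setIntegral_congr_fun measurableSet_Icc fun s hs => ?_
    have h1 : ∀ q : Vec d, tent s * F (dil s • q) * Ψ (s * quad k q) =
        tent s * (fun q => F q * Ψ (quad k q)) (dil s • q) := fun q => by
      simp only [quad_smul, dil_sq hs.1, mul_assoc]
    simp only [h1]
    rw [integral_const_mul, Measure.integral_comp_smul_of_nonneg volume
      (fun q => F q * Ψ (quad k q)) (dil s) (hR := by linarith [one_le_dil s]), finrank_euclideanSpace_fin, smul_eq_mul, mul_assoc]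
  · have hmeas : Measurable fun p : Vec d × ℝ =>
        tent p.2 * F (dil p.2 • p.1) * Ψ (p.2 * quad k p.1) := by
      refine Measurable.mul (Measurable.mul (by fun_prop) (hF.comp ?_)) (hΨ.comp ?_)
      · exact Continuous.measurable (by fun_prop)
      · refine Continuous.measurable ?_
        have := continuous_quad k
        fun_prop
    have hbd : Integrable (fun p : Vec d × ℝ =>
        (Metric.closedBall (0 : Vec d) R).indicator (fun _ => M * A) p.1 * 1)
        (volume.prod (volume.restrict (Set.Icc (1 : ℝ) 2))) :=
      Integrable.mul_prod (f := (Metric.closedBall (0 : Vec d) R).indicator (fun _ => M * A))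
        (g := fun _ : ℝ => (1 : ℝ))
        ((integrableOn_const measure_closedBall_lt_top.ne).integrable_indicator measurableSet_closedBall)
        (integrable_const _)
    refine hbd.mono' hmeas.aestronglyMeasurable (Eventually.of_forall fun p => ?_)
    simp only [Function.uncurry, mul_one]
    by_cases hp : p.1 ∈ Metric.closedBall (0 : Vec d) R
    · rw [Set.indicator_of_mem hp, norm_mul, norm_mul, Real.norm_of_nonneg (tent_nonneg _)]
      have h1 := mul_le_mul (tent_le p.2) (hM (dil p.2 • p.1)) (abs_nonneg _) zero_le_one
      rw [one_mul] at h1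
      exact mul_le_mul h1 (hA _) (abs_nonneg _) hM0
    · have h2 : R < ‖dil p.2 • p.1‖ := by
        rw [mem_closedBall_zero_iff, not_le] at hp
        rw [norm_smul, Real.norm_of_nonneg (by linarith [one_le_dil p.2])]
        nlinarith [one_le_dil p.2, norm_nonneg p.1]
      rw [Set.indicator_of_notMem hp, hR _ h2]
      simp

/-- The constant in `abs_integral_mul_fejerDefect_res_le`. -/
def defectConst (d : ℕ) (R : ℝ) : ℝ :=
  (tentMass d)⁻¹ * (32 * (1 + R) * volume.real (Metric.closedBall (0 : Vec d) R))

theorem defectConst_nonneg (d : ℕ) {R : ℝ} (hR : 0 ≤ R) : 0 ≤ defectConst d R := by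
  have := tentMass_pos d
  unfold defectConst
  positivity

/-- The average over dilations, integrated over the ball. The shift `m` must be nonzero, so that
dilations cross the resonant set transversally; the bound is uniform in `h ≤ δ`. -/
theorem abs_integral_mul_fejerDefect_res_le {k : Vec d} {F : Vec d → ℝ} (hF : Continuous F)
    {M R : ℝ} (hR0 : 0 ≤ R) (hM : ∀ q, |F q| ≤ M) (hR : ∀ q, R < ‖q‖ → F q = 0)
    (hL : ∀ q q', |F q - F q'| ≤ M * ‖q - q'‖) {h r δ m : ℝ} (hm : m = 3 / 4 * |kx k| * ‖k‖ ^ 2)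
    (hh : 0 < h) (hhδ : h ≤ δ) (hδ : δ ≤ m / 2) (hr : 0 ≤ r) :
    |∫ q, F q * fejerDefect h r (res k q)| ≤
      defectConst d R * M * (Real.pi * r * δ / m ^ 2 + 1 / (δ * m) + 1 / m ^ 2) := by
  wlog hk : 0 ≤ kx k generalizing k
  · have h1 := this (k := -k) (by rw [kx_neg, abs_neg, norm_neg]; exact hm)
      (by rw [kx_neg]; linarith)
    simpa only [res_neg_left, fejerDefect_neg] using h1
  have hM0 : 0 ≤ M := (abs_nonneg _).trans (hM 0)
  rw [abs_of_nonneg hk] at hm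
  have hE := tentMass_mul_integral (k := k) hF.measurable hM hR
    (Ψ := fun v => fejerDefect h r (v - m))
    ((measurable_fejerDefect h).comp (by fun_prop : Measurable fun v : ℝ => (r, v - m)))
    (fun v => abs_fejerDefect_le_const hh hr (v - m))
  have hb : |∫ q, ∫ s in Set.Icc (1 : ℝ) 2, tent s * F (dil s • q) *
      fejerDefect h r (s * quad k q - m)| ≤
      32 * M * (1 + R) * (Real.pi * r * δ / m ^ 2 + 1 / (δ * m) + 1 / m ^ 2) *
        volume.real (Metric.closedBall (0 : Vec d) R) := by
    rw [← setIntegral_eq_integral_of_forall_compl_eq_zero (s := Metric.closedBall (0 : Vec d) R)]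
    · rw [← Real.norm_eq_abs]
      refine norm_setIntegral_le_of_norm_le_const (s := Metric.closedBall (0 : Vec d) R)
        measure_closedBall_lt_top fun q hq => ?_
      exact abs_integral_tent_mul_fejerDefect_le hF hM hL hh hhδ hδ hr q
        (mem_closedBall_zero_iff.1 hq)
    · intro q hq
      have : ∀ s, F (dil s • q) = 0 := fun s => by
        refine hR _ ?_
        rw [mem_closedBall_zero_iff, not_le] at hq
        rw [norm_smul, Real.norm_of_nonneg (by linarith [one_le_dil s])]
        nlinarith [one_le_dil s, norm_nonneg q]
      simp [this]
  have ht := tentMass_pos d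
  have hres : ∀ q, res k q = quad k q - m := fun q => by rw [res, hm]
  simp only [hres]
  rw [← hE, abs_mul, abs_of_pos ht] at hb
  unfold defectConst
  rw [mul_assoc (tentMass d)⁻¹, mul_assoc (tentMass d)⁻¹, inv_mul_eq_div, le_div_iff₀ ht, mul_comm]
  refine hb.trans (le_of_eq ?_)
  ring

end ZK

end

noncomputable section

namespace ZK

variable {d : ℕ}


/-! ### The time kernel against the delta function -/

/-- The decompositions of the kernel and of its mass use the same weights, so the error is a
superposition of Fejér defects. -/
theorem timeKernel_sub_eq (a b t h v : ℝ) :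
    timeKernel a b t v -
        Real.pi * damp a t * (Set.Icc (-h) h).indicator (fun _ => (2 * h)⁻¹) v =
      (∫ r in (0 : ℝ)..t, kernelWeight a b t r * fejerDefect h r v) +
        Real.exp (-(b * t)) * fejerDefect h t v := by
  have hk : Continuous (kernelWeight a b t) := by
    unfold kernelWeight
    fun_prop
  have hf : Continuous fun r => fejer r v := by fun_prop
  set c := (Set.Icc (-h) h).indicator (fun _ => (2 * h)⁻¹) v with hc
  have h1 : ∫ r in (0 : ℝ)..t, kernelWeight a b t r * fejerDefect h r v =
      (∫ r in (0 : ℝ)..t, kernelWeight a b t r * fejer r v) -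
        Real.pi * c * ∫ r in (0 : ℝ)..t, kernelWeight a b t r * r := by
    rw [← intervalIntegral.integral_const_mul, ← intervalIntegral.integral_sub
      (Continuous.intervalIntegrable (by fun_prop) _ _)
      (Continuous.intervalIntegrable (by fun_prop) _ _)]
    congr 1
    ext r
    rw [fejerDefect, ← hc]
    ring
  rw [h1, timeKernel_eq_fejer, damp_eq_integral_kernelWeight a b t, fejerDefect, ← hc]
  ring

variable [NeZero d]

/-! ### Integrals against functions of the resonance function -/

/-- The bound for the density of the resonance function on the ball of radius `R`. -/
def resDensity (R : ℝ) (k : Vec d) : ℝ :=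
  Real.pi * (2 * R) ^ (d - 2) / Real.sqrt (|kx k| * ‖k‖)

theorem resDensity_nonneg {R : ℝ} (hR : 0 ≤ R) (k : Vec d) : 0 ≤ resDensity R k := by
  unfold resDensity
  positivity

theorem integrableOn_comp_res (hd : 3 ≤ d) {k : Vec d} (hk : kx k ≠ 0) {R : ℝ} (hR : 0 ≤ R)
    {Ψ : ℝ → ℝ} (hΨ : Measurable Ψ) (hi : Integrable Ψ) :
    IntegrableOn (fun q => Ψ (res k q)) (Metric.closedBall (0 : Vec d) R) ∧
      ∫ q in Metric.closedBall (0 : Vec d) R, |Ψ (res k q)| ≤ resDensity R k * ∫ v, |Ψ v| := by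
  have hm : Measurable fun q => Ψ (res k q) := hΨ.comp (continuous_res k).measurable
  have h1 := lintegral_closedBall_comp_res_le hd hk hR (Ψ := fun v => ‖Ψ v‖ₑ) (by fun_prop)
  have h2 : ENNReal.ofReal (resDensity R k) * ∫⁻ v, ‖Ψ v‖ₑ < ⊤ :=
    ENNReal.mul_lt_top ENNReal.ofReal_lt_top hi.2
  have h3 : IntegrableOn (fun q => Ψ (res k q)) (Metric.closedBall (0 : Vec d) R) :=
    ⟨hm.aestronglyMeasurable, h1.trans_lt h2⟩
  refine ⟨h3, ?_⟩
  have h4 := ENNReal.toReal_mono h2.ne h1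
  rw [ENNReal.toReal_mul, ENNReal.toReal_ofReal (resDensity_nonneg hR k)] at h4
  simp only [← Real.norm_eq_abs]
  rwa [integral_norm_eq_lintegral_enorm hm.aestronglyMeasurable,
    integral_norm_eq_lintegral_enorm hΨ.aestronglyMeasurable]

theorem abs_integral_mul_comp_res_le (hd : 3 ≤ d) {k : Vec d} (hk : kx k ≠ 0) {R : ℝ} (hR0 : 0 ≤ R)
    {Ψ : ℝ → ℝ} (hΨ : Measurable Ψ) (hi : Integrable Ψ) {F : Vec d → ℝ} {M : ℝ}
    (hM : ∀ q, |F q| ≤ M) (hR : ∀ q, R < ‖q‖ → F q = 0) :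
    |∫ q, F q * Ψ (res k q)| ≤ M * (resDensity R k * ∫ v, |Ψ v|) := by
  obtain ⟨h1, h2⟩ := integrableOn_comp_res hd hk hR0 hΨ hi
  have hM0 : 0 ≤ M := (abs_nonneg _).trans (hM 0)
  rw [← setIntegral_eq_integral_of_forall_compl_eq_zero (s := Metric.closedBall (0 : Vec d) R)
    (fun q hq => by rw [hR q (by simpa using hq), zero_mul]), ← Real.norm_eq_abs]
  refine (norm_integral_le_of_norm_le (h1.norm.const_mul M)
    (Eventually.of_forall fun q => ?_)).trans ?_
  · rw [norm_mul]
    exact mul_le_mul_of_nonneg_right (hM q) (norm_nonneg _)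
  · rw [integral_const_mul]
    exact mul_le_mul_of_nonneg_left h2 hM0

theorem integral_abs_fejerDefect_le {h r : ℝ} (hh : 0 < h) (hr : 0 ≤ r) :
    ∫ v, |fejerDefect h r v| ≤ 2 * Real.pi * r := by
  have hi := (integrable_fejer r).add ((integrable_indicator_Icc h).const_mul (Real.pi * r))
  refine (integral_mono (integrable_fejerDefect h r).abs hi
    fun v => abs_fejerDefect_le hh hr v).trans (le_of_eq ?_)
  rw [integral_add' (integrable_fejer r) ((integrable_indicator_Icc h).const_mul _),
    integral_const_mul, integral_indicator_Icc hh, integral_fejer hr]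
  ring

theorem measurable_fejerDefect_right (h r : ℝ) : Measurable (fejerDefect h r) :=
  (measurable_fejerDefect h).comp (by fun_prop : Measurable fun v : ℝ => (r, v))

theorem integrable_mul_comp_res {k : Vec d} {F : Vec d → ℝ} (hF : Measurable F) {M A R : ℝ}
    (hM : ∀ q, |F q| ≤ M) (hR : ∀ q, R < ‖q‖ → F q = 0) {Ψ : ℝ → ℝ} (hΨ : Measurable Ψ)
    (hA : ∀ v, |Ψ v| ≤ A) : Integrable fun q => F q * Ψ (res k q) := by
  have hM0 : 0 ≤ M := (abs_nonneg _).trans (hM 0)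
  have h1 : Integrable ((Metric.closedBall (0 : Vec d) R).indicator fun _ => M * A) :=
    (integrableOn_const measure_closedBall_lt_top.ne).integrable_indicator measurableSet_closedBall
  refine h1.mono' (hF.mul (hΨ.comp (continuous_res k).measurable)).aestronglyMeasurable
    (Eventually.of_forall fun q => ?_)
  by_cases hq : q ∈ Metric.closedBall (0 : Vec d) R
  · rw [Set.indicator_of_mem hq, norm_mul]
    exact mul_le_mul (hM q) (hA _) (abs_nonneg _) hM0
  · rw [Set.indicator_of_notMem hq, hR q (by simpa using hq)]
    simp

/-- The resonance function is even in `q`, so only the even part of `F` contributes. Size and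
density bounds suffice here; the defect itself need not be small. -/
theorem abs_integral_mul_fejerDefect_res_le_of_add_neg (hd : 3 ≤ d) {k : Vec d} (hk : kx k ≠ 0)
    {R : ℝ} (hR0 : 0 ≤ R) {F : Vec d → ℝ} (hF : Measurable F) {A M : ℝ} (hA : ∀ q, |F q| ≤ A)
    (hM : ∀ q, |F q + F (-q)| ≤ M) (hR : ∀ q, R < ‖q‖ → F q = 0) {h r : ℝ} (hh : 0 < h)
    (hr : 0 ≤ r) :
    |∫ q, F q * fejerDefect h r (res k q)| ≤ M * (resDensity R k * (Real.pi * r)) := by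
  have hi := integrable_mul_comp_res (k := k) hF hA hR (measurable_fejerDefect_right h r)
    (abs_fejerDefect_le_const hh hr)
  have h1 : ∫ q, F (-q) * fejerDefect h r (res k q) = ∫ q, F q * fejerDefect h r (res k q) := by
    rw [← integral_neg_eq_self]
    simp only [neg_neg, res_neg]
  have hi' : Integrable fun q => F (-q) * fejerDefect h r (res k q) := by
    have := hi.comp_neg
    simpa only [res_neg] using this
  have h2 : ∫ q, (F q + F (-q)) * fejerDefect h r (res k q) =
      2 * ∫ q, F q * fejerDefect h r (res k q) := by
    simp only [add_mul]
    rw [integral_add hi hi', h1]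
    ring
  have h3 := abs_integral_mul_comp_res_le hd hk hR0 (measurable_fejerDefect_right h r)
    (integrable_fejerDefect h r) (F := fun q => F q + F (-q)) hM
    (fun q hq => by rw [hR q hq, hR (-q) (by simpa using hq), add_zero])
  have hM0 : 0 ≤ M := (abs_nonneg _).trans (hM 0)
  have h4 := mul_le_mul_of_nonneg_left (mul_le_mul_of_nonneg_left (integral_abs_fejerDefect_le hh hr)
    (resDensity_nonneg hR0 k)) hM0
  rw [h2, abs_mul, abs_two] at h3
  linarith

/-! ### Averages over thin shells around the resonant manifold -/

/-- The normalised integral over `{|res k| ≤ h}`. -/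
def shellAvg (h : ℝ) (k : Vec d) (F : Vec d → ℝ) : ℝ :=
  (2 * h)⁻¹ * ∫ q in {q | |res k q| ≤ h}, F q

theorem shellAvg_eq (h : ℝ) (k : Vec d) (F : Vec d → ℝ) :
    shellAvg h k F =
      ∫ q, F q * (Set.Icc (-h) h).indicator (fun _ => (2 * h)⁻¹) (res k q) := by
  have hs : MeasurableSet {q : Vec d | |res k q| ≤ h} :=
    measurableSet_le (continuous_res k).abs.measurable measurable_const
  rw [shellAvg, ← integral_indicator hs, ← integral_const_mul]
  congr 1
  ext q
  simp only [Set.indicator_apply, Set.mem_ofPred_eq, Set.mem_Icc, abs_le]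
  split_ifs <;> ring

theorem abs_shellAvg_le (hd : 3 ≤ d) {k : Vec d} (hk : kx k ≠ 0) {R : ℝ} (hR0 : 0 ≤ R)
    {F : Vec d → ℝ} {M : ℝ} (hM : ∀ q, |F q| ≤ M) (hR : ∀ q, R < ‖q‖ → F q = 0) {h : ℝ}
    (hh : 0 < h) : |shellAvg h k F| ≤ M * resDensity R k := by
  rw [shellAvg_eq]
  have := abs_integral_mul_comp_res_le hd hk hR0 (measurable_indicator_Icc h)
    (integrable_indicator_Icc h) hM hR
  simpa only [abs_of_nonneg (indicator_Icc_nonneg hh _), integral_indicator_Icc hh, mul_one]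
    using this

theorem integral_mul_fejerDefect_res {k : Vec d} {F : Vec d → ℝ} (hF : Measurable F) {M R : ℝ}
    (hM : ∀ q, |F q| ≤ M) (hR : ∀ q, R < ‖q‖ → F q = 0) {h : ℝ} (hh : 0 < h) (r : ℝ) :
    ∫ q, F q * fejerDefect h r (res k q) =
      (∫ q, F q * fejer r (res k q)) - Real.pi * r * shellAvg h k F := by
  have h1 : Integrable fun q => F q * fejer r (res k q) :=
    integrable_mul_comp_res hF hM hR (Continuous.measurable (by fun_prop)) (A := r ^ 2 / 2)
      fun v => by rw [abs_of_nonneg (fejer_nonneg _ _)]; exact fejer_le r v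
  have h2 : Integrable fun q => F q * (Set.Icc (-h) h).indicator (fun _ => (2 * h)⁻¹) (res k q) :=
    integrable_mul_comp_res hF hM hR (measurable_indicator_Icc h) (A := (2 * h)⁻¹)
      fun v => by
        rw [abs_of_nonneg (indicator_Icc_nonneg hh _)]
        exact Set.indicator_le_self' (fun _ _ => by positivity) v
  rw [shellAvg_eq, ← integral_const_mul, ← integral_sub h1 (h2.const_mul _)]
  congr 1
  ext q
  rw [fejerDefect]
  ring

/-- All averages with `h ≤ ρ` are close to one and the same Fejér average, hence to each other. -/
theorem exists_tendsto_shellAvg {k : Vec d} (hk : kx k ≠ 0) {F : Vec d → ℝ} (hF : Continuous F)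
    {M R : ℝ} (hR0 : 0 ≤ R) (hM : ∀ q, |F q| ≤ M) (hR : ∀ q, R < ‖q‖ → F q = 0)
    (hL : ∀ q q', |F q - F q'| ≤ M * ‖q - q'‖) :
    ∃ I, Tendsto (fun h => shellAvg h k F) (𝓝[>] 0) (𝓝 I) := by
  rw [← cauchy_map_iff_exists_tendsto, Metric.cauchy_iff]
  refine ⟨inferInstance, fun e he => ?_⟩
  have hkn : 0 < ‖k‖ := (abs_pos.2 hk).trans_le (abs_kx_le k)
  have hkx := abs_pos.2 hk
  set m : ℝ := 3 / 4 * |kx k| * ‖k‖ ^ 2 with hm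
  have hm0 : 0 < m := by positivity
  have hC := defectConst_nonneg d hR0
  have hM0 : 0 ≤ M := (abs_nonneg _).trans (hM 0)
  have hpi := Real.pi_pos
  have hlim : Tendsto (fun ρ : ℝ => defectConst d R * M *
      (ρ / m ^ 2 + ρ / (Real.pi * m) + ρ ^ 2 / (Real.pi * m ^ 2))) (𝓝[>] 0) (𝓝 0) := by
    have : Continuous fun ρ : ℝ => defectConst d R * M *
      (ρ / m ^ 2 + ρ / (Real.pi * m) + ρ ^ 2 / (Real.pi * m ^ 2)) := by fun_prop
    have := this.tendsto 0
    simp only [zero_div, ne_eq, OfNat.ofNat_ne_zero, not_false_eq_true, zero_pow, add_zero,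
      mul_zero] at this
    exact this.mono_left nhdsWithin_le_nhds
  -- Taking `δ = ρ` and `r = ρ⁻²` in the defect estimate and dividing by the mass `πr` leaves three
  -- errors that vanish with `ρ`.
  obtain ⟨ρ, hρ, hρ0, hρm⟩ := ((hlim.eventually (gt_mem_nhds (half_pos he))).and
    (Ioc_mem_nhdsGT (half_pos hm0))).exists
  have key : ∀ h ∈ Set.Ioc 0 ρ, |shellAvg h k F -
      (∫ q, F q * fejer (ρ ^ 2)⁻¹ (res k q)) / (Real.pi * (ρ ^ 2)⁻¹)| < e / 2 := by
    intro h hh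
    refine lt_of_le_of_lt ?_ hρ
    have h1 := abs_integral_mul_fejerDefect_res_le hF hR0 hM hR hL hm hh.1 hh.2 hρm
      (r := (ρ ^ 2)⁻¹) (by positivity)
    rw [integral_mul_fejerDefect_res hF.measurable hM hR hh.1] at h1
    have hr : 0 < Real.pi * (ρ ^ 2)⁻¹ := by positivity
    have h2 : shellAvg h k F - (∫ q, F q * fejer (ρ ^ 2)⁻¹ (res k q)) / (Real.pi * (ρ ^ 2)⁻¹) =
        -(((∫ q, F q * fejer (ρ ^ 2)⁻¹ (res k q)) - Real.pi * (ρ ^ 2)⁻¹ * shellAvg h k F) /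
          (Real.pi * (ρ ^ 2)⁻¹)) := by
      field_simp
      ring
    rw [h2, abs_neg, abs_div, abs_of_pos hr, div_le_iff₀ hr]
    refine h1.trans (le_of_eq ?_)
    field_simp
  refine ⟨_, image_mem_map (Ioc_mem_nhdsGT hρ0), ?_⟩
  rintro _ ⟨h, hh, rfl⟩ _ ⟨h', hh', rfl⟩
  have h1 := key h hh
  have h2 := key h' hh'
  rw [Real.dist_eq]
  rw [abs_lt] at *
  constructor <;> linarith


/-! ### The time-integrated sum against the delta function -/

/-- In the loss term the rate `b = νβ` varies with `q`. This separates the dependence on `q` into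
three smooth amplitudes `β^j e^{-νrβ}`, to which the defect estimates apply. -/
theorem kernelWeight_mul (a ν β t r : ℝ) :
    kernelWeight a (ν * β) t r =
      -a * Real.exp (-(a * (t - r))) * (β ^ 0 * Real.exp (-(ν * r * β))) +
        2 * ν * Real.exp (-(a * (t - r))) * (β ^ 1 * Real.exp (-(ν * r * β))) +
        ν ^ 2 * damp a (t - r) * (β ^ 2 * Real.exp (-(ν * r * β))) := by
  rw [kernelWeight, show ν * β * r = ν * r * β by ring]
  ring

theorem abs_kernelWeight_combination_le {a ν t r Y x₀ x₁ x₂ : ℝ} (ha : 0 ≤ a) (hν : 0 ≤ ν)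
    (hr : r ∈ Set.Icc 0 t) (h0 : |x₀| ≤ Y) (h1 : |x₁| ≤ Y) (h2 : |x₂| ≤ Y) :
    |-a * Real.exp (-(a * (t - r))) * x₀ + 2 * ν * Real.exp (-(a * (t - r))) * x₁ +
      ν ^ 2 * damp a (t - r) * x₂| ≤ (a + 2 * ν + ν ^ 2 * t) * Y := by
  have htr : 0 ≤ t - r := by linarith [hr.2]
  have hY : 0 ≤ Y := (abs_nonneg _).trans h0
  have he : Real.exp (-(a * (t - r))) ≤ 1 := by
    rw [Real.exp_le_one_iff]
    linarith [mul_nonneg ha htr]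
  have he0 := Real.exp_pos (-(a * (t - r)))
  have hd := damp_le ha htr
  have hd0 := damp_nonneg a htr
  have e1 : |-a * Real.exp (-(a * (t - r))) * x₀| ≤ a * Y := by
    rw [abs_mul, abs_mul, abs_neg, abs_of_nonneg ha, abs_of_pos he0]
    exact mul_le_mul (mul_le_of_le_one_right ha he) h0 (abs_nonneg _) ha
  have e2 : |2 * ν * Real.exp (-(a * (t - r))) * x₁| ≤ 2 * ν * Y := by
    rw [abs_mul, abs_mul, abs_of_nonneg (by positivity : 0 ≤ 2 * ν), abs_of_pos he0]
    exact mul_le_mul (mul_le_of_le_one_right (by positivity) he) h1 (abs_nonneg _) (by positivity)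
  have e3 : |ν ^ 2 * damp a (t - r) * x₂| ≤ ν ^ 2 * t * Y := by
    rw [abs_mul, abs_of_nonneg (mul_nonneg (sq_nonneg ν) hd0)]
    have ht : 0 ≤ t := hr.1.trans hr.2
    refine mul_le_mul (mul_le_mul_of_nonneg_left ?_ (sq_nonneg _)) h2 (abs_nonneg _) (by positivity)
    linarith [hr.1]
  refine (abs_add_le _ _).trans ((add_le_add (abs_add_le _ _) le_rfl).trans ?_)
  linarith

/-- Fubini between `q` and `r`, then the assumed bound `Y` for each of the three amplitudes at each
`r`. The factor in front stays bounded when `at` and `νt` do. -/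
theorem abs_integral_mul_timeKernel_sub_le {k : Vec d} {F β : Vec d → ℝ} (hF : Continuous F)
    (hβ : Continuous β) (hβ0 : ∀ q, 0 ≤ β q) {A R : ℝ} (hA : ∀ j ≤ 2, ∀ q, |F q * β q ^ j| ≤ A)
    (hR : ∀ q, R < ‖q‖ → F q = 0) {a ν t h Y : ℝ} (ha : 0 ≤ a) (hν : 0 ≤ ν) (ht : 0 ≤ t)
    (hh : 0 < h) (hY : ∀ j ≤ 2, ∀ r ∈ Set.Icc 0 t,
      |∫ q, F q * β q ^ j * Real.exp (-(ν * r * β q)) * fejerDefect h r (res k q)| ≤ Y) :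
    |(∫ q, F q * timeKernel a (ν * β q) t (res k q)) - Real.pi * damp a t * shellAvg h k F| ≤
      (1 + (a + 2 * ν + ν ^ 2 * t) * t) * Y := by
  set W : ℝ := t ^ 2 / 2 + Real.pi * t * (2 * h)⁻¹ with hW
  have hA0 : 0 ≤ A := (abs_nonneg _).trans (hA 0 (by norm_num) 0)
  have hexp : ∀ r ∈ Set.Icc 0 t, ∀ j ≤ 2, ∀ q, |F q * β q ^ j * Real.exp (-(ν * r * β q))| ≤ A := by
    intro r hr j hj q
    rw [abs_mul, Real.abs_exp]
    refine (mul_le_of_le_one_right (abs_nonneg _) ?_).trans (hA j hj q)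
    rw [Real.exp_le_one_iff]
    linarith [mul_nonneg (mul_nonneg hν hr.1) (hβ0 q)]
  have hEW : ∀ r ∈ Set.Icc 0 t, ∀ v, |fejerDefect h r v| ≤ W := by
    intro r hr v
    refine (abs_fejerDefect_le_const hh hr.1 v).trans ?_
    have := Real.pi_pos
    have := hr.1
    rw [hW]
    gcongr <;> exact hr.2
  have hW0 : 0 ≤ W := (abs_nonneg _).trans (hEW 0 ⟨le_rfl, ht⟩ 0)
  have hFk : ∀ r q, F q * kernelWeight a (ν * β q) t r =
      -a * Real.exp (-(a * (t - r))) * (F q * β q ^ 0 * Real.exp (-(ν * r * β q))) +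
        2 * ν * Real.exp (-(a * (t - r))) * (F q * β q ^ 1 * Real.exp (-(ν * r * β q))) +
        ν ^ 2 * damp a (t - r) * (F q * β q ^ 2 * Real.exp (-(ν * r * β q))) := fun r q => by
    rw [kernelWeight_mul]
    ring
  set g : Vec d × ℝ → ℝ := fun p =>
    F p.1 * kernelWeight a (ν * β p.1) t p.2 * fejerDefect h p.2 (res k p.1) with hg
  have hgm : Measurable g := by
    refine Measurable.mul (Continuous.measurable ?_) ((measurable_fejerDefect h).comp
      (Continuous.measurable (f := fun p : Vec d × ℝ => (p.2, res k p.1)) ?_))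
    · unfold kernelWeight
      fun_prop
    · have := continuous_res k
      fun_prop
  have hgi : Integrable g (volume.prod (volume.restrict (Set.Ioc 0 t))) := by
    have hbd : Integrable (fun p : Vec d × ℝ => (Metric.closedBall (0 : Vec d) R).indicator
        (fun _ => (a + 2 * ν + ν ^ 2 * t) * A * W) p.1 * 1)
        (volume.prod (volume.restrict (Set.Ioc 0 t))) :=
      Integrable.mul_prod (g := fun _ : ℝ => (1 : ℝ))
        ((integrableOn_const measure_closedBall_lt_top.ne).integrable_indicator
          measurableSet_closedBall) (integrable_const _)
    refine hbd.mono' hgm.aestronglyMeasurable ?_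
    have hprod : (volume : Measure (Vec d)).prod (volume.restrict (Set.Ioc 0 t)) =
        ((volume : Measure (Vec d)).prod volume).restrict (Set.univ ×ˢ Set.Ioc 0 t) := by
      rw [← Measure.prod_restrict, Measure.restrict_univ]
    rw [hprod]
    refine ae_restrict_of_forall_mem (MeasurableSet.univ.prod measurableSet_Ioc) fun p hp => ?_
    have hr : p.2 ∈ Set.Icc 0 t := ⟨hp.2.1.le, hp.2.2⟩
    rw [mul_one, hg, norm_mul]
    by_cases hq : p.1 ∈ Metric.closedBall (0 : Vec d) R
    · rw [Set.indicator_of_mem hq]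
      refine mul_le_mul ?_ (hEW _ hr _) (abs_nonneg _) (by positivity)
      rw [hFk, Real.norm_eq_abs]
      exact abs_kernelWeight_combination_le ha hν hr (hexp _ hr 0 (by norm_num) _)
        (hexp _ hr 1 (by norm_num) _) (hexp _ hr 2 le_rfl _)
    · rw [Set.indicator_of_notMem hq, hR p.1 (by simpa using hq)]
      simp
  have hti : t ∈ Set.Icc 0 t := ⟨ht, le_rfl⟩
  have hFR : ∀ j r q, R < ‖q‖ → F q * β q ^ j * Real.exp (-(ν * r * β q)) = 0 := fun j r q hq => by
    rw [hR q hq, zero_mul, zero_mul]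
  have hint : ∀ j ≤ 2, ∀ r ∈ Set.Icc 0 t, Integrable fun q =>
      F q * β q ^ j * Real.exp (-(ν * r * β q)) * fejerDefect h r (res k q) := fun j hj r hr =>
    integrable_mul_comp_res (Continuous.measurable (by fun_prop)) (hexp r hr j hj) (hFR j r)
      (measurable_fejerDefect_right h r) (hEW r hr)
  have hA1 : ∀ q, |F q| ≤ A := fun q => by simpa using hA 0 (by norm_num) q
  have hind : Integrable fun q =>
      F q * (Set.Icc (-h) h).indicator (fun _ => (2 * h)⁻¹) (res k q) :=
    integrable_mul_comp_res hF.measurable hA1 hR (measurable_indicator_Icc h) (A := (2 * h)⁻¹)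
      fun v => by
        rw [abs_of_nonneg (indicator_Icc_nonneg hh _)]
        exact Set.indicator_le_self' (fun _ _ => by positivity) v
  have hsplit : ∀ q, F q * timeKernel a (ν * β q) t (res k q) =
      (∫ r in Set.Ioc 0 t, g (q, r)) +
        F q * β q ^ 0 * Real.exp (-(ν * t * β q)) * fejerDefect h t (res k q) +
        Real.pi * damp a t * (F q * (Set.Icc (-h) h).indicator (fun _ => (2 * h)⁻¹) (res k q)) := by
    intro q
    have h1 := timeKernel_sub_eq a (ν * β q) t h (res k q)
    rw [intervalIntegral.integral_of_le ht, sub_eq_iff_eq_add] at h1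
    rw [h1, hg]
    simp only [mul_assoc (F q)]
    rw [integral_const_mul, show ν * β q * t = ν * t * β q by ring]
    ring
  have hinner : ∀ r ∈ Set.Icc 0 t, |∫ q, g (q, r)| ≤ (a + 2 * ν + ν ^ 2 * t) * Y := by
    intro r hr
    have h1 : ∫ q, g (q, r) =
        -a * Real.exp (-(a * (t - r))) * (∫ q, F q * β q ^ 0 * Real.exp (-(ν * r * β q)) *
            fejerDefect h r (res k q)) +
          2 * ν * Real.exp (-(a * (t - r))) * (∫ q, F q * β q ^ 1 * Real.exp (-(ν * r * β q)) *
            fejerDefect h r (res k q)) +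
          ν ^ 2 * damp a (t - r) * (∫ q, F q * β q ^ 2 * Real.exp (-(ν * r * β q)) *
            fejerDefect h r (res k q)) := by
      have i0 := (hint 0 (by norm_num) r hr).const_mul (-a * Real.exp (-(a * (t - r))))
      have i1 := (hint 1 (by norm_num) r hr).const_mul (2 * ν * Real.exp (-(a * (t - r))))
      have i2 := (hint 2 le_rfl r hr).const_mul (ν ^ 2 * damp a (t - r))
      rw [← integral_const_mul, ← integral_const_mul, ← integral_const_mul, ← integral_add i0 i1,
        ← integral_add (i0.fun_add i1) i2]
      congr 1
      ext q
      simp only [hg, hFk]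
      ring
    rw [h1]
    exact abs_kernelWeight_combination_le ha hν hr (hY 0 (by norm_num) r hr)
      (hY 1 (by norm_num) r hr) (hY 2 le_rfl r hr)
  have htot : (∫ q, F q * timeKernel a (ν * β q) t (res k q)) -
      Real.pi * damp a t * shellAvg h k F = (∫ r in Set.Ioc 0 t, ∫ q, g (q, r)) +
        ∫ q, F q * β q ^ 0 * Real.exp (-(ν * t * β q)) * fejerDefect h t (res k q) := by
    rw [shellAvg_eq]
    simp only [hsplit]
    rw [integral_add (hgi.integral_prod_left.fun_add (hint 0 (by norm_num) t hti)) (hind.const_mul _),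
      integral_add hgi.integral_prod_left (hint 0 (by norm_num) t hti), integral_const_mul,
      integral_integral_swap (f := fun q r => g (q, r)) hgi]
    ring
  have h3 : ‖∫ r in Set.Ioc 0 t, ∫ q, g (q, r)‖ ≤ (a + 2 * ν + ν ^ 2 * t) * Y * t := by
    have := norm_setIntegral_le_of_norm_le_const (μ := volume) (s := Set.Ioc 0 t) (by simp)
      (f := fun r => ∫ q, g (q, r)) fun r hr => hinner r ⟨hr.1.le, hr.2⟩
    simpa [Real.volume_real_Ioc_of_le ht] using this
  rw [htot]
  refine (abs_add_le _ _).trans ((add_le_add h3 (hY 0 (by norm_num) t hti)).trans (le_of_eq ?_))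
  ring

end ZK

end

noncomputable section

namespace ZK

variable {d : ℕ}


/-! ### Uniform bounds for smooth families -/

theorem exists_bound_family {P E : Type*} [NormedAddCommGroup P] [NormedSpace ℝ P]
    [NormedAddCommGroup E] [NormedSpace ℝ E] [ProperSpace E] {G : P × E → ℝ}
    (hG : ContDiff ℝ ∞ G) {𝒦 : Set P} (h𝒦 : IsCompact 𝒦) {R : ℝ}
    (hR : ∀ p q, R < ‖q‖ → G (p, q) = 0) :
    ∃ M, 0 ≤ M ∧ ∀ p ∈ 𝒦, (∀ q, |G (p, q)| ≤ M) ∧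
      ∀ q q', |G (p, q) - G (p, q')| ≤ M * ‖q - q'‖ := by
  have hcomp : IsCompact (𝒦 ×ˢ Metric.closedBall (0 : E) R) :=
    h𝒦.prod (isCompact_closedBall _ _)
  obtain ⟨M₁, hM₁⟩ := hcomp.exists_bound_of_continuousOn hG.continuous.continuousOn
  obtain ⟨M₂, hM₂⟩ := hcomp.exists_bound_of_continuousOn
    (hG.continuous_fderiv (by simp)).continuousOn
  refine ⟨max 0 (max M₁ M₂), le_max_left _ _, fun p hp => ⟨fun q => ?_, fun q q' => ?_⟩⟩
  · rcases le_or_gt ‖q‖ R with hq | hq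
    · exact (hM₁ (p, q) ⟨hp, by simpa using hq⟩).trans
        ((le_max_left _ _).trans (le_max_right _ _))
    · rw [hR p q hq, abs_zero]
      exact le_max_left _ _
  · have hd : ∀ q, HasFDerivAt (fun q => G (p, q))
        ((fderiv ℝ G (p, q)).comp (ContinuousLinearMap.inr ℝ P E)) q := fun q =>
      ((hG.differentiable (by simp)).differentiableAt.hasFDerivAt).comp q
        (hasFDerivAt_prodMk_right p q)
    have hb : ∀ q, ‖(fderiv ℝ G (p, q)).comp (ContinuousLinearMap.inr ℝ P E)‖ ≤
        max 0 (max M₁ M₂) := by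
      intro q
      rcases le_or_gt ‖q‖ R with hq | hq
      · refine (ContinuousLinearMap.opNorm_comp_le _ _).trans ?_
        refine (mul_le_of_le_one_right (norm_nonneg _)
          (ContinuousLinearMap.norm_inr_le_one ℝ P E)).trans ?_
        exact (hM₂ (p, q) ⟨hp, by simpa using hq⟩).trans
          ((le_max_right _ _).trans (le_max_right _ _))
      · have h0 : (fun q => G (p, q)) =ᶠ[𝓝 q] fun _ => 0 := by
          filter_upwards [(isOpen_lt continuous_const continuous_norm).mem_nhds hq] with x hx
          exact hR p x hx
        rw [(hd q).unique ((hasFDerivAt_const (0 : ℝ) q).congr_of_eventuallyEq h0), norm_zero]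
        exact le_max_left _ _
    have := Convex.norm_image_sub_le_of_norm_hasFDerivWithin_le (s := Set.univ)
      (fun x _ => (hd x).hasFDerivWithinAt) (fun x _ => hb x) convex_univ
      (Set.mem_univ q') (Set.mem_univ q)
    simpa using this

/-- Mean value inequality along the segment from `k = 0`. -/
theorem exists_bound_of_eq_zero {E E' : Type*} [NormedAddCommGroup E] [NormedSpace ℝ E]
    [ProperSpace E] [NormedAddCommGroup E'] [NormedSpace ℝ E'] [ProperSpace E']
    {H : (E × ℝ) × E' → ℝ} (hH : ContDiff ℝ ∞ H) {D τ R : ℝ} (hD : 0 ≤ D)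
    (hR : ∀ p q, R < ‖q‖ → H (p, q) = 0) (h0 : ∀ s q, H ((0, s), q) = 0) :
    ∃ M, 0 ≤ M ∧ ∀ k : E, ‖k‖ ≤ D → ∀ s ∈ Set.Icc 0 τ, ∀ q, |H ((k, s), q)| ≤ M * ‖k‖ := by
  set S : Set ((E × ℝ) × E') :=
    (Metric.closedBall 0 D ×ˢ Set.Icc 0 τ) ×ˢ Metric.closedBall 0 R with hS
  have hcomp : IsCompact S :=
    ((isCompact_closedBall _ _).prod isCompact_Icc).prod (isCompact_closedBall _ _)
  have hconv : Convex ℝ S :=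
    ((convex_closedBall _ _).prod (convex_Icc _ _)).prod (convex_closedBall _ _)
  obtain ⟨M, hM⟩ := hcomp.exists_bound_of_continuousOn
    (hH.continuous_fderiv (by simp)).continuousOn
  refine ⟨max 0 M, le_max_left _ _, fun k hk s hs q => ?_⟩
  rcases le_or_gt ‖q‖ R with hq | hq
  · have h1 := Convex.norm_image_sub_le_of_norm_fderiv_le (f := H) (𝕜 := ℝ) (C := max 0 M) (s := S)
      (fun x _ => (hH.differentiable (by simp)).differentiableAt)
      (fun x hx => (hM x hx).trans (le_max_right _ _)) hconv
      (x := ((0, s), q)) (y := ((k, s), q)) ⟨⟨by simpa using hD, hs⟩, by simpa using hq⟩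
      ⟨⟨by simpa using hk, hs⟩, by simpa using hq⟩
    rw [h0, sub_zero] at h1
    refine h1.trans (le_of_eq ?_)
    simp [Prod.norm_def]
  · rw [hR _ _ hq, abs_zero]
    positivity

variable [NeZero d]

/-- Makes the defect estimate uniform down to `k_x = 0`. The weight `|k_x|` alone only cancels the
singularity of the density; smallness for small `|k_x|` needs the oddness at `k = 0`. The condition
on `δ` is `δ ≤ m/2` for the least admissible `m = (3/4)η³`. -/
theorem exists_abs_kx_mul_integral_fejerDefect_le (hd : 3 ≤ d) {G : (Vec d × ℝ) × Vec d → ℝ}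
    (hG : ContDiff ℝ ∞ G) {D τ R : ℝ} (hD : 0 ≤ D) (hR0 : 0 ≤ R)
    (hR : ∀ p q, R < ‖q‖ → G (p, q) = 0)
    (hodd : ∀ s q, G ((0, s), q) + G ((0, s), -q) = 0) :
    ∃ M, 0 ≤ M ∧ ∀ k : Vec d, ‖k‖ ≤ D → kx k ≠ 0 → ∀ s ∈ Set.Icc 0 τ, ∀ r t η δ h : ℝ,
      r ∈ Set.Icc 0 t → 0 < η → 0 < h → h ≤ δ → δ ≤ 3 / 8 * η ^ 3 →
      |kx k| * |∫ q, G ((k, s), q) * fejerDefect h r (res k q)| ≤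
        M * (t * Real.sqrt η + t * δ / η ^ 6 + 1 / (δ * η ^ 3) + 1 / η ^ 6) := by
  obtain ⟨M₁, hM₁, hb⟩ := exists_bound_family hG
    (𝒦 := Metric.closedBall (0 : Vec d) D ×ˢ Set.Icc 0 τ)
    ((isCompact_closedBall _ _).prod isCompact_Icc) hR
  obtain ⟨M₂, hM₂, ho⟩ := exists_bound_of_eq_zero (τ := τ) (R := R)
    (H := fun p : (Vec d × ℝ) × Vec d => G p + G (p.1, -p.2))
    (hG.add (hG.comp (contDiff_fst.prodMk contDiff_snd.neg))) hD
    (fun p q hq => by simp only; rw [hR p q hq, hR p (-q) (by simpa using hq), add_zero]) hodd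
  set Z : ℝ := Real.pi * (2 * R) ^ (d - 2) with hZ
  have hpi := Real.pi_pos
  have hZ0 : 0 ≤ Z := by positivity
  have hC := defectConst_nonneg d hR0
  refine ⟨D * (defectConst d R * M₁) * (Real.pi * 2) + M₂ * Z * Real.pi * Real.sqrt D + D * (defectConst d R * M₁) * 2, by positivity,
    fun k hk hkx s hs r t η δ h hr hη hh hhδ hδ => ?_⟩
  obtain ⟨hbM, hbL⟩ := hb (k, s) ⟨by simpa using hk, hs⟩
  have hGc : Continuous fun q => G ((k, s), q) := hG.continuous.comp (by fun_prop)
  have hδ0 : 0 < δ := hh.trans_le hhδ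
  have hkD : |kx k| ≤ D := (abs_kx_le k).trans hk
  have hkx0 := abs_pos.2 hkx
  have hk0 : 0 < ‖k‖ := hkx0.trans_le (abs_kx_le k)
  have ht : 0 ≤ t := hr.1.trans hr.2
  have hr0 := hr.1
  have hsD := Real.sqrt_nonneg D
  have hsη := Real.sqrt_nonneg η
  -- Above the threshold the dilation estimate applies with `m ≥ (3/4)η³`. Below it the even part of
  -- the amplitude is `O(|k|)`, and `|k_x||k|` divided by its square root is at most `√(Dη)`.
  rcases le_or_gt η |kx k| with h1 | h1
  · set m : ℝ := 3 / 4 * |kx k| * ‖k‖ ^ 2 with hm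
    have hmη : 3 / 4 * η ^ 3 ≤ m := by
      have : η ≤ ‖k‖ := h1.trans (abs_kx_le k)
      calc 3 / 4 * η ^ 3 = 3 / 4 * η * η ^ 2 := by ring
        _ ≤ m := by rw [hm]; gcongr
    have hm0 : 0 < m := lt_of_lt_of_le (by positivity) hmη
    have h2 := abs_integral_mul_fejerDefect_res_le hGc hR0 hbM (fun q => hR (k, s) q) hbL hm hh
      hhδ (by linarith) hr0
    have hm2 : 1 / m ^ 2 ≤ 2 / η ^ 6 := by
      rw [div_le_div_iff₀ (by positivity) (by positivity)]
      have : (3 / 4 * η ^ 3) ^ 2 ≤ m ^ 2 := by gcongr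
      have h6 : 0 < η ^ 6 := by positivity
      nlinarith
    have hm1 : 1 / (δ * m) ≤ 2 / (δ * η ^ 3) := by
      rw [div_le_div_iff₀ (by positivity) (by positivity)]
      have h3 : 0 < η ^ 3 := by positivity
      nlinarith
    have h3 : Real.pi * r * δ / m ^ 2 ≤ Real.pi * t * δ * (2 / η ^ 6) := by
      rw [div_eq_mul_one_div]
      gcongr
      exact hr.2
    calc _ ≤ D * (defectConst d R * M₁ *
          (Real.pi * t * δ * (2 / η ^ 6) + 2 / (δ * η ^ 3) + 2 / η ^ 6)) := by
          refine mul_le_mul hkD (h2.trans ?_) (abs_nonneg _) hD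
          gcongr
      _ = D * (defectConst d R * M₁) * (Real.pi * 2) * (t * δ / η ^ 6) +
          D * (defectConst d R * M₁) * 2 * (1 / (δ * η ^ 3) + 1 / η ^ 6) := by ring
      _ ≤ _ := by
          have e1 : 0 ≤ t * Real.sqrt η := by positivity
          have e2 : 0 ≤ t * δ / η ^ 6 := by positivity
          have e3 : 0 ≤ 1 / (δ * η ^ 3) := by positivity
          have e4 : 0 ≤ 1 / η ^ 6 := by positivity
          set c₁ := D * (defectConst d R * M₁) * (Real.pi * 2) with hc₁
          set c₂ := M₂ * Z * Real.pi * Real.sqrt D with hc₂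
          set c₃ := D * (defectConst d R * M₁) * 2 with hc₃
          have f1 : 0 ≤ c₁ := by positivity
          have f2 : 0 ≤ c₂ := by positivity
          have f3 : 0 ≤ c₃ := by positivity
          generalize t * Real.sqrt η = x₁ at *
          generalize t * δ / η ^ 6 = x₂ at *
          generalize 1 / (δ * η ^ 3) = x₃ at *
          generalize 1 / η ^ 6 = x₄ at *
          have := mul_nonneg f1 e1
          have := mul_nonneg f1 e3
          have := mul_nonneg f1 e4
          have := mul_nonneg f2 e1
          have := mul_nonneg f2 e2
          have := mul_nonneg f2 e3
          have := mul_nonneg f2 e4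
          have := mul_nonneg f3 e1
          have := mul_nonneg f3 e2
          linarith
  · have h2 := abs_integral_mul_fejerDefect_res_le_of_add_neg hd hkx hR0 hGc.measurable hbM
      (M := M₂ * ‖k‖) (fun q => ho k hk s hs q) (fun q => hR (k, s) q) hh hr0
    have h3 : |kx k| * ‖k‖ / Real.sqrt (|kx k| * ‖k‖) = Real.sqrt (|kx k| * ‖k‖) := Real.div_sqrt
    have h4 : Real.sqrt (|kx k| * ‖k‖) ≤ Real.sqrt D * Real.sqrt η := by
      rw [mul_comm, Real.sqrt_mul (norm_nonneg k)]
      gcongr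
    calc _ ≤ |kx k| * (M₂ * ‖k‖ * (resDensity R k * (Real.pi * r))) := by gcongr
      _ = M₂ * Z * Real.pi * r * (|kx k| * ‖k‖ / Real.sqrt (|kx k| * ‖k‖)) := by
          rw [resDensity, ← hZ]
          ring
      _ ≤ M₂ * Z * Real.pi * t * (Real.sqrt D * Real.sqrt η) := by
          rw [h3]
          have := hr.2
          gcongr
      _ = M₂ * Z * Real.pi * Real.sqrt D * (t * Real.sqrt η) := by ring
      _ ≤ _ := by
          gcongr
          · have : 0 ≤ D * (defectConst d R * M₁) * (Real.pi * 2) := by positivity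
            have : 0 ≤ D * (defectConst d R * M₁) * 2 := by positivity
            linarith
          · have e2 : 0 ≤ t * δ / η ^ 6 := by positivity
            have e3 : 0 ≤ 1 / (δ * η ^ 3) := by positivity
            have e4 : 0 ≤ 1 / η ^ 6 := by positivity
            linarith

end ZK

end

noncomputable section

namespace ZK

variable {d : ℕ}


/-! ### The continuum approximation -/

theorem integrable_prod_Ioc {f : Vec d × ℝ → ℝ} (hf : Continuous f) {R : ℝ}
    (hR : ∀ x u, R < ‖x‖ → f (x, u) = 0) (t : ℝ) :
    Integrable f (volume.prod (volume.restrict (Set.Ioc 0 t))) := by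
  have hprod : (volume : Measure (Vec d)).prod (volume.restrict (Set.Ioc 0 t)) =
      ((volume : Measure (Vec d)).prod volume).restrict (Set.univ ×ˢ Set.Ioc 0 t) := by
    rw [← Measure.prod_restrict, Measure.restrict_univ]
  rw [hprod]
  have h1 : IntegrableOn f (Metric.closedBall (0 : Vec d) R ×ˢ Set.Icc 0 t)
      (volume.prod volume) :=
    hf.continuousOn.integrableOn_compact ((isCompact_closedBall _ _).prod isCompact_Icc)
  refine h1.of_forall_sdiff_eq_zero (MeasurableSet.univ.prod measurableSet_Ioc) ?_
  rintro ⟨x, u⟩ ⟨hx, hx'⟩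
  refine hR x u ?_
  by_contra! h
  exact hx' ⟨by simpa using h, hx.2.1.le, hx.2.2⟩

variable [NeZero d]

/-- The product `s = νr` is treated as a parameter in `[0,τ]`, so that the constant is independent
of `ν` and `t` separately. -/
theorem exists_abs_kx_mul_timeKernel_sub_le (hd : 3 ≤ d) {F β : Vec d × Vec d → ℝ}
    (hF : ContDiff ℝ ∞ F) (hβ : ContDiff ℝ ∞ β) (hβ0 : ∀ p, 0 ≤ β p) {D τ R : ℝ} (hD : 0 ≤ D)
    (hR0 : 0 ≤ R) (hR : ∀ k q, R < ‖q‖ → F (k, q) = 0) (hFodd : ∀ q, F (0, -q) = -F (0, q))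
    (hβeven : ∀ q, β (0, -q) = β (0, q)) :
    ∃ M, 0 ≤ M ∧ ∀ k : Vec d, ‖k‖ ≤ D → kx k ≠ 0 → ∀ a ν t η δ I : ℝ, 0 ≤ a → 0 ≤ ν → 0 ≤ t →
      a * t ≤ τ → ν * t ≤ τ → 0 < η → 0 < δ → δ ≤ 3 / 8 * η ^ 3 →
      Tendsto (fun h => shellAvg h k fun q => F (k, q)) (𝓝[>] 0) (𝓝 I) →
      |kx k| * |(∫ q, F (k, q) * timeKernel a (ν * β (k, q)) t (res k q)) -
          Real.pi * damp a t * I| ≤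
        M * (t * Real.sqrt η + t * δ / η ^ 6 + 1 / (δ * η ^ 3) + 1 / η ^ 6) := by
  have hG : ∀ j : ℕ, ContDiff ℝ ∞ fun p : (Vec d × ℝ) × Vec d =>
      F (p.1.1, p.2) * β (p.1.1, p.2) ^ j * Real.exp (-(p.1.2 * β (p.1.1, p.2))) := by
    intro j
    fun_prop
  choose M hM0 hM using fun j : ℕ => exists_abs_kx_mul_integral_fejerDefect_le (τ := τ) hd (hG j)
    hD hR0 (fun p q hq => by simp only [hR p.1 q hq, zero_mul])
    (fun s q => by simp only [hFodd, hβeven]; ring)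
  have hMs : ∀ j ≤ 2, M j ≤ M 0 + M 1 + M 2 := by
    have := hM0 0
    have := hM0 1
    have := hM0 2
    intro j hj
    interval_cases j <;> linarith
  set M' := M 0 + M 1 + M 2 with hM'
  have hM'0 : 0 ≤ M' := (hM0 0).trans (hMs 0 (by norm_num))
  refine ⟨(1 + (3 * |τ| + τ ^ 2)) * M', by positivity, ?_⟩
  intro k hk hkx a ν t η δ I ha hν ht hat hνt hη hδ hδη hI
  have hkx0 := abs_pos.2 hkx
  choose A hA0 hA using fun j : ℕ => exists_bound_family (P := Vec d) (E := Vec d)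
    (R := R) (G := fun p => F p * β p ^ j) (by fun_prop) (isCompact_singleton (x := k))
    (fun p q hq => by simp only [hR p q hq, zero_mul])
  have hAs : ∀ j ≤ 2, ∀ q, |F (k, q) * β (k, q) ^ j| ≤ A 0 + A 1 + A 2 := by
    have := hA0 0
    have := hA0 1
    have := hA0 2
    intro j hj q
    refine ((hA j k rfl).1 q).trans ?_
    interval_cases j <;> linarith
  set e : ℝ := t * Real.sqrt η + t * δ / η ^ 6 + 1 / (δ * η ^ 3) + 1 / η ^ 6 with he
  have he0 : 0 ≤ e := by positivity
  have hFc : Continuous fun q => F (k, q) := hF.continuous.comp (by fun_prop)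
  have hβc : Continuous fun q => β (k, q) := hβ.continuous.comp (by fun_prop)
  have hcoef : 1 + (a + 2 * ν + ν ^ 2 * t) * t ≤ 1 + (3 * |τ| + τ ^ 2) := by
    have h1 : 0 ≤ ν * t := by positivity
    have h2 : (ν * t) ^ 2 ≤ τ ^ 2 := by gcongr
    have h3 := le_abs_self τ
    linarith
  -- The bound is uniform in `h ≤ δ` and passes to the limit defining the delta integral.
  refine le_of_tendsto (f := fun h => |kx k| * |(∫ q, F (k, q) *
    timeKernel a (ν * β (k, q)) t (res k q)) -
      Real.pi * damp a t * shellAvg h k fun q => F (k, q)|) (x := 𝓝[>] 0)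
    (((tendsto_const_nhds.sub (hI.const_mul _)).abs).const_mul _) ?_
  filter_upwards [Ioc_mem_nhdsGT hδ] with h hh
  have hY := abs_integral_mul_timeKernel_sub_le (k := k) hFc hβc (fun q => hβ0 _) hAs (hR k) ha hν
    ht hh.1 (Y := M' * e / |kx k|) (fun j hj r hr => by
      rw [le_div_iff₀ hkx0, mul_comm]
      have hs : ν * r ∈ Set.Icc 0 τ :=
        ⟨mul_nonneg hν hr.1, (mul_le_mul_of_nonneg_left hr.2 hν).trans hνt⟩
      exact (hM j k hk hkx (ν * r) hs r t η δ h hr hη hh.1 hh.2 hδη).trans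
        (mul_le_mul_of_nonneg_right (hMs j hj) he0))
  calc _ ≤ |kx k| * ((1 + (a + 2 * ν + ν ^ 2 * t) * t) * (M' * e / |kx k|)) := by gcongr
    _ = (1 + (a + 2 * ν + ν ^ 2 * t) * t) * (M' * e) := by field_simp
    _ ≤ _ := by
        rw [mul_assoc]
        gcongr

theorem contDiff_Om : ContDiff ℝ ∞ fun p : Vec d × Vec d => Om p.2 (p.1 - p.2) p.1 := by
  have h : ContDiff ℝ ∞ (disp : Vec d → ℝ) := by
    unfold disp kx
    refine ContDiff.mul (by fun_prop) (contDiff_norm_sq ℝ)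
  unfold Om
  fun_prop

/-- Exchange sum and time integral: at each `u` there is an oscillating lattice sum with frequency
`u ≤ t` and parameters `(k, νu)`. The weight `damp` and the length of the time interval give `t²`.
-/
theorem exists_abs_sum_timeKernel_sub_le {F β : Vec d × Vec d → ℝ}
    (hF : ContDiff ℝ ∞ F) (hβ : ContDiff ℝ ∞ β) {D τ R : ℝ}
    (hR0 : 0 ≤ R) (hR : ∀ k x, R < ‖x‖ → F (k, x) = 0) (N : ℕ) :
    ∃ C, 0 ≤ C ∧ ∀ k : Vec d, ‖k‖ ≤ D → ∀ a ν t L : ℝ, 0 ≤ a → 0 ≤ ν → 0 ≤ t → ν * t ≤ τ → 1 ≤ L →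
      |1 / L ^ d * (∑ K ∈ box d L R, F (k, pt L K) *
          timeKernel a (ν * β (k, pt L K)) t (Om (pt L K) (k - pt L K) k)) -
        ∫ x, F (k, x) * timeKernel a (ν * β (k, x)) t (Om x (k - x) k)| ≤
        C * (t ^ 2 * ((1 + t) / L) ^ N) := by
  set Φ : (Vec d × ℝ) × Vec d → ℝ := fun p => Om p.2 (p.1.1 - p.2) p.1.1 with hΦ
  have hΦc : ContDiff ℝ ∞ Φ := by
    exact contDiff_Om.comp (contDiff_fst.fst.prodMk contDiff_snd)
  set G : (Vec d × ℝ) × Vec d → ℝ := fun p =>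
    F (p.1.1, p.2) * Real.exp (-(p.1.2 * β (p.1.1, p.2))) with hG
  have hGc : ContDiff ℝ ∞ G := by
    rw [hG]
    fun_prop
  obtain ⟨C, hC, hCb⟩ := norm_latSum_osc_sub_integral_le hΦc
    (𝒦 := Metric.closedBall (0 : Vec d) D ×ˢ Set.Icc 0 τ)
    ((isCompact_closedBall _ _).prod isCompact_Icc) hR0 N (fun p => (G p : ℂ))
    (Complex.ofRealCLM.contDiff.comp hGc)
    (fun p x hx => by simp only [hG, hR p.1 x hx, zero_mul, Complex.ofReal_zero])
  refine ⟨C, hC, fun k hk a ν t L ha hν ht hνt hL => ?_⟩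
  set f : Vec d × ℝ → ℝ := fun p => F (k, p.1) *
    (Real.exp (-(ν * β (k, p.1) * p.2)) * damp a (t - p.2) *
      Real.cos (p.2 * Om p.1 (k - p.1) k)) with hf
  have hFc := hF.continuous
  have hβc := hβ.continuous
  have hOc : Continuous fun x => Om x (k - x) k :=
    contDiff_Om.continuous.comp (f := fun x => (k, x)) (by fun_prop)
  have hO : Continuous fun p : Vec d × ℝ => Om p.1 (k - p.1) k := hOc.comp continuous_fst
  have hfc : Continuous f := by
    rw [hf]
    fun_prop
  have htk : ∀ x, F (k, x) * timeKernel a (ν * β (k, x)) t (Om x (k - x) k) =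
      ∫ u in Set.Ioc 0 t, f (x, u) := by
    intro x
    rw [timeKernel, intervalIntegral.integral_of_le ht, ← integral_const_mul]
  have hfi := integrable_prod_Ioc hfc (R := R) (fun x u hx => by simp only [hf, hR k x hx, zero_mul]) t
  have hfx : ∀ x, IntegrableOn (fun u => f (x, u)) (Set.Ioc 0 t) := fun x =>
    (Continuous.integrableOn_Icc (by fun_prop)).mono_set Set.Ioc_subset_Icc_self
  have hre : ∀ u x, f (x, u) =
      damp a (t - u) * (osc (fun p => (G p : ℂ)) Φ (k, ν * u) u x).re := by
    intro u x
    rw [osc, Complex.re_ofReal_mul, mul_comm Complex.I, Complex.exp_ofReal_mul_I_re]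
    simp only [hf, hG, hΦ, show ν * β (k, x) * u = ν * u * β (k, x) by ring]
    ring
  have hosc : ∀ u, Integrable (osc (fun p => (G p : ℂ)) Φ (k, ν * u) u) := fun u => by
    refine (Continuous.integrable_of_hasCompactSupport ?_ (hasCompactSupport_osc (R := R)
      (fun p x hx => by simp only [hG, hR p.1 x hx, zero_mul, Complex.ofReal_zero]) _ _))
    have h1 : Continuous fun x => G ((k, ν * u), x) := hGc.continuous.comp (by fun_prop)
    have h2 : Continuous fun x => Φ ((k, ν * u), x) := hΦc.continuous.comp (by fun_prop)
    unfold osc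
    fun_prop
  have hdiff : ∀ u ∈ Set.Ioc 0 t, ‖1 / L ^ d * (∑ K ∈ box d L R, f (pt L K, u)) -
      ∫ x, f (x, u)‖ ≤ t * (C * ((1 + t) / L) ^ N) := by
    intro u hu
    have h1 : 1 / L ^ d * (∑ K ∈ box d L R, f (pt L K, u)) - ∫ x, f (x, u) =
        damp a (t - u) * (latSum L R (osc (fun p => (G p : ℂ)) Φ (k, ν * u) u) 0 -
          ∫ x, osc (fun p => (G p : ℂ)) Φ (k, ν * u) u x).re := by
      have h2 : (∫ x, osc (fun p => (G p : ℂ)) Φ (k, ν * u) u x).re =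
          ∫ x, (osc (fun p => (G p : ℂ)) Φ (k, ν * u) u x).re := (integral_re (hosc u)).symm
      simp only [hre]
      rw [integral_const_mul, Complex.sub_re, h2, latSum, Complex.re_ofReal_mul, Complex.re_sum,
        ← Finset.mul_sum]
      simp only [add_zero]
      ring
    have htu : 0 ≤ t - u := by linarith [hu.2]
    have h3 := hCb (k, ν * u) ⟨by simpa using hk, mul_nonneg hν hu.1.le,
      (mul_le_mul_of_nonneg_left hu.2 hν).trans hνt⟩ u L hL 0 (zero_mem_cell hL)
    rw [h1, norm_mul, Real.norm_of_nonneg (damp_nonneg a htu)]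
    refine mul_le_mul ((damp_le ha htu).trans (by linarith [hu.1]))
      ((Complex.abs_re_le_norm _).trans (h3.trans ?_)) (norm_nonneg _) ht
    rw [abs_of_pos hu.1]
    have := hu.1
    have hL0 : 0 < L := by linarith
    gcongr
    exact hu.2
  have htot : 1 / L ^ d * (∑ K ∈ box d L R, F (k, pt L K) *
        timeKernel a (ν * β (k, pt L K)) t (Om (pt L K) (k - pt L K) k)) -
      ∫ x, F (k, x) * timeKernel a (ν * β (k, x)) t (Om x (k - x) k) =
      ∫ u in Set.Ioc 0 t, (1 / L ^ d * (∑ K ∈ box d L R, f (pt L K, u)) - ∫ x, f (x, u)) := by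
    simp only [htk]
    rw [integral_integral_swap (f := fun x u => f (x, u)) hfi, integral_sub
      ((integrable_finsetSum _ fun K _ => hfx (pt L K)).const_mul _) hfi.integral_prod_right,
      integral_const_mul, integral_finsetSum _ fun K _ => hfx (pt L K)]
  rw [htot]
  refine (norm_setIntegral_le_of_norm_le_const (μ := volume) (by simp) hdiff).trans (le_of_eq ?_)
  rw [Real.volume_real_Ioc_of_le ht]
  ring

end ZK

end

noncomputable section

namespace ZK

variable {d : ℕ}


/-! ### The collision operator in centred coordinates -/

/-- For `e ≤ 1` the relative error is at most `at ≤ e² ≤ e`; for `e ≥ 1` the trivial bound `0 ≤ damp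
a t ≤ t` is enough. No smallness of `e` is needed. -/
theorem sub_damp_le_of_le_sq {a t e : ℝ} (ha : 0 ≤ a) (ht : 0 ≤ t) (he : 0 ≤ e)
    (h : a * t ≤ e ^ 2) : |damp a t - t| ≤ t * e := by
  rw [abs_sub_comm, abs_of_nonneg (sub_nonneg.2 (damp_le ha ht))]
  rcases le_total e 1 with h1 | h1
  · refine (sub_damp_le ha ht).trans (mul_le_mul_of_nonneg_left (h.trans ?_) ht)
    nlinarith
  · have := damp_nonneg a ht
    nlinarith

theorem sub_half_smul_sub (k q : Vec d) :
    k - ((1 / 2 : ℝ) • k - q) = (1 / 2 : ℝ) • k + q := by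
  module

theorem HasDeltaIntegral.deltaIntegral_eq {F Φ : Vec d → ℝ} {I : ℝ} (h : HasDeltaIntegral F Φ I) :
    deltaIntegral F Φ = I :=
  h.limUnder_eq

theorem deltaIntegral_zero (Φ : Vec d → ℝ) : deltaIntegral (fun _ => 0) Φ = 0 := by
  have : HasDeltaIntegral (fun _ => 0) Φ 0 := by
    simp [HasDeltaIntegral]
  exact this.deltaIntegral_eq

/-- The integrand of the gain term in centred coordinates, up to the factor `k_x²`. -/
def gainDensity (n : Vec d → ℝ) (k q : Vec d) : ℝ :=
  n ((1 / 2 : ℝ) • k - q) * n ((1 / 2 : ℝ) • k + q)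

theorem abs_gainDensity_le {n : Vec d → ℝ} {Cin : ℝ} (h0 : ∀ x, 0 ≤ n x) (hC : ∀ x, n x ≤ Cin)
    (k q : Vec d) : |gainDensity n k q| ≤ Cin ^ 2 := by
  rw [gainDensity, abs_of_nonneg (mul_nonneg (h0 _) (h0 _)), sq]
  exact mul_le_mul (hC _) (hC _) (h0 _) ((h0 0).trans (hC 0))

theorem gainDensity_eq_zero {n : Vec d → ℝ} {D : ℝ} (hsupp : ∀ x, D / 2 < ‖x‖ → n x = 0)
    {k q : Vec d} (hq : D < ‖q‖) : gainDensity n k q = 0 := by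
  have h : D / 2 < ‖(1 / 2 : ℝ) • k - q‖ ∨ D / 2 < ‖(1 / 2 : ℝ) • k + q‖ := by
    by_contra! hcon
    have h1 := norm_sub_le ((1 / 2 : ℝ) • k + q) ((1 / 2 : ℝ) • k - q)
    rw [add_sub_sub_cancel, ← two_smul ℝ q, norm_smul, Real.norm_two] at h1
    linarith [hcon.1, hcon.2, norm_nonneg q]
  rw [gainDensity]
  rcases h with h | h
  · rw [hsupp _ h, zero_mul]
  · rw [hsupp _ h, mul_zero]

variable [NeZero d]

theorem shellAvg_const_mul (h : ℝ) (k : Vec d) (c : ℝ) (F : Vec d → ℝ) :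
    shellAvg h k (fun q => c * F q) = c * shellAvg h k F := by
  rw [shellAvg, shellAvg, integral_const_mul]
  ring

theorem shellAvg_comp_neg (h : ℝ) (k : Vec d) (F : Vec d → ℝ) :
    shellAvg h k (fun q => F (-q)) = shellAvg h k F := by
  rw [shellAvg_eq, shellAvg_eq, ← integral_neg_eq_self]
  simp only [neg_neg, res_neg]

theorem setIntegral_Om_eq_shellAvg (h : ℝ) (k : Vec d) (F : Vec d → ℝ) :
    (2 * h)⁻¹ * ∫ x in {x | |Om x (k - x) k| ≤ h}, F x =
      shellAvg h k fun q => F ((1 / 2 : ℝ) • k - q) := by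
  have h1 : MeasurableSet {x : Vec d | |Om x (k - x) k| ≤ h} :=
    measurableSet_le ((contDiff_Om.continuous.comp (f := fun x => (k, x))
      (by fun_prop)).abs.measurable) measurable_const
  have h2 : MeasurableSet {q : Vec d | |res k q| ≤ h} :=
    measurableSet_le (continuous_res k).abs.measurable measurable_const
  rw [shellAvg, ← integral_indicator h1, ← integral_indicator h2,
    ← integral_sub_left_eq_self _ volume ((1 / 2 : ℝ) • k)]
  congr 2
  ext q
  simp only [Set.indicator_apply, Set.mem_ofPred_eq, Om_eq_res]

theorem hasDeltaIntegral_iff {k : Vec d} {F : Vec d → ℝ} {I : ℝ} :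
    HasDeltaIntegral F (fun x => Om x (k - x) k) I ↔
      Tendsto (fun h => shellAvg h k fun q => F ((1 / 2 : ℝ) • k - q)) (𝓝[>] 0) (𝓝 I) := by
  simp only [HasDeltaIntegral, setIntegral_Om_eq_shellAvg]

/-- The integrand of the loss term in centred coordinates, up to the factor `k_x`. -/
def lossDensity (n : Vec d → ℝ) (k q : Vec d) : ℝ :=
  kx ((1 / 2 : ℝ) • k - q) * n ((1 / 2 : ℝ) • k + q)

theorem contDiff_kx : ContDiff ℝ ∞ (kx : Vec d → ℝ) := by
  unfold kx
  fun_prop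

theorem exists_tendsto_shellAvg_of_contDiff {k : Vec d} (hk : kx k ≠ 0) {F : Vec d → ℝ}
    (hF : ContDiff ℝ ∞ F) {R : ℝ} (hR0 : 0 ≤ R) (hR : ∀ q, R < ‖q‖ → F q = 0) :
    ∃ I, Tendsto (fun h => shellAvg h k F) (𝓝[>] 0) (𝓝 I) := by
  obtain ⟨M, -, hM⟩ := exists_bound_family (P := ℝ) (G := fun p => F p.2)
    (hF.comp contDiff_snd) (isCompact_singleton (x := 0)) (R := R) (fun _ q hq => hR q hq)
  obtain ⟨hb, hL⟩ := hM 0 rfl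
  exact exists_tendsto_shellAvg hk hF.continuous hR0 hb hR hL

theorem exists_shellAvg_gain_loss {n : Vec d → ℝ} (hn : ContDiff ℝ ∞ n) {ρ : ℝ} (hρ : 0 ≤ ρ)
    (hsupp : ∀ x, ρ < ‖x‖ → n x = 0) {k : Vec d} (hk : kx k ≠ 0) :
    ∃ Ig Il, Tendsto (fun h => shellAvg h k (gainDensity n k)) (𝓝[>] 0) (𝓝 Ig) ∧
      Tendsto (fun h => shellAvg h k (lossDensity n k)) (𝓝[>] 0) (𝓝 Il) ∧
      CollisionExists n k ∧ collision n k = kx k ^ 2 * Ig - 2 * n k * (kx k * Il) := by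
  have hplus : ∀ q : Vec d, ρ + ‖k‖ < ‖q‖ → n ((1 / 2 : ℝ) • k + q) = 0 := by
    intro q hq
    refine hsupp _ ?_
    have h1 : ‖q‖ ≤ ‖(1 / 2 : ℝ) • k + q‖ + ‖(1 / 2 : ℝ) • k‖ := by
      simpa using norm_sub_le ((1 / 2 : ℝ) • k + q) ((1 / 2 : ℝ) • k)
    rw [norm_smul, Real.norm_of_nonneg (by norm_num)] at h1
    linarith [norm_nonneg k]
  have hkc := contDiff_kx (d := d)
  obtain ⟨Ig, hIg⟩ := exists_tendsto_shellAvg_of_contDiff hk (F := gainDensity n k)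
    (by unfold gainDensity; fun_prop) (R := ρ + ‖k‖) (by positivity)
    (fun q hq => by rw [gainDensity, hplus q hq, mul_zero])
  obtain ⟨Il, hIl⟩ := exists_tendsto_shellAvg_of_contDiff hk (F := lossDensity n k)
    (by unfold lossDensity; fun_prop) (R := ρ + ‖k‖) (by positivity)
    (fun q hq => by rw [lossDensity, hplus q hq, mul_zero])
  have hg : HasDeltaIntegral (gain n k) (fun x => Om x (k - x) k) Ig := by
    rw [hasDeltaIntegral_iff]
    simp only [gain, sub_half_smul_sub]
    exact hIg
  have hl : HasDeltaIntegral (loss n k) (fun x => Om x (k - x) k) (kx k * Il) := by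
    rw [hasDeltaIntegral_iff]
    -- The reflection `q ↦ -q` exchanges `k₁` and `k - k₁`; it matches the loss integrand of the
    -- collision operator with the one that Wick's formula produces.
    have h1 : ∀ h, (shellAvg h k fun q => loss n k ((1 / 2 : ℝ) • k - q)) =
        kx k * shellAvg h k (lossDensity n k) := by
      intro h
      rw [← shellAvg_comp_neg, ← shellAvg_const_mul]
      congr 1
      ext q
      simp only [loss, lossDensity, kx_sub, kx_add, kx_smul, sub_neg_eq_add]
      ring
    simp only [h1]
    exact hIl.const_mul _
  refine ⟨Ig, Il, hIg, hIl, ⟨⟨Ig, hg⟩, ⟨_, hl⟩⟩, ?_⟩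
  rw [collision, hg.deltaIntegral_eq, hl.deltaIntegral_eq]

theorem collision_of_kx_eq_zero (n : Vec d → ℝ) {k : Vec d} (hk : kx k = 0) :
    collision n k = 0 := by
  have h1 : loss n k = fun _ => 0 := by
    ext x
    simp [loss, hk]
  rw [collision, h1, deltaIntegral_zero, hk]
  ring

theorem collision_of_lt_norm {n : Vec d → ℝ} {ρ : ℝ} (hsupp : ∀ x, ρ < ‖x‖ → n x = 0)
    (hρ : 0 ≤ ρ) {k : Vec d} (hk : 2 * ρ < ‖k‖) : collision n k = 0 := by
  have h1 : gain n k = fun _ => 0 := by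
    ext x
    rw [gain]
    rcases lt_or_ge ρ ‖x‖ with hx | hx
    · rw [hsupp x hx, zero_mul]
    · rw [hsupp (k - x) (by linarith [norm_sub_norm_le k x]), mul_zero]
  rw [collision, h1, deltaIntegral_zero, hsupp k (by linarith)]
  ring

/-! ### The kinetic approximation of the lattice sum -/

/-- The lattice sum in the first correction to the energy spectrum. -/
def latticeCorr (n : Vec d → ℝ) (D ν t L : ℝ) (k : Vec d) : ℝ :=
  1 / L ^ d * (4 * kx k * (∑ K ∈ box d L D, kx k * (n (pt L K) * n (k - pt L K)) *
      timeKernel (2 * (ν * ‖k‖ ^ 2)) (ν * ‖k‖ ^ 2) t (Om (pt L K) (k - pt L K) k)) -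
    8 * kx k * ∑ K ∈ box d L D, n k * (kx (pt L K) * n (k - pt L K)) *
      timeKernel (ν * ‖k‖ ^ 2) (ν * ‖pt L K‖ ^ 2) t (Om (pt L K) (k - pt L K) k))

theorem integral_Om_eq_integral_res (f : Vec d → ℝ → ℝ) (k : Vec d) :
    ∫ x, f x (Om x (k - x) k) = ∫ q, f ((1 / 2 : ℝ) • k - q) (res k q) := by
  rw [← integral_sub_left_eq_self _ volume ((1 / 2 : ℝ) • k)]
  simp only [Om_eq_res]

/-- The weight `|k_x|` compensates the singular density because `|k_x| ≤ |k|`. -/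
theorem resDensity_mul_abs_kx_le {R : ℝ} (hR : 0 ≤ R) {k : Vec d} (hk : kx k ≠ 0) :
    |kx k| * resDensity R k ≤ Real.pi * (2 * R) ^ (d - 2) := by
  have hk0 := abs_pos.2 hk
  have hpi := Real.pi_pos
  have h1 : |kx k| ≤ Real.sqrt (|kx k| * ‖k‖) := by
    refine Real.le_sqrt_of_sq_le ?_
    rw [sq]
    gcongr
    exact abs_kx_le k
  rw [resDensity, ← mul_div_assoc, div_le_iff₀ (hk0.trans_le h1), mul_comm]
  gcongr

theorem mul_kx_mul_eq_zero {n : Vec d → ℝ} {D : ℝ} (hsupp : ∀ x, D / 2 < ‖x‖ → n x = 0)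
    {k x : Vec d} (hx : D < ‖x‖) : n k * (kx x * n (k - x)) = 0 := by
  rcases lt_or_ge (D / 2) ‖k‖ with hk | hk
  · rw [hsupp k hk, zero_mul]
  · have : ‖x‖ - ‖k‖ ≤ ‖k - x‖ := by
      rw [norm_sub_rev]
      exact norm_sub_norm_le x k
    rw [hsupp (k - x) (by linarith)]
    ring

theorem mul_lossDensity_eq_zero {n : Vec d → ℝ} {D : ℝ} (hsupp : ∀ x, D / 2 < ‖x‖ → n x = 0)
    {k q : Vec d} (hq : D < ‖q‖) : n k * lossDensity n k q = 0 := by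
  rcases lt_or_ge (D / 2) ‖k‖ with hk | hk
  · rw [hsupp k hk, zero_mul]
  · have h1 : ‖q‖ ≤ ‖(1 / 2 : ℝ) • k + q‖ + ‖(1 / 2 : ℝ) • k‖ := by
      simpa using norm_sub_le ((1 / 2 : ℝ) • k + q) ((1 / 2 : ℝ) • k)
    rw [norm_smul, Real.norm_of_nonneg (by norm_num)] at h1
    rw [lossDensity, hsupp ((1 / 2 : ℝ) • k + q) (by linarith [norm_nonneg k])]
    ring

theorem abs_mul_lossDensity_le {n : Vec d → ℝ} {Cin D : ℝ} (hD : 0 ≤ D) (h0 : ∀ x, 0 ≤ n x)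
    (hC : ∀ x, n x ≤ Cin) (hsupp : ∀ x, D / 2 < ‖x‖ → n x = 0) (k q : Vec d) :
    |n k * lossDensity n k q| ≤ Cin ^ 2 * D := by
  have hCin : 0 ≤ Cin := (h0 0).trans (hC 0)
  rcases lt_or_ge (D / 2) ‖k‖ with hk | hk
  · rw [hsupp k hk, zero_mul, abs_zero]
    positivity
  rcases lt_or_ge (D / 2) ‖(1 / 2 : ℝ) • k + q‖ with hq | hq
  · rw [lossDensity, hsupp _ hq, mul_zero, mul_zero, abs_zero]
    positivity
  have h1 : |kx ((1 / 2 : ℝ) • k - q)| ≤ D := by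
    have h2 := norm_sub_le k ((1 / 2 : ℝ) • k + q)
    have h3 : k - ((1 / 2 : ℝ) • k + q) = (1 / 2 : ℝ) • k - q := by module
    rw [h3] at h2
    exact (abs_kx_le _).trans (by linarith)
  rw [lossDensity, abs_mul, abs_mul, abs_of_nonneg (h0 _), abs_of_nonneg (h0 _)]
  calc _ ≤ Cin * (D * Cin) := mul_le_mul (hC _)
        (mul_le_mul h1 (hC _) (h0 _) hD) (mul_nonneg (abs_nonneg _) (h0 _)) hCin
    _ = _ := by ring

theorem abs_kx_mul_le_of_tendsto_shellAvg (hd : 3 ≤ d) {k : Vec d} (hk : kx k ≠ 0) {R : ℝ}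
    (hR0 : 0 ≤ R) {F : Vec d → ℝ} {M I : ℝ} (hM : ∀ q, |F q| ≤ M) (hR : ∀ q, R < ‖q‖ → F q = 0)
    (hI : Tendsto (fun h => shellAvg h k F) (𝓝[>] 0) (𝓝 I)) :
    |kx k| * |I| ≤ M * (Real.pi * (2 * R) ^ (d - 2)) := by
  have h1 : |I| ≤ M * resDensity R k := by
    refine le_of_tendsto hI.abs ?_
    filter_upwards [self_mem_nhdsWithin] with h hh
    exact abs_shellAvg_le hd hk hR0 hM hR hh
  have hM0 : 0 ≤ M := (abs_nonneg _).trans (hM 0)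
  calc _ ≤ |kx k| * (M * resDensity R k) := by gcongr
    _ = M * (|kx k| * resDensity R k) := by ring
    _ ≤ _ := mul_le_mul_of_nonneg_left (resDensity_mul_abs_kx_le hR0 hk) hM0

-- Gain and loss each incur three errors: sum to integral, time kernel to delta function, and `damp`
-- to `t`. Only the last has an explicit constant, depending on `Cin`, `D` and `d` alone; the others
-- may depend on `n`, since they come with small factors.
set_option maxHeartbeats 1000000 in
theorem exists_latticeCorr_bound (hd : 3 ≤ d) {n : Vec d → ℝ} (hn : ContDiff ℝ ∞ n)
    (heven : ∀ x, n (-x) = n x) {Cin D : ℝ} (hD : 0 < D) (h0 : ∀ x, 0 ≤ n x) (hC : ∀ x, n x ≤ Cin)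
    (hsupp : ∀ x, D / 2 < ‖x‖ → n x = 0) (τ : ℝ) (N : ℕ) :
    ∃ M, 0 ≤ M ∧ ∀ k : Vec d, ‖k‖ ≤ D → kx k ≠ 0 → ∀ ν t L η δ e : ℝ, 0 ≤ ν → 0 ≤ t → ν * t ≤ τ →
      1 ≤ L → 0 < η → 0 < δ → δ ≤ 3 / 8 * η ^ 3 → 0 ≤ e → ν * ‖k‖ ^ 2 * t ≤ e ^ 2 →
      |latticeCorr n D ν t L k - 4 * Real.pi * t * collision n k| ≤
        M * (t * Real.sqrt η + t * δ / η ^ 6 + 1 / (δ * η ^ 3) + 1 / η ^ 6 +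
            t ^ 2 * ((1 + t) / L) ^ N) +
          16 * Real.pi ^ 2 * (Cin ^ 2 * D * (2 * D) ^ (d - 2)) * (t * e) := by
  have hkc := contDiff_kx (d := d)
  have hns : ContDiff ℝ ∞ fun x : Vec d => ‖x‖ ^ 2 := contDiff_norm_sq ℝ
  have hCin : 0 ≤ Cin := (h0 0).trans (hC 0)
  have hpi := Real.pi_pos
  have hsg := fun (_ : Vec d) (x : Vec d) (hx : D < ‖x‖) => hsupp x (by linarith)
  have hsl := fun k x => mul_kx_mul_eq_zero hsupp (k := k) (x := x)
  have hsgC := fun k q => gainDensity_eq_zero hsupp (k := k) (q := q)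
  have hslC := fun k q => mul_lossDensity_eq_zero hsupp (k := k) (q := q)
  -- One of the two factors `k_x` of the gain term is kept in the amplitude, which then vanishes at
  -- `k = 0`. The other is the weight in the estimate.
  obtain ⟨M₁, hM₁, hg⟩ := exists_abs_kx_mul_timeKernel_sub_le (τ := 2 * D ^ 2 * |τ| + |τ|) hd
    (F := fun p => kx p.1 * gainDensity n p.1 p.2) (β := fun p => ‖p.1‖ ^ 2)
    (by unfold gainDensity; fun_prop) (hns.comp contDiff_fst) (fun p => by positivity) hD.le hD.le
    (fun k q hq => by simp only [hsgC k q hq, mul_zero])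
    (fun q => by simp [show kx (0 : Vec d) = 0 from rfl]) (fun q => rfl)
  -- At `k = 0` the loss amplitude is `-n(0) q_x n(q)`, odd in `q` because `n` is even.
  obtain ⟨M₂, hM₂, hl⟩ := exists_abs_kx_mul_timeKernel_sub_le (τ := 2 * D ^ 2 * |τ| + |τ|) hd
    (F := fun p => n p.1 * lossDensity n p.1 p.2) (β := fun p => ‖(1 / 2 : ℝ) • p.1 - p.2‖ ^ 2)
    (by unfold lossDensity; fun_prop) (hns.comp (by fun_prop)) (fun p => by positivity) hD.le hD.le
    hslC (fun q => by simp [lossDensity, kx_neg, heven]) (fun q => by simp)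
  obtain ⟨M₃, hM₃, hgs⟩ := exists_abs_sum_timeKernel_sub_le (D := D) (τ := τ)
    (F := fun p => kx p.1 * (n p.2 * n (p.1 - p.2))) (β := fun p => ‖p.1‖ ^ 2)
    (by fun_prop) (hns.comp contDiff_fst) hD.le
    (fun k x hx => by simp only [hsg k x hx, zero_mul, mul_zero]) N
  obtain ⟨M₄, hM₄, hls⟩ := exists_abs_sum_timeKernel_sub_le (D := D) (τ := τ)
    (F := fun p => n p.1 * (kx p.2 * n (p.1 - p.2))) (β := fun p => ‖p.2‖ ^ 2)
    (by fun_prop) (hns.comp contDiff_snd) hD.le hsl N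
  refine ⟨4 * M₁ + 8 * M₂ + 4 * D * M₃ + 8 * D * M₄, by positivity, ?_⟩
  intro k hk hkx ν t L η δ e hν ht hνt hL hη hδ hδη he hae
  obtain ⟨Ig, Il, hIg, hIl, -, hcoll⟩ := exists_shellAvg_gain_loss hn (by positivity) hsupp hkx
  have hkx0 := abs_pos.2 hkx
  have hkD : |kx k| ≤ D := (abs_kx_le k).trans hk
  have hτ : 0 ≤ |τ| := abs_nonneg τ
  have hντ : ν * t ≤ |τ| := hνt.trans (le_abs_self τ)
  have hk2 : ‖k‖ ^ 2 ≤ D ^ 2 := by gcongr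
  have hat : ν * ‖k‖ ^ 2 * t ≤ D ^ 2 * |τ| := by
    calc ν * ‖k‖ ^ 2 * t = ‖k‖ ^ 2 * (ν * t) := by ring
      _ ≤ _ := by gcongr
  have hD2 : 0 ≤ D ^ 2 * |τ| := by positivity
  set a : ℝ := ν * ‖k‖ ^ 2 with ha
  have ha0 : 0 ≤ a := by positivity
  set E : ℝ := t * Real.sqrt η + t * δ / η ^ 6 + 1 / (δ * η ^ 3) + 1 / η ^ 6 with hE
  set E' : ℝ := t ^ 2 * ((1 + t) / L) ^ N with hE'
  have hL0 : 0 < L := by linarith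
  have hE0 : 0 ≤ E := by positivity
  have hE'0 : 0 ≤ E' := by positivity
  have hg1 := hg k hk hkx (2 * a) ν t η δ (kx k * Ig) (by positivity) hν ht (by linarith)
    (by linarith) hη hδ hδη (by simpa only [shellAvg_const_mul] using hIg.const_mul (kx k))
  have hl1 := hl k hk hkx a ν t η δ (n k * Il) ha0 hν ht (by linarith)
    (by linarith) hη hδ hδη (by simpa only [shellAvg_const_mul] using hIl.const_mul (n k))
  have hg2 := hgs k hk (2 * a) ν t L (by positivity) hν ht hνt hL
  have hl2 := hls k hk a ν t L ha0 hν ht hνt hL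
  simp only at hg1 hl1 hg2 hl2
  rw [integral_Om_eq_integral_res (fun x v => kx k * (n x * n (k - x)) *
    timeKernel (2 * a) (ν * ‖k‖ ^ 2) t v)] at hg2
  rw [integral_Om_eq_integral_res (fun x v => n k * (kx x * n (k - x)) *
    timeKernel a (ν * ‖x‖ ^ 2) t v)] at hl2
  simp only [sub_half_smul_sub] at hg2 hl2
  simp only [gainDensity, lossDensity] at hg1 hl1
  rw [← ha] at hg1 hg2
  have hIgb : |kx k| * |Ig| ≤ Cin ^ 2 * (Real.pi * (2 * D) ^ (d - 2)) :=
    abs_kx_mul_le_of_tendsto_shellAvg hd hkx hD.le (abs_gainDensity_le h0 hC k) (hsgC k) hIg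
  have hIlb : |kx k| * |n k * Il| ≤ Cin ^ 2 * D * (Real.pi * (2 * D) ^ (d - 2)) :=
    abs_kx_mul_le_of_tendsto_shellAvg hd hkx hD.le
      (abs_mul_lossDensity_le hD.le h0 hC hsupp k) (hslC k)
      (by simpa only [shellAvg_const_mul] using hIl.const_mul (n k))
  have hd1 : |damp (2 * a) t - t| ≤ t * (2 * e) :=
    sub_damp_le_of_le_sq (by positivity) ht (by positivity) (by nlinarith [sq_nonneg e])
  have hd2 : |damp a t - t| ≤ t * e := sub_damp_le_of_le_sq ha0 ht he hae
  set Z : ℝ := Real.pi * (2 * D) ^ (d - 2) with hZ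
  have hZ0 : 0 ≤ Z := by positivity
  have hc1 : |4 * kx k * (Real.pi * (damp (2 * a) t - t) * (kx k * Ig))| ≤
      4 * Real.pi * (t * (2 * e)) * (D * (Cin ^ 2 * Z)) := by
    have h1 : |4 * kx k * (Real.pi * (damp (2 * a) t - t) * (kx k * Ig))| =
        4 * Real.pi * |damp (2 * a) t - t| * (|kx k| * (|kx k| * |Ig|)) := by
      simp only [abs_mul, abs_of_pos hpi, abs_of_pos (by norm_num : (0 : ℝ) < 4)]
      ring
    rw [h1]
    gcongr
  have hc2 : |8 * kx k * (Real.pi * (damp a t - t) * (n k * Il))| ≤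
      8 * Real.pi * (t * e) * (Cin ^ 2 * D * Z) := by
    have h1 : |8 * kx k * (Real.pi * (damp a t - t) * (n k * Il))| =
        8 * Real.pi * |damp a t - t| * (|kx k| * |n k * Il|) := by
      simp only [abs_mul, abs_of_pos hpi, abs_of_pos (by norm_num : (0 : ℝ) < 8)]
      ring
    rw [h1]
    gcongr
  unfold latticeCorr
  rw [← ha]
  generalize (∑ K ∈ box d L D, kx k * (n (pt L K) * n (k - pt L K)) *
      timeKernel (2 * a) a t (Om (pt L K) (k - pt L K) k)) = Sg at *
  generalize (∑ K ∈ box d L D, n k * (kx (pt L K) * n (k - pt L K)) *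
      timeKernel a (ν * ‖pt L K‖ ^ 2) t (Om (pt L K) (k - pt L K) k)) = Sl at *
  generalize (∫ q, kx k * (n ((1 / 2 : ℝ) • k - q) * n ((1 / 2 : ℝ) • k + q)) *
      timeKernel (2 * a) a t (res k q)) = Xg at *
  generalize (∫ q, n k * (kx ((1 / 2 : ℝ) • k - q) * n ((1 / 2 : ℝ) • k + q)) *
      timeKernel a (ν * ‖(1 / 2 : ℝ) • k - q‖ ^ 2) t (res k q)) = Xl at *
  have e1 : |4 * kx k * (1 / L ^ d * Sg - Xg)| ≤ 4 * D * (M₃ * E') := by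
    rw [abs_mul, abs_mul, abs_of_pos (by norm_num : (0 : ℝ) < 4)]
    gcongr
  have e2 : |8 * kx k * (1 / L ^ d * Sl - Xl)| ≤ 8 * D * (M₄ * E') := by
    rw [abs_mul, abs_mul, abs_of_pos (by norm_num : (0 : ℝ) < 8)]
    gcongr
  have e3 : |4 * kx k * (Xg - Real.pi * damp (2 * a) t * (kx k * Ig))| ≤ 4 * (M₁ * E) := by
    rw [abs_mul, abs_mul, abs_of_pos (by norm_num : (0 : ℝ) < 4), mul_assoc]
    gcongr
  have e4 : |8 * kx k * (Xl - Real.pi * damp a t * (n k * Il))| ≤ 8 * (M₂ * E) := by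
    rw [abs_mul, abs_mul, abs_of_pos (by norm_num : (0 : ℝ) < 8), mul_assoc]
    gcongr
  have hdec : 1 / L ^ d * (4 * kx k * Sg - 8 * kx k * Sl) - 4 * Real.pi * t * collision n k =
      4 * kx k * (1 / L ^ d * Sg - Xg) - 8 * kx k * (1 / L ^ d * Sl - Xl) +
      4 * kx k * (Xg - Real.pi * damp (2 * a) t * (kx k * Ig)) -
      8 * kx k * (Xl - Real.pi * damp a t * (n k * Il)) +
      4 * kx k * (Real.pi * (damp (2 * a) t - t) * (kx k * Ig)) -
      8 * kx k * (Real.pi * (damp a t - t) * (n k * Il)) := by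
    rw [hcoll]
    ring
  have hfin : 16 * Real.pi ^ 2 * (Cin ^ 2 * D * (2 * D) ^ (d - 2)) * (t * e) =
      4 * Real.pi * (t * (2 * e)) * (D * (Cin ^ 2 * Z)) +
        8 * Real.pi * (t * e) * (Cin ^ 2 * D * Z) := by
    rw [hZ]
    ring
  have p1 := mul_nonneg hM₁ hE'0
  have p2 := mul_nonneg hM₂ hE'0
  have p3 := mul_nonneg (mul_nonneg hD.le hM₃) hE0
  have p4 := mul_nonneg (mul_nonneg hD.le hM₄) hE0
  rw [hdec, hfin]
  rw [abs_le] at e1 e2 e3 e4 hc1 hc2 ⊢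
  constructor <;> linarith

end ZK

end

noncomputable section

namespace ZK

variable {d : ℕ}


/-! ### The kinetic approximation of the first correction -/

theorem alpha_sq {L : ℝ} (hL : 0 < L) (lam : ℝ) : alpha d L lam ^ 2 = lam ^ 2 / L ^ d := by
  have h : (L ^ (-(d : ℝ) / 2)) ^ 2 = (L ^ d)⁻¹ := by
    rw [← Real.rpow_natCast, ← Real.rpow_mul hL.le, Nat.cast_ofNat, div_mul_cancel₀ _ two_ne_zero,
      Real.rpow_neg hL.le, Real.rpow_natCast]
  rw [alpha, mul_pow, h, div_eq_mul_inv]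

/-- By evenness the support contains `-x` with `x`, at distance `2‖x‖`. -/
theorem eq_zero_of_diam_le {n : Vec d → ℝ} (hc : HasCompactSupport n) {D : ℝ}
    (hD : Metric.diam (Function.support n) ≤ D) (heven : ∀ x, n (-x) = n x) (x : Vec d)
    (hx : D / 2 < ‖x‖) : n x = 0 := by
  by_contra h
  have h1 := Metric.dist_le_diam_of_mem (hc.isBounded.subset (subset_tsupport n)) (x := x) (y := -x)
    h (by rwa [Function.mem_support, heven])
  rw [dist_eq_norm, sub_neg_eq_add, ← two_smul ℝ x, norm_smul, Real.norm_two] at h1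
  linarith

/-- Here `x = L^{-ε/400}`, `η = x⁴` and `δ = x⁴⁰`. Then `√η = x²`, `δ/η⁶ = x¹⁶`, and the negative
powers `x⁻⁵²`, `x⁻²⁴` are beaten by `T ≥ x⁻⁴⁰⁰`. All terms are `O(T x²)`, and one factor `x` absorbs
the constant `M(4 + 2^N)`. -/
theorem error_le {x t T L M : ℝ} {N : ℕ} (hx0 : 0 < x) (hx : x ≤ 3 / 8) (ht : 0 ≤ t) (htT : t ≤ T)
    (hT1 : 1 ≤ T) (hTx : 1 ≤ T * x ^ 400) (hTL : T ≤ L * x ^ 400) (hL : L * x ^ (400 * N) ≤ x ^ 2)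
    (hM : 0 ≤ M) (hMx : M * (4 + 2 ^ N) * x ≤ 1) :
    M * (t * Real.sqrt (x ^ 4) + t * x ^ 40 / (x ^ 4) ^ 6 + 1 / (x ^ 40 * (x ^ 4) ^ 3) +
      1 / (x ^ 4) ^ 6 + t ^ 2 * ((1 + t) / L) ^ N) ≤ T * x := by
  have hx1 : x ≤ 1 := by linarith
  have hT0 : 0 < T := by linarith
  have hx400 : 0 < x ^ 400 := by positivity
  have hL0 : 0 < L := by
    by_contra! h
    nlinarith
  have hTL' : T ≤ L := hTL.trans (mul_le_of_le_one_right hL0.le (pow_le_one₀ hx0.le hx1))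
  have e1 : t * Real.sqrt (x ^ 4) ≤ T * x ^ 2 := by
    rw [show x ^ 4 = (x ^ 2) ^ 2 by ring, Real.sqrt_sq (by positivity)]
    gcongr
  have e2 : t * x ^ 40 / (x ^ 4) ^ 6 ≤ T * x ^ 2 := by
    rw [div_le_iff₀ (by positivity)]
    have : x ^ 40 ≤ x ^ 26 := pow_le_pow_of_le_one hx0.le hx1 (by norm_num)
    calc t * x ^ 40 ≤ T * x ^ 26 := by gcongr
      _ = T * x ^ 2 * (x ^ 4) ^ 6 := by ring
  have e3 : ∀ m : ℕ, m ≤ 398 → 1 / x ^ m ≤ T * x ^ 2 := by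
    intro m hm
    rw [div_le_iff₀ (by positivity), mul_assoc, ← pow_add]
    exact hTx.trans (mul_le_mul_of_nonneg_left
      (pow_le_pow_of_le_one hx0.le hx1 (by omega)) hT0.le)
  have e4 : 1 / (x ^ 40 * (x ^ 4) ^ 3) ≤ T * x ^ 2 := by
    rw [← pow_mul, ← pow_add]
    exact e3 _ (by norm_num)
  have e5 : 1 / (x ^ 4) ^ 6 ≤ T * x ^ 2 := by
    rw [← pow_mul]
    exact e3 _ (by norm_num)
  have e6 : t ^ 2 * ((1 + t) / L) ^ N ≤ 2 ^ N * (T * x ^ 2) := by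
    have h1 : (1 + t) / L ≤ 2 * x ^ 400 := by
      rw [div_le_iff₀ hL0]
      linarith
    calc t ^ 2 * ((1 + t) / L) ^ N ≤ (T * L) * (2 * x ^ 400) ^ N := by
          rw [sq]
          gcongr
          exact htT.trans hTL'
      _ = 2 ^ N * (T * (L * x ^ (400 * N))) := by
          rw [mul_pow, ← pow_mul]
          ring
      _ ≤ _ := by gcongr
  calc _ ≤ M * (T * x ^ 2 + T * x ^ 2 + T * x ^ 2 + T * x ^ 2 + 2 ^ N * (T * x ^ 2)) := by gcongr
    _ = T * x * (M * (4 + 2 ^ N) * x) := by ring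
    _ ≤ T * x * 1 := by gcongr
    _ = T * x := mul_one _

/-- Multiplication by `α²`; since `D ≥ 1`, the natural power `D^{d-1}` is at most the `D^{d+1}` of
the error function. -/
theorem abs_sq_mul_sub_le (hd : 3 ≤ d) {S K t T x α Cin D e : ℝ} (hD : 1 ≤ D) (he : 0 ≤ e)
    (ht : 0 ≤ t) (htT : t ≤ T) (hx : 0 ≤ x) (h : |S - 4 * Real.pi * t * K| ≤
      T * x + 16 * Real.pi ^ 2 * (Cin ^ 2 * D * (2 * D) ^ (d - 2)) * (t * e)) :
    |α ^ 2 * S - 4 * Real.pi * α ^ 2 * t * K| ≤ 1 * (x * (4 * Real.pi * α ^ 2 * T)) +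
      4 * Real.pi * 2 ^ (d - 2) * Cin ^ 2 * (e * D ^ (d + 1) * (4 * Real.pi * α ^ 2 * T)) := by
  have hT : 0 ≤ T := ht.trans htT
  have hS : Cin ^ 2 * D * (2 * D) ^ (d - 2) * (t * e) ≤
      2 ^ (d - 2) * Cin ^ 2 * (e * D ^ (d + 1) * T) := by
    have h1 : D * D ^ (d - 2) ≤ D ^ (d + 1) := by
      rw [← pow_succ']
      exact pow_le_pow_right₀ hD (by omega)
    calc Cin ^ 2 * D * (2 * D) ^ (d - 2) * (t * e) =
          2 ^ (d - 2) * Cin ^ 2 * (e * (D * D ^ (d - 2)) * t) := by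
          rw [mul_pow]
          ring
      _ ≤ _ := by gcongr
  have h4 : (1 : ℝ) ≤ 4 * Real.pi := by linarith [Real.pi_gt_three]
  rw [show α ^ 2 * S - 4 * Real.pi * α ^ 2 * t * K = α ^ 2 * (S - 4 * Real.pi * t * K) by ring,
    abs_mul, abs_of_nonneg (sq_nonneg α)]
  calc _ ≤ α ^ 2 * (4 * Real.pi * (T * x) + 16 * Real.pi ^ 2 *
        (2 ^ (d - 2) * Cin ^ 2 * (e * D ^ (d + 1) * T))) := by
        refine mul_le_mul_of_nonneg_left (h.trans (add_le_add ?_ ?_)) (sq_nonneg α)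
        · exact le_mul_of_one_le_left (mul_nonneg hT hx) h4
        · rw [mul_assoc]
          exact mul_le_mul_of_nonneg_left hS (by positivity)
    _ = _ := by ring

variable [NeZero d]

theorem nCorr_eq_latticeCorr {S : Type*} [MeasurableSpace S] {μ : Measure S}
    {η : (Fin d → ℤ) → S → ℂ} (h : IsGaussianData μ η) {L : ℝ} (hL : 1 ≤ L) (lam ν : ℝ)
    {n : Vec d → ℝ} (h0 : ∀ k, 0 ≤ n k) (heven : ∀ k, n (-k) = n k) {D : ℝ} (hD : 0 ≤ D)
    (hsupp : ∀ x, D / 2 < ‖x‖ → n x = 0) (t : ℝ) {K : Fin d → ℤ} (hK0 : K ≠ 0) :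
    nCorr μ L lam ν n η 1 t K = ((alpha d L lam ^ 2 * latticeCorr n D ν t L (pt L K) : ℝ) : ℂ) := by
  classical
  have hbox : ∀ K₁ ∉ box d L D, D < ‖pt L K₁‖ := fun K₁ hK₁ => by
    simpa using lt_norm_of_notMem_box hL hK₁ (zero_mem_cell hL)
  -- Adding the reflected box makes the index set stable under `K₁ ↦ K - K₁`; the added points
  -- contribute nothing to the sums.
  set Λ : Finset (Fin d → ℤ) := box d L D ∪ (box d L D).image (fun K₁ => K - K₁) with hΛ
  have hsub : box d L D ⊆ Λ := Finset.subset_union_left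
  have hsum : ∀ f : (Fin d → ℤ) → ℝ, (∀ K₁ ∉ box d L D, f K₁ = 0) →
      ∑ K₁ ∈ Λ, f K₁ = ∑ K₁ ∈ box d L D, f K₁ := fun f hf =>
    (Finset.sum_subset hsub fun K₁ _ hK₁ => hf K₁ hK₁).symm
  rw [nCorr_eq h L lam ν n h0 heven Λ (fun K₁ hK₁ => hsupp _ (by
    linarith [hbox K₁ fun hb => hK₁ (hsub hb)])) t hK0]
  · simp only [pt_sub, latOm]
    rw [hsum _ fun K₁ hK₁ => by rw [hsupp (pt L K₁) (by linarith [hbox K₁ hK₁]), zero_mul, zero_mul],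
      hsum _ fun K₁ hK₁ => by rw [mul_kx_mul_eq_zero hsupp (hbox K₁ hK₁), zero_mul]]
    congr 1
    have hL0 : 0 < L := by linarith
    rw [alpha_sq hL0, latticeCorr]
    simp only [mul_assoc (kx (pt L K))]
    rw [← Finset.mul_sum]
    field_simp
  · intro K₁ hK₁
    rw [hΛ, Finset.mem_union, Finset.mem_image] at hK₁ ⊢
    rcases hK₁ with hK₁ | ⟨K₂, hK₂, rfl⟩
    · exact Or.inr ⟨K₁, hK₁, rfl⟩
    · left
      rwa [sub_sub_cancel]

theorem nCorr_of_lt_norm {S : Type*} [MeasurableSpace S] {μ : Measure S}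
    {η : (Fin d → ℤ) → S → ℂ} (h : IsGaussianData μ η) {L : ℝ} (hL : 1 ≤ L) (lam ν : ℝ)
    {n : Vec d → ℝ} (h0 : ∀ k, 0 ≤ n k) (heven : ∀ k, n (-k) = n k) {D : ℝ} (hD : 0 ≤ D)
    (hsupp : ∀ x, D / 2 < ‖x‖ → n x = 0) (t : ℝ) {K : Fin d → ℤ} (hK : D < ‖pt L K‖) :
    nCorr μ L lam ν n η 1 t K = 0 := by
  have hK0 : K ≠ 0 := by
    rintro rfl
    rw [pt_zero, norm_zero] at hK
    linarith
  have h1 : ∀ x, n x * n (pt L K - x) = 0 := fun x => by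
    rcases lt_or_ge (D / 2) ‖x‖ with hx | hx
    · rw [hsupp x hx, zero_mul]
    · rw [hsupp (pt L K - x) (by linarith [norm_sub_norm_le (pt L K) x]), mul_zero]
  rw [nCorr_eq_latticeCorr h hL lam ν h0 heven hD hsupp t hK0, latticeCorr]
  simp [h1, hsupp (pt L K) (by linarith)]

end ZK

end

/-! ### Choice of constants and conclusion. -/

theorem proposition3 (d : ℕ) [NeZero d] (hd : 3 ≤ d) :
    ∃ C₁ > (0 : ℝ), ∃ B > (0 : ℝ),
    ∀ c > (0 : ℝ), ∀ C₂ > (0 : ℝ), ∀ D > (0 : ℝ),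
    ∃ C > (0 : ℝ),
    ∀ ε > (0 : ℝ), ∀ ε₁ > (0 : ℝ), ∀ (Cin : ℝ) (nin : ZK.Vec d → ℝ),
      ContDiff ℝ ∞ nin → HasCompactSupport nin → Metric.diam (Function.support nin) ≤ D →
      (∀ k, 0 ≤ nin k) → (∀ k, nin (-k) = nin k) → (∀ k, nin k ≤ Cin) →
    ∃ L₀ > (0 : ℝ), ∀ L lam ν : ℝ, L₀ ≤ L → 0 < lam →
      (ZK.alpha d L lam)⁻¹ ≤ L ^ (1 / 2 : ℝ) →
      c ^ 2 * (ZK.Tmax d L lam ε)⁻¹ ≤ ν →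
      D ≤ C₂ * (ZK.dissLength d L lam ε ν)⁻¹ →
    ∀ {S : Type*} [MeasurableSpace S] (μ : Measure S) [IsProbabilityMeasure μ]
      (η : (Fin d → ℤ) → S → ℂ), ZK.IsGaussianData μ η →
    ∀ t : ℝ, L ^ ε ≤ t → t ≤ ZK.Tmax d L lam ε →
    ∀ K : Fin d → ℤ,
      (1 ≤ D → ‖ZK.pt L K‖ ≤ ε₁ * (ZK.dissLength d L lam ε ν)⁻¹ →
        (ZK.kx (ZK.pt L K) ≠ 0 → ZK.CollisionExists nin (ZK.pt L K)) ∧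
        ‖ZK.nCorr μ L lam ν nin η 1 t K
            - ((t / ZK.Tkin d L lam * ZK.collision nin (ZK.pt L K) : ℝ) : ℂ)‖
          ≤ C * (L ^ (-(C₁⁻¹ * ε)) * (ZK.Tmax d L lam ε / ZK.Tkin d L lam))
            + B * Cin ^ 2 * (ε₁ * ZK.errD d D (ZK.kx (ZK.pt L K))
                * (ZK.Tmax d L lam ε / ZK.Tkin d L lam))) ∧
      (2 * C₂ * (ZK.dissLength d L lam ε ν)⁻¹ ≤ ‖ZK.pt L K‖ →
        ZK.nCorr μ L lam ν nin η 1 t K = 0) := by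
  have hpi := Real.pi_pos
  -- With `C₁ = 400` the target factor is `x = L^{-ε/400}`. The value of `B` is `16π² 2^{d-2}`
  -- divided by the `4π` contained in `1/T_kin`.
  refine ⟨400, by norm_num, 4 * Real.pi * 2 ^ (d - 2), by positivity, ?_⟩
  intro c hc C₂ hC₂ D hD
  -- `C = 1` suffices because the constants depending on `n_in` are absorbed by taking `L` large.
  refine ⟨1, one_pos, ?_⟩
  intro ε hε ε₁ hε₁ Cin nin hn hcs hdiam h0 heven hC
  have hsupp := ZK.eq_zero_of_diam_le hcs hdiam heven
  -- This `N` gives `L · L^{-εN} ≤ L^{-ε}`.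
  obtain ⟨N, hN⟩ := exists_nat_ge (1 / ε + 1)
  -- The bound `(C₂/D)²` for `νt` comes from `νT_max = l_d²` and `D ≤ C₂ l_d⁻¹`.
  obtain ⟨M, hM, hmain⟩ := ZK.exists_latticeCorr_bound hd hn heven hD h0 hC hsupp ((C₂ / D) ^ 2) N
  have hlarge : ∀ᶠ L : ℝ in atTop, L ^ (-(400⁻¹ * ε)) ≤
      min (3 / 8) (1 / (M * (4 + 2 ^ N) + 1)) :=
    (tendsto_rpow_neg_atTop (by positivity)).eventually (ge_mem_nhds (by positivity))
  obtain ⟨L₁, hL₁⟩ := eventually_atTop.1 hlarge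
  refine ⟨max 1 L₁, by positivity, ?_⟩
  intro L lam ν hL hlam hα hν hDC S _ μ _ η hη t htl htT K
  have hL1 : 1 ≤ L := (le_max_left _ _).trans hL
  have hL0 : 0 < L := by linarith
  set x : ℝ := L ^ (-(400⁻¹ * ε)) with hx
  have hx0 : 0 < x := Real.rpow_pos_of_pos hL0 _
  have hxm := hL₁ L ((le_max_right _ _).trans hL)
  have hx38 : x ≤ 3 / 8 := hxm.trans (min_le_left _ _)
  have hxM : M * (4 + 2 ^ N) * x ≤ 1 := by
    have h1 : x ≤ _ := hxm.trans (min_le_right _ _)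
    rw [le_div_iff₀ (by positivity)] at h1
    linarith
  have hx400 : x ^ 400 = L ^ (-ε) := by
    rw [hx, ← Real.rpow_natCast, ← Real.rpow_mul hL0.le]
    congr 1
    push_cast
    ring
  have hα0 : 0 < ZK.alpha d L lam := mul_pos hlam (Real.rpow_pos_of_pos hL0 _)
  set α := ZK.alpha d L lam with hαdef
  have hTdef : ZK.Tmax d L lam ε = L ^ (-ε) * (α ^ 2)⁻¹ := rfl
  set T := ZK.Tmax d L lam ε with hT
  have hT1 : L ^ ε ≤ T := htl.trans htT
  have hLε : 0 < L ^ ε := Real.rpow_pos_of_pos hL0 _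
  have hLε1 : 1 ≤ L ^ ε := Real.one_le_rpow hL1 hε.le
  have hT0 : 0 < T := hLε.trans_le hT1
  have ht0 : 0 ≤ t := hLε.le.trans htl
  -- The assumption `α⁻¹ ≤ L^{1/2}` gives `T_max ≤ L^{1-ε}`: frequencies stay below the lattice
  -- scale.
  have hTL : T ≤ L * x ^ 400 := by
    have h1 : (α ^ 2)⁻¹ ≤ L := by
      rw [← inv_pow]
      calc α⁻¹ ^ 2 ≤ (L ^ (1 / 2 : ℝ)) ^ 2 := by gcongr
        _ = L := by
          rw [← Real.rpow_natCast, ← Real.rpow_mul hL0.le]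
          norm_num
    rw [hTdef, hx400, mul_comm L]
    gcongr
  have hTx : 1 ≤ T * x ^ 400 := by
    rw [hx400, Real.rpow_neg hL0.le, ← div_eq_mul_inv, le_div_iff₀ hLε, one_mul]
    exact hT1
  have hLN : L * x ^ (400 * N) ≤ x ^ 2 := by
    have h1 : L * x ^ (400 * N) = L ^ (1 - ε * N) := by
      rw [pow_mul, hx400, ← Real.rpow_natCast, ← Real.rpow_mul hL0.le, sub_eq_add_neg,
        Real.rpow_add hL0, Real.rpow_one, neg_mul]
    have h2 : 1 - ε * N ≤ -ε := by
      have := mul_le_mul_of_nonneg_left hN hε.le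
      rw [mul_add, mul_one_div_cancel hε.ne'] at this
      linarith
    rw [h1]
    calc L ^ (1 - ε * N) ≤ L ^ (-ε) := Real.rpow_le_rpow_of_exponent_le hL1 h2
      _ = x ^ 400 := hx400.symm
      _ ≤ x ^ 2 := pow_le_pow_of_le_one hx0.le (by linarith) (by norm_num)
  have hν0 : 0 < ν := lt_of_lt_of_le (by positivity) hν
  set l := ZK.dissLength d L lam ε ν with hl
  have hl2 : l ^ 2 = ν * T := Real.sq_sqrt (by positivity)
  have hl0 : 0 < l := Real.sqrt_pos.2 (by positivity)
  have hlD : l ≤ C₂ / D := by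
    rw [← div_eq_mul_inv, le_div_iff₀ hl0] at hDC
    rw [le_div_iff₀ hD]
    linarith
  have hνT : ν * T ≤ (C₂ / D) ^ 2 := by
    rw [← hl2]
    gcongr
  have hνt : ν * t ≤ (C₂ / D) ^ 2 := (mul_le_mul_of_nonneg_left htT hν0.le).trans hνT
  have hTk : ∀ s, s / ZK.Tkin d L lam = 4 * Real.pi * α ^ 2 * s := fun s => by
    rw [ZK.Tkin, div_div_eq_mul_div, div_one, mul_comm]
  have hzero : D < ‖ZK.pt L K‖ → ZK.nCorr μ L lam ν nin η 1 t K = 0 :=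
    ZK.nCorr_of_lt_norm hη hL1 lam ν h0 heven hD.le hsupp t
  have hCin : 0 ≤ Cin := (h0 0).trans (hC 0)
  clear_value x
  refine ⟨fun hD1 hk => ⟨fun hkx => ?_, ?_⟩, fun hk => hzero ?_⟩
  · obtain ⟨-, -, -, -, h, -⟩ := ZK.exists_shellAvg_gain_loss hn (by positivity) hsupp hkx
    exact h
  · have herr : 0 ≤ ZK.errD d D (ZK.kx (ZK.pt L K)) := by
      unfold ZK.errD
      split_ifs <;> positivity
    have hrhs : 0 ≤ 1 * (x * (T / ZK.Tkin d L lam)) + 4 * Real.pi * 2 ^ (d - 2) * Cin ^ 2 *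
        (ε₁ * ZK.errD d D (ZK.kx (ZK.pt L K)) * (T / ZK.Tkin d L lam)) := by
      rw [hTk]
      positivity
    -- Outside the ball of radius `D`, and for `k_x = 0`, both sides vanish. In the remaining case
    -- `|k_x| ≤ D`, which selects the branch `D^{d+1}` of the error function.
    by_cases hkD : D < ‖ZK.pt L K‖
    · rw [hzero hkD, ZK.collision_of_lt_norm hsupp (by positivity) (by linarith)]
      simpa using hrhs
    by_cases hkx : ZK.kx (ZK.pt L K) = 0
    · rw [ZK.nCorr_of_kx_eq_zero μ lam ν nin η t hkx, ZK.collision_of_kx_eq_zero nin hkx]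
      simpa using hrhs
    rw [not_lt] at hkD
    have hK0 : K ≠ 0 := by
      rintro rfl
      rw [ZK.pt_zero] at hkx
      exact hkx rfl
    have he : ν * ‖ZK.pt L K‖ ^ 2 * t ≤ ε₁ ^ 2 := by
      rw [← div_eq_mul_inv, le_div_iff₀ hl0] at hk
      calc ν * ‖ZK.pt L K‖ ^ 2 * t ≤ ν * ‖ZK.pt L K‖ ^ 2 * T := by gcongr
        _ = (‖ZK.pt L K‖ * l) ^ 2 := by rw [mul_pow, hl2]; ring
        _ ≤ ε₁ ^ 2 := by gcongr
    have hb := hmain _ hkD hkx ν t L (x ^ 4) (x ^ 40) ε₁ hν0.le ht0 hνt hL1 (by positivity)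
      (by positivity) (by
        have h1 : x ^ 28 ≤ x ^ 1 := pow_le_pow_of_le_one hx0.le (by linarith) (by norm_num)
        calc x ^ 40 = x ^ 28 * x ^ 12 := by ring
          _ ≤ 3 / 8 * x ^ 12 := by
            gcongr
            linarith
          _ = 3 / 8 * (x ^ 4) ^ 3 := by ring) hε₁.le he
    have hE := ZK.error_le hx0 hx38 ht0 htT (hLε1.trans hT1) hTx hTL hLN hM hxM
    rw [ZK.nCorr_eq_latticeCorr hη hL1 lam ν h0 heven hD.le hsupp t hK0, hTk, hTk, ← hαdef,
      ← Complex.ofReal_sub, Complex.norm_real, Real.norm_eq_abs,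
      show ZK.errD d D (ZK.kx (ZK.pt L K)) = D ^ (d + 1) from
        if_pos ((ZK.abs_kx_le _).trans hkD)]
    exact ZK.abs_sq_mul_sub_le hd hD1 hε₁.le ht0 htT hx0.le (hb.trans (add_le_add hE le_rfl))
  -- The factor `2` turns `D ≤ C₂ l_d⁻¹` into a strict inequality, as needed to be outside the
  -- support.
  · have h1 : D < 2 * C₂ * l⁻¹ := by linarith
    exact h1.trans_le hk
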